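/- Let $G$ be a finite simple graph. All drawings are in general position: for a surface $S\in\{S^2,\mathbb{RP}^2\}$, a drawing $D$ of $G$ on $S$ maps the vertices to distinct points and each edge $e$ to a simple (self-crossing free), piecewise $C^1$ arc $D(e)$ joining its end vertices and containing no vertex in its interior; here an arc is piecewise $C^1$ if it has a continuous injective parametrization on $[0,1]$ that is a $C^1$ immersion at all but finitely many parameters. The interiors of two distinct edges meet in finitely many points, and at each of these both arcs are $C^1$ immersed and cross transversally (several edges may pass through one point). Let $\mathrm{cr}_D(e,f)\in\mathbb Z_2$ be the number of common points of the interiors of the distinct edges $e,f$, modulo $2$. Edges are independent if they share no vertex. A drawing is an HT-drawing (Hanani–Tutte drawing) if $\mathrm{cr}_D(e,f)=0$ for all independent edges $e,f$. A projective HT-drawing of $G$ on $S^2$ is a pair $(D,\lambda)$ of a drawing $D$ of $G$ on $S^2$ and a function $\lambda\colon E(G)\to\mathbb Z_2$ such that $\mathrm{cr}_D(e,f)=\lambda(e)\lambda(f)$ for all independent edges $e,f$. View $\mathbb{RP}^2$ as the quotient of the unit sphere by the antipodal map; the crosscap is the image of the equator. (1) $G$ admits a projective HT-drawing on $S^2$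 (with respect to some $\lambda\colon E(G)\to\mathbb Z_2$) if and only if $G$ admits an HT-drawing on $\mathbb{RP}^2$. (2) Let $(D,\lambda)$ be a projective HT-drawing of $G$ on $S^2$. Then there is an HT-drawing $D_\otimes$ of $G$ on $\mathbb{RP}^2$ such that - $\mathrm{cr}_{D_\otimes}(e,f)=\mathrm{cr}_D(e,f)+\lambda(e)\lambda(f)$ for every pair of distinct edges $e,f$, possibly adjacent; - if $\lambda(e)=\lambda(f)=0$ and $D(e)$, $D(f)$ are disjoint, then $D_\otimes(e)$, $D_\otimes(f)$ are disjoint; likewise, if $\lambda(e)=\lambda(f)=0$ and the interiors of the arcs $D(e)$, $D(f)$ are disjoint, then so are the interiors of $D_\otimes(e)$, $D_\otimes(f)$; - no vertex lies on the crosscap, every edge $e$ with $\lambda(e)=0$ avoids the crosscap, and every edge $e$ with $\lambda(e)=1$ meets the crosscap in exactly one point, an interior point of $e$, where it crosses the crosscap transversally. -/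

import Mathlib

namespace ProjHT

/-- Euclidean 3-space. -/
abbrev E3 : Type := EuclideanSpace ℝ (Fin 3)

/-- The sphere `S²`. -/
abbrev S2 : Type := Metric.sphere (0 : E3) 1

/-- Two points of the sphere are equivalent when they are equal or antipodal. -/
def antipodal : Setoid S2 where
  r x y := x = y ∨ x = -y
  iseqv :=
    { refl := fun _ => Or.inl rfl
      symm := by
        rintro x y (h | h)
        · exact Or.inl h.symm
        · exact Or.inr (by rw [h, neg_neg])
      trans := by
        rintro x y z (h | h) (k | k)
        · exact Or.inl (h.trans k)
        · exact Or.inr (h.trans k)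
        · exact Or.inr (by rw [h, k])
        · exact Or.inl (by rw [h, k, neg_neg]) }

/-- The real projective plane, with the quotient topology. -/
abbrev RP2 : Type := Quotient antipodal

/-- The quotient map `S² → ℝP²`. -/
def toRP2 (x : S2) : RP2 := Quotient.mk antipodal x

section Curves

variable {S : Type} (π : S2 → S)

/- Below `π : S² → S` is either the identity of `S²` or the two-fold covering `S² → ℝP²`.  In both
cases it is a local diffeomorphism, so that differential properties of curves in `S` can be read
off from local lifts to `S² ⊆ ℝ³`. -/

/-- Near the parameter `t`, the curve `x` in `ℝ³` runs on the sphere, is a lift of the curve `c`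
through `π`, is continuously differentiable, and its velocity at `t` does not vanish. -/
def IsRegularLiftAt (c : ℝ → S) (t : ℝ) (x : ℝ → E3) : Prop :=
  (∀ᶠ r in nhds t, ∃ h : x r ∈ Metric.sphere (0 : E3) 1, π ⟨x r, h⟩ = c r) ∧
    ContDiffAt ℝ 1 x t ∧ deriv x t ≠ 0

/-- The curve `c` is a `C¹` immersion near the parameter `t`. -/
def RegularAt (c : ℝ → S) (t : ℝ) : Prop :=
  ∃ x : ℝ → E3, IsRegularLiftAt π c t x

/-- The curves `c` and `d` meet at the parameters `s` and `t`, where both are `C¹` immersions and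
their tangent directions differ. -/
def CrossTransversally (c : ℝ → S) (s : ℝ) (d : ℝ → S) (t : ℝ) : Prop :=
  ∃ x y : ℝ → E3, IsRegularLiftAt π c s x ∧ IsRegularLiftAt π d t y ∧ x s = y t ∧
    LinearIndependent ℝ ![deriv x s, deriv y t]

end Curves

/-- A drawing in general position of the graph `G` on the surface `S` (see above for `π`).
Vertices are distinct points; an edge is a simple arc, parametrized by `[0,1]`, joining its two end
vertices, a `C¹` immersion at all but finitely many parameters, with no vertex in its interior;
distinct edges meet, apart from common end vertices, in finitely many points, at which they cross
transversally.  Several edges may pass through the same point. -/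
structure Drawing {S : Type} [TopologicalSpace S] (π : S2 → S) {V : Type*}
    (G : SimpleGraph V) where
  vertex : V → S
  vertex_injective : Function.Injective vertex
  curve : G.edgeSet → ℝ → S
  curve_continuousOn : ∀ e, ContinuousOn (curve e) (Set.Icc 0 1)
  curve_injOn : ∀ e, Set.InjOn (curve e) (Set.Icc 0 1)
  curve_ends : ∀ e : G.edgeSet, ∃ u v : V, (e : Sym2 V) = s(u, v) ∧
    curve e 0 = vertex u ∧ curve e 1 = vertex v
  curve_ne_vertex : ∀ e, ∀ t ∈ Set.Ioo (0 : ℝ) 1, ∀ w, curve e t ≠ vertex w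
  curve_regular : ∀ e, {t ∈ Set.Ioo (0 : ℝ) 1 | ¬ RegularAt π (curve e) t}.Finite
  crossings_finite : ∀ e f, e ≠ f →
    (curve e '' Set.Ioo 0 1 ∩ curve f '' Set.Ioo 0 1).Finite
  crossings_transversal : ∀ e f, e ≠ f → ∀ s ∈ Set.Ioo (0 : ℝ) 1, ∀ t ∈ Set.Ioo (0 : ℝ) 1,
    curve e s = curve f t → CrossTransversally π (curve e) s (curve f) t

namespace Drawing

variable {S : Type} [TopologicalSpace S] {π : S2 → S} {V : Type*} {G : SimpleGraph V}

/-- The closed arc representing the edge `e`. -/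
def arc (D : Drawing π G) (e : G.edgeSet) : Set S := D.curve e '' Set.Icc 0 1

/-- The interior of the arc representing the edge `e`. -/
def openArc (D : Drawing π G) (e : G.edgeSet) : Set S := D.curve e '' Set.Ioo 0 1

/-- The number of crossings of two distinct edges, modulo 2. -/
noncomputable def cr (D : Drawing π G) (e f : G.edgeSet) : ZMod 2 :=
  ((D.openArc e ∩ D.openArc f).ncard : ZMod 2)

end Drawing

/-- Two edges are independent if they do not share a vertex. -/
def Independent {V : Type*} {G : SimpleGraph V} (e f : G.edgeSet) : Prop :=
  ∀ v : V, ¬ (v ∈ (e : Sym2 V) ∧ v ∈ (f : Sym2 V))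

/-- Hanani–Tutte drawings: independent edges cross an even number of times. -/
def IsHT {S : Type} [TopologicalSpace S] {π : S2 → S} {V : Type*} {G : SimpleGraph V}
    (D : Drawing π G) : Prop :=
  ∀ e f : G.edgeSet, Independent e f → D.cr e f = 0

/-- Drawings on the sphere. -/
abbrev SphereDrawing {V : Type*} (G : SimpleGraph V) := Drawing (id : S2 → S2) G

/-- Drawings on the projective plane. -/
abbrev RP2Drawing {V : Type*} (G : SimpleGraph V) := Drawing toRP2 G

/-- `(D, l)` is a projective Hanani–Tutte drawing on the sphere. -/
def IsProjectiveHT {V : Type*} {G : SimpleGraph V} (D : SphereDrawing G)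
    (l : G.edgeSet → ZMod 2) : Prop :=
  ∀ e f : G.edgeSet, Independent e f → D.cr e f = l e * l f

/-- A parametrization of the equator of the sphere. -/
noncomputable def equator (θ : ℝ) : S2 :=
  ⟨!₂[Real.cos θ, Real.sin θ, 0], by
    simp [EuclideanSpace.norm_eq, Fin.sum_univ_three]⟩

/-- The crosscap of `ℝP²`: the image of the equator.  Cutting the sphere along the equator and
keeping one closed hemisphere presents `ℝP²` as a sphere from which an open disk is removed and
opposite points of the boundary circle are identified; the crosscap is the image of this circle. -/
noncomputable def crosscap (θ : ℝ) : RP2 := toRP2 (equator θ)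

/-- The edge `e` passes through the crosscap exactly once, transversally, and not at an end. -/
def PassesOnce {V : Type*} {G : SimpleGraph V} (D : RP2Drawing G) (e : G.edgeSet) : Prop :=
  ∃ t ∈ Set.Ioo (0 : ℝ) 1, (∃ θ : ℝ, CrossTransversally toRP2 (D.curve e) t crosscap θ) ∧
    ∀ r ∈ Set.Icc (0 : ℝ) 1, D.curve e r ∈ Set.range crosscap → r = t

end ProjHT

/-!
Both directions rest on coordinates for the sphere without its poles. Central projection from a
cylinder (`pt`) makes the complex plane a covering of it, with the angle as imaginary and the height
as real part; the antipodal map is covered by `deck`, and it becomes `a ↦ -1 / conj a` in the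
coordinate `a = exp L` (`merc`). A rotation moves the poles into general position
(`exists_generic_rotation`); it exists because cones over piecewise `C¹` curves have dimension at
most two.

*From the projective plane to the sphere.* Lift every edge `e` to the sphere, starting at a chosen
lift of its first end; let `l e` tell whether the lift ends at the chosen lift of the second end or
at its antipode. Two edges with Mercator coordinates `a` and `b` cross where
`(a s - b t) * (1 + a s * conj (b t))` vanishes, the second factor accounting for the antipodal
lift. For independent edges this function has no zero on the boundary of the unit square, and
transversality makes its zeros nondegenerate, so that their number has the parity of the winding
number along the boundary (`windParity_card`). On the boundary one of the two curves stands still at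
an end, and the winding is a sum of angles swept by an edge around a vertex or its antipode.
Comparison with reference angles of pairs of vertices (`turns_parity`) shows that
`cr (e, f) = l e * l f + i (e, f) + N e x + N e y + N f u + N f v`, where `i (e, f)` is the parity of
the interleaving of the ends `u`, `v` of `e` and `x`, `y` of `f` in a fixed linear order of the
vertices, and `N` depends on one edge and one vertex (`exists_parity_formula`).

On the other hand, a drawing on the sphere can have the crossing parities `i (e, f) + N e x + N e y +
N f u + N f v` for any prescribed `N`: put the vertices on the equator and let every edge wind around
the axis from one end to the other, passing above or below each vertex as prescribed by `N`
(`exists_spiral_drawing`). If the given drawing is a Hanani–Tutte drawing, these parities equal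
`l e * l f`, which is what `exists_isProjectiveHT` claims.

*From the sphere to the projective plane.* In cylindrical coordinates, with the origin of the height
moved below the drawing, the drawing lies in an open hemisphere, hence in the projective plane
without the crosscap (`exists_cylDrawing`). By Sard's theorem almost every meridian avoids vertices
and crossings and is met transversally by all edges (`volume_not_generic`), so every edge `e` with
`l e = 1` has a point on such a meridian below which the edge does not meet the meridian again
(`exists_bases`). Replace a small part of `e` around this point by a thin finger: down one side,
by nearly half a turn through the crosscap, and back along the other side, whose lift to the sphere
is the antipodal one, below the equator (`exists_fingers`, `Fingers.mid`). Every other edge crosses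
the two sides of the finger equally often (`card_sideCrossings`), and any two fingers cross exactly
once, near the crosscap (`exists_mid_eq_mid_iff`). So precisely `l e * l f` is added to the crossing
parities, for adjacent edges as well (`card_crossPairs`), and edges with `l e = 0` are left as they
are (`exists_crosscap_drawing`).
-/

open Complex Set Filter Topology

namespace ProjHT

local notation "cj" => starRingEnd ℂ

/-! ### Cylindrical coordinates on the sphere and on the projective plane -/

/-- The point of `ℝ³` on the unit cylinder with angle `L.im` and height `L.re`. -/
noncomputable def cyl (L : ℂ) : E3 := !₂[Real.cos L.im, Real.sin L.im, L.re]

lemma norm_cyl_sq (L : ℂ) : ‖cyl L‖ ^ 2 = 1 + L.re ^ 2 := by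
  rw [EuclideanSpace.norm_sq_eq]
  simp [cyl, Fin.sum_univ_three]

lemma cyl_ne_zero (L : ℂ) : cyl L ≠ 0 := by
  intro h
  have := norm_cyl_sq L
  rw [h] at this
  simp at this
  nlinarith [sq_nonneg L.re]

lemma contDiff_cyl : ContDiff ℝ 1 cyl := by
  rw [contDiff_euclidean]
  intro i
  have hre : ContDiff ℝ 1 (fun L : ℂ => L.re) := Complex.reCLM.contDiff
  have him : ContDiff ℝ 1 (fun L : ℂ => L.im) := Complex.imCLM.contDiff
  fin_cases i
  · exact Real.contDiff_cos.comp him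
  · exact Real.contDiff_sin.comp him
  · exact hre

/-- Central projection of the cylinder to the sphere, as a map to `ℝ³`. -/
noncomputable def ptE (L : ℂ) : E3 := ‖cyl L‖⁻¹ • cyl L

lemma ptE_mem (L : ℂ) : ptE L ∈ Metric.sphere (0 : E3) 1 := by
  simp [ptE, norm_smul, cyl_ne_zero L]

/-- Central projection of the cylinder to the sphere.  The complex number `L` encodes the angle
`L.im` and the height `L.re`, so that this is a covering of the sphere without its poles. -/
noncomputable def pt (L : ℂ) : S2 := ⟨ptE L, ptE_mem L⟩

lemma contDiff_ptE : ContDiff ℝ 1 ptE := by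
  have h : ContDiff ℝ 1 fun L => ‖cyl L‖ :=
    contDiff_cyl.norm ℝ cyl_ne_zero
  exact (h.inv fun L => norm_ne_zero_iff.2 (cyl_ne_zero L)).smul contDiff_cyl

lemma continuous_pt : Continuous pt :=
  Continuous.subtype_mk contDiff_ptE.continuous _

/-- The horizontal part of a point of `ℝ³`, as a complex number. -/
noncomputable def horiz (x : E3) : ℂ := ⟨x 0, x 1⟩

/-- The Mercator-type coordinate of a point of `ℝ³` off the vertical axis: it is homogeneous of
degree `0`, inverts `pt` up to the exponential, and turns the antipodal map into `a ↦ -1 / conj a`. -/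
noncomputable def merc (x : E3) : ℂ :=
  (horiz x / (‖horiz x‖ : ℝ)) * Real.exp (x 2 / ‖horiz x‖)

lemma merc_smul {r : ℝ} (hr : 0 < r) (x : E3) : merc (r • x) = merc x := by
  have h1 : horiz (r • x) = r * horiz x := by
    apply Complex.ext <;> simp [horiz]
  have h2 : ‖horiz (r • x)‖ = r * ‖horiz x‖ := by
    rw [h1, norm_mul, Complex.norm_real, Real.norm_of_nonneg hr.le]
  have hr' : (r : ℂ) ≠ 0 := by exact_mod_cast hr.ne'
  unfold merc
  rw [h2, h1]
  congr 1
  · push_cast; rw [mul_div_mul_left _ _ hr']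
  · congr 2
    simp only [PiLp.smul_apply, smul_eq_mul]
    rw [mul_div_mul_left _ _ hr.ne']

lemma merc_ptE (L : ℂ) : merc (ptE L) = exp L := by
  rw [ptE, merc_smul (inv_pos.2 (norm_pos_iff.2 (cyl_ne_zero L)))]
  have h1 : horiz (cyl L) = exp (L.im * I) := by
    apply Complex.ext <;> simp [horiz, cyl, Complex.exp_ofReal_mul_I_re, Complex.exp_ofReal_mul_I_im]
  have h2 : ‖horiz (cyl L)‖ = 1 := by rw [h1, Complex.norm_exp_ofReal_mul_I]
  unfold merc
  rw [h2, h1]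
  simp only [cyl, ofReal_one, div_one]
  rw [Complex.ofReal_exp, ← Complex.exp_add]
  congr 1
  apply Complex.ext <;> simp

lemma merc_neg (x : E3) (hx : horiz x ≠ 0) : merc (-x) = -1 / (starRingEnd ℂ) (merc x) := by
  have h1 : horiz (-x) = -horiz x := by apply Complex.ext <;> simp [horiz]
  have hn : (‖horiz x‖ : ℂ) ≠ 0 := by exact_mod_cast norm_ne_zero_iff.2 hx
  have hc : (starRingEnd ℂ) (horiz x) ≠ 0 := by simpa using hx
  have hm : horiz x * (starRingEnd ℂ) (horiz x) = (‖horiz x‖ : ℂ) ^ 2 := Complex.mul_conj' _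
  unfold merc
  rw [h1, norm_neg]
  simp only [PiLp.neg_apply, map_mul, map_div₀, Complex.conj_ofReal, neg_div]
  rw [Real.exp_neg]
  have he : (Real.exp (x.ofLp 2 / ‖horiz x‖) : ℂ) ≠ 0 := by exact_mod_cast (Real.exp_pos _).ne'
  push_cast at he ⊢
  field_simp
  rw [hm]

lemma merc_ne_zero {x : E3} (hx : horiz x ≠ 0) : merc x ≠ 0 := by
  unfold merc
  refine mul_ne_zero (div_ne_zero hx ?_) ?_
  · exact_mod_cast norm_ne_zero_iff.2 hx
  · exact_mod_cast (Real.exp_pos _).ne'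

lemma contDiff_horiz : ContDiff ℝ 1 horiz := by
  have : horiz = fun x : E3 => (x 0 : ℂ) + (x 1 : ℂ) * I := by
    ext x; apply Complex.ext <;> simp [horiz]
  rw [this]
  have h (i : Fin 3) : ContDiff ℝ 1 fun x : E3 => (x i : ℂ) :=
    Complex.ofRealCLM.contDiff.comp (contDiff_piLp_apply (p := 2))
  exact (h 0).add ((h 1).mul contDiff_const)

lemma contDiffAt_merc {x : E3} (hx : horiz x ≠ 0) : ContDiffAt ℝ 1 merc x := by
  have hw := contDiff_horiz.contDiffAt (x := x)
  have hn : ContDiffAt ℝ 1 (fun x => ‖horiz x‖) x := hw.norm ℝ hx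
  have hn0 : ‖horiz x‖ ≠ 0 := norm_ne_zero_iff.2 hx
  have h2 : ContDiffAt ℝ 1 (fun x : E3 => x 2) x := (contDiff_piLp_apply (p := 2)).contDiffAt
  unfold merc
  simp only [div_eq_mul_inv (horiz _)]
  refine ContDiffAt.mul (hw.mul (ContDiffAt.inv ?_ ?_)) ?_
  · exact Complex.ofRealCLM.contDiff.contDiffAt.comp x hn
  · exact_mod_cast hn0
  · exact Complex.ofRealCLM.contDiff.contDiffAt.comp x
      (Real.contDiff_exp.contDiffAt.comp x (h2.div hn hn0))

/-- The point of the sphere with Mercator coordinate `a`. -/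
noncomputable def unmerc (a : ℂ) : E3 := ptE ⟨Real.log ‖a‖, a.arg⟩

lemma ptE_congr {L L' : ℂ} (h : exp L = exp L') : ptE L = ptE L' := by
  obtain ⟨n, hn⟩ := Complex.exp_eq_exp_iff_exists_int.1 h
  have hc : cyl L = cyl L' := by
    ext i
    have hr : L.re = L'.re := by rw [hn]; simp
    have hi : L.im = L'.im + n * (2 * Real.pi) := by rw [hn]; simp
    fin_cases i
    · simp [cyl, hi, Real.cos_add_int_mul_two_pi]
    · simp [cyl, hi, Real.sin_add_int_mul_two_pi]
    · simp [cyl, hr]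
  rw [ptE, ptE, hc]

lemma pt_eq_iff {L L' : ℂ} : pt L = pt L' ↔ exp L = exp L' := by
  constructor
  · intro h
    rw [← merc_ptE, ← merc_ptE]
    exact congrArg (fun x : S2 => merc x) h
  · intro h
    exact Subtype.ext (ptE_congr h)

/-- The deck transformation of the coordinate plane covering the antipodal map. -/
noncomputable def deck (L : ℂ) : ℂ := -(starRingEnd ℂ) L + Real.pi * I

lemma pt_deck (L : ℂ) : pt (deck L) = -pt L := by
  apply Subtype.ext
  have h : cyl (deck L) = -cyl L := by
    ext i
    fin_cases i
    · simp [cyl, deck, Real.cos_add_pi]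
    · simp [cyl, deck, Real.sin_add_pi]
    · simp [cyl, deck]
  simp [pt, ptE, h]

lemma toRP2_eq_iff {x y : S2} : toRP2 x = toRP2 y ↔ x = y ∨ x = -y := by
  unfold toRP2
  exact Quotient.eq (r := antipodal)

lemma continuous_toRP2 : Continuous toRP2 := continuous_quotient_mk'

lemma toRP2_deck (L : ℂ) : toRP2 (pt (deck L)) = toRP2 (pt L) :=
  toRP2_eq_iff.2 (Or.inr (pt_deck L))

lemma toRP2_pt_eq_iff {L L' : ℂ} :
    toRP2 (pt L) = toRP2 (pt L') ↔ exp L = exp L' ∨ exp L = exp (deck L') := by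
  rw [toRP2_eq_iff, ← pt_deck, pt_eq_iff, pt_eq_iff]

lemma exp_eq_exp_iff {L L' : ℂ} :
    exp L = exp L' ↔ L.re = L'.re ∧ ∃ k : ℤ, L.im = L'.im + k * (2 * Real.pi) := by
  rw [Complex.exp_eq_exp_iff_exists_int]
  constructor
  · rintro ⟨n, hn⟩
    exact ⟨by rw [hn]; simp, n, by rw [hn]; simp⟩
  · rintro ⟨h1, n, hn⟩
    exact ⟨n, by apply Complex.ext <;> simp [h1, hn]⟩

/-- Every point of the sphere off the vertical axis is in the image of `pt`. -/
lemma eq_ptE_of_exp_eq {x : E3} (hx : x ∈ Metric.sphere (0 : E3) 1) (hw : horiz x ≠ 0) {L : ℂ}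
    (h : exp L = merc x) : x = ptE L := by
  have hn : 0 < ‖horiz x‖ := norm_pos_iff.2 hw
  have hn' : (‖horiz x‖ : ℂ) ≠ 0 := by exact_mod_cast hn.ne'
  have h1 : L.re = x 2 / ‖horiz x‖ := by
    have := congrArg norm h
    rw [Complex.norm_exp, merc, norm_mul, norm_div, Complex.norm_real, Complex.norm_real,
      norm_norm, div_self hn.ne', one_mul, Real.norm_of_nonneg (Real.exp_pos _).le] at this
    exact Real.exp_injective this
  have h2 : exp (L.im * I) = horiz x / ‖horiz x‖ := by
    have hL : exp L = exp (L.im * I) * Real.exp L.re := by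
      rw [Complex.ofReal_exp, ← Complex.exp_add, add_comm, Complex.re_add_im]
    rw [hL, merc, h1] at h
    exact mul_right_cancel₀ (by exact_mod_cast (Real.exp_pos _).ne') h
  have h3 : cyl L = ‖horiz x‖⁻¹ • x := by
    have hre := congrArg Complex.re h2
    have him := congrArg Complex.im h2
    rw [Complex.exp_ofReal_mul_I_re, Complex.div_ofReal_re] at hre
    rw [Complex.exp_ofReal_mul_I_im, Complex.div_ofReal_im] at him
    ext i
    fin_cases i
    · simp [cyl, hre, horiz]; ring
    · simp [cyl, him, horiz]; ring
    · simp [cyl, h1]; ring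
  have hx1 : ‖x‖ = 1 := by simpa using hx
  rw [ptE, h3, norm_smul, hx1, norm_inv, norm_norm, mul_one, inv_inv, smul_smul,
    mul_inv_cancel₀ hn.ne', one_smul]

lemma unmerc_exp (L : ℂ) : unmerc (exp L) = ptE L := by
  unfold unmerc
  apply ptE_congr
  have h : exp L ≠ 0 := exp_ne_zero L
  have : (⟨Real.log ‖exp L‖, (exp L).arg⟩ : ℂ) = log (exp L) := by
    apply Complex.ext <;> simp [Complex.log_re, Complex.log_im]
  rw [this, Complex.exp_log h]

lemma unmerc_merc {x : E3} (hx : x ∈ Metric.sphere (0 : E3) 1) (hw : horiz x ≠ 0) :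
    unmerc (merc x) = x := by
  have h := Complex.exp_log (merc_ne_zero hw)
  rw [← h, unmerc_exp]
  exact (eq_ptE_of_exp_eq hx hw h).symm

lemma differentiableAt_unmerc {a : ℂ} (ha : a ≠ 0) : DifferentiableAt ℝ unmerc a := by
  -- Near `a`, a branch of the logarithm is `z ↦ log (z / a) + log a`.
  have hev : ∀ᶠ z in 𝓝 a, unmerc z = ptE (log (z / a) + log a) := by
    filter_upwards [eventually_ne_nhds ha] with z hz
    have : exp (log (z / a) + log a) = z := by
      rw [Complex.exp_add, Complex.exp_log (div_ne_zero hz ha), Complex.exp_log ha,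
        div_mul_cancel₀ _ ha]
    conv_lhs => rw [← this]
    rw [unmerc_exp]
  refine DifferentiableAt.congr_of_eventuallyEq ?_ hev
  refine (contDiff_ptE.differentiable one_ne_zero).differentiableAt.comp a ?_
  have h1 : DifferentiableAt ℂ (fun z => log (z / a) + log a) a := by
    refine DifferentiableAt.add_const _ ((differentiableAt_id.div_const a).clog ?_)
    simp [ha]
  exact h1.restrictScalars ℝ

/-- The determinant of two vectors of the plane. -/
def det2 (a b : ℂ) : ℝ := a.re * b.im - a.im * b.re

lemma linearIndependent_iff_det2 {a b : ℂ} : LinearIndependent ℝ ![a, b] ↔ det2 a b ≠ 0 := by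
  rw [LinearIndependent.pair_iff, det2]
  constructor
  · intro h h0
    have h1 := h b.re (-a.re) (by apply Complex.ext <;> simp <;> linarith)
    have h2 := h b.im (-a.im) (by apply Complex.ext <;> simp <;> linarith)
    have h3 := h 1 0 (by
      apply Complex.ext <;> simp <;> linarith)
    exact one_ne_zero h3.1
  · intro h s t hst
    have h1 := congrArg Complex.re hst
    have h2 := congrArg Complex.im hst
    simp at h1 h2
    constructor
    · have : s * (a.re * b.im - a.im * b.re) = 0 := by linear_combination b.im * h1 - b.re * h2
      exact (mul_eq_zero.1 this).resolve_right h
    · have : t * (a.re * b.im - a.im * b.re) = 0 := by linear_combination a.re * h2 - a.im * h1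
      exact (mul_eq_zero.1 this).resolve_right h

/-- If the images of two curves under a differentiable map meet with independent velocities, then
so do the curves. -/
lemma linearIndependent_of_comp {E F : Type*} [NormedAddCommGroup E] [NormedSpace ℝ E]
    [NormedAddCommGroup F] [NormedSpace ℝ F] {g : E → F} {x y : ℝ → E} {a b : ℝ → F} {s t : ℝ}
    (hx : DifferentiableAt ℝ x s) (hy : DifferentiableAt ℝ y t) (hxy : x s = y t)
    (hg : DifferentiableAt ℝ g (x s)) (ha : a =ᶠ[𝓝 s] g ∘ x) (hb : b =ᶠ[𝓝 t] g ∘ y)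
    (h : LinearIndependent ℝ ![deriv a s, deriv b t]) :
    LinearIndependent ℝ ![deriv x s, deriv y t] := by
  rw [ha.deriv_eq, hb.deriv_eq, (hg.hasFDerivAt.comp_hasDerivAt s hx.hasDerivAt).deriv] at h
  rw [hxy] at hg h
  rw [(hg.hasFDerivAt.comp_hasDerivAt t hy.hasDerivAt).deriv] at h
  rw [LinearIndependent.pair_iff] at h ⊢
  intro p q hpq
  apply h p q
  rw [← map_smul, ← map_smul, ← map_add, hpq, map_zero]

lemma deriv_exp_comp {L : ℝ → ℂ} {t : ℝ} (hL : DifferentiableAt ℝ L t) :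
    deriv (fun r => exp (L r)) t = exp (L t) * deriv L t :=
  hL.hasDerivAt.cexp.deriv

lemma horiz_ptE_ne_zero (L : ℂ) : horiz (ptE L) ≠ 0 := by
  intro h
  have : merc (ptE L) = 0 := by simp [merc, h]
  rw [merc_ptE] at this
  exact exp_ne_zero L this

section Builders

variable {S : Type} {π : S2 → S}

lemma isRegularLiftAt_pt {c : ℝ → S} {t : ℝ} {L : ℝ → ℂ} (hc : ∀ᶠ r in 𝓝 t, c r = π (pt (L r)))
    (hL : ContDiffAt ℝ 1 L t) (hL' : deriv L t ≠ 0) : IsRegularLiftAt π c t (ptE ∘ L) := by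
  have hd : DifferentiableAt ℝ L t := hL.differentiableAt one_ne_zero
  have hd' : DifferentiableAt ℝ (ptE ∘ L) t :=
    (contDiff_ptE.differentiable one_ne_zero).differentiableAt.comp t hd
  refine ⟨?_, contDiff_ptE.contDiffAt.comp t hL, ?_⟩
  · filter_upwards [hc] with r hr
    exact ⟨ptE_mem _, hr.symm⟩
  · intro h0
    have h1 : (fun r => exp (L r)) = merc ∘ (ptE ∘ L) := by
      ext r; simp [merc_ptE]
    have h2 := deriv_exp_comp hd
    have hg : DifferentiableAt ℝ merc ((ptE ∘ L) t) :=
      (contDiffAt_merc (horiz_ptE_ne_zero _)).differentiableAt one_ne_zero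
    rw [h1, (hg.hasFDerivAt.comp_hasDerivAt t hd'.hasDerivAt).deriv, h0, map_zero] at h2
    exact mul_ne_zero (exp_ne_zero _) hL' h2.symm

lemma regularAt_pt {c : ℝ → S} {t : ℝ} {L : ℝ → ℂ} (hc : ∀ᶠ r in 𝓝 t, c r = π (pt (L r)))
    (hL : ContDiffAt ℝ 1 L t) (hL' : deriv L t ≠ 0) : RegularAt π c t :=
  ⟨_, isRegularLiftAt_pt hc hL hL'⟩

lemma crossTransversally_pt {c d : ℝ → S} {s t : ℝ} {L M : ℝ → ℂ}
    (hc : ∀ᶠ r in 𝓝 s, c r = π (pt (L r))) (hd : ∀ᶠ r in 𝓝 t, d r = π (pt (M r)))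
    (hL : ContDiffAt ℝ 1 L s) (hM : ContDiffAt ℝ 1 M t) (heq : exp (L s) = exp (M t))
    (hdet : det2 (deriv L s) (deriv M t) ≠ 0) : CrossTransversally π c s d t := by
  have hL' : deriv L s ≠ 0 := by
    intro h; apply hdet; simp [det2, h]
  have hM' : deriv M t ≠ 0 := by
    intro h; apply hdet; simp [det2, h]
  have hLd : DifferentiableAt ℝ L s := hL.differentiableAt one_ne_zero
  have hMd : DifferentiableAt ℝ M t := hM.differentiableAt one_ne_zero
  have hst : (ptE ∘ L) s = (ptE ∘ M) t := ptE_congr heq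
  refine ⟨ptE ∘ L, ptE ∘ M, isRegularLiftAt_pt hc hL hL', isRegularLiftAt_pt hd hM hM', hst, ?_⟩
  have hp := contDiff_ptE.differentiable one_ne_zero
  refine linearIndependent_of_comp (g := merc) (a := fun r => exp (L r)) (b := fun r => exp (M r))
    (hp.differentiableAt.comp s hLd) (hp.differentiableAt.comp t hMd) hst
    ((contDiffAt_merc (horiz_ptE_ne_zero _)).differentiableAt one_ne_zero) ?_ ?_ ?_
  · exact Eventually.of_forall fun r => (merc_ptE _).symm
  · exact Eventually.of_forall fun r => (merc_ptE _).symm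
  · rw [deriv_exp_comp hLd, deriv_exp_comp hMd, ← heq]
    rw [← linearIndependent_iff_det2, LinearIndependent.pair_iff] at hdet
    rw [LinearIndependent.pair_iff]
    intro p q hpq
    apply hdet p q
    have : exp (L s) * (p • deriv L s + q • deriv M t) = 0 := by
      rw [← hpq]; simp only [Complex.real_smul]; ring
    exact (mul_eq_zero.1 this).resolve_left (exp_ne_zero _)

end Builders

/-! ### Continuous logarithms and the winding of a map along the boundary of a rectangle -/

/-- `L` is a continuous logarithm of `γ` on `[a, b]`. -/
def LogLift (γ : ℝ → ℂ) (a b : ℝ) (L : ℝ → ℂ) : Prop :=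
  ContinuousOn L (Icc a b) ∧ ∀ t ∈ Icc a b, exp (L t) = γ t

lemma exists_continuous_log {A : Type*} [TopologicalSpace A] [SimplyConnectedSpace A]
    [LocallyPathConnectedSpace A] (f : A → ℂ) (hf : Continuous f) (h0 : ∀ a, f a ≠ 0) :
    ∃ L : A → ℂ, Continuous L ∧ ∀ a, exp (L a) = f a := by
  obtain ⟨a₀⟩ : Nonempty A := inferInstance
  obtain ⟨F, ⟨-, hF⟩, -⟩ := Complex.isCoveringMapOn_exp.existsUnique_continuousMap_lifts ⟨f, hf⟩
    (a₀ := a₀) (e₀ := log (f a₀)) (Complex.exp_log (h0 a₀)) h0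
  exact ⟨F, F.continuous, fun a => congrFun hF a⟩

lemma exists_logLift {γ : ℝ → ℂ} {a b : ℝ} (hab : a ≤ b) (hγ : ContinuousOn γ (Icc a b))
    (h0 : ∀ t ∈ Icc a b, γ t ≠ 0) : ∃ L, LogLift γ a b L := by
  obtain ⟨L, hL, h⟩ := exists_continuous_log (fun t => γ (projIcc a b hab t))
    (hγ.domRestrict.comp continuous_projIcc) (fun t => h0 _ (projIcc a b hab t).2)
  refine ⟨L, hL.continuousOn, fun t ht => ?_⟩
  rw [h, projIcc_of_mem hab ht]

/-- Two continuous logarithms differ by a constant. -/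
lemma LogLift.sub_eq {γ L M : ℝ → ℂ} {a b : ℝ} (hab : a ≤ b) (hL : LogLift γ a b L)
    (hM : LogLift γ a b M) : L b - L a = M b - M a := by
  have hc : ContinuousOn (fun t => ((L t - M t) / (2 * Real.pi * I)).re) (Icc a b) :=
    Complex.continuous_re.comp_continuousOn ((hL.1.sub hM.1).div_const _)
  have hpi : (2 * Real.pi * I : ℂ) ≠ 0 := Complex.two_pi_I_ne_zero
  have hint : ∀ t ∈ Icc a b, ∃ n : ℤ, L t - M t = n * (2 * Real.pi * I) := by
    intro t ht
    obtain ⟨n, hn⟩ := Complex.exp_eq_exp_iff_exists_int.1 ((hL.2 t ht).trans (hM.2 t ht).symm)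
    exact ⟨n, by rw [hn]; ring⟩
  choose! n hn using hint
  have hval : ∀ t ∈ Icc a b, ((L t - M t) / (2 * Real.pi * I)).re = n t := by
    intro t ht
    rw [hn t ht, mul_div_cancel_right₀ _ hpi, Complex.intCast_re]
  have hcn : ContinuousOn (fun t => ((n t : ℤ) : ℝ)) (Icc a b) := hc.congr fun t ht => (hval t ht).symm
  have hcn' : ContinuousOn n (Icc a b) := by
    rwa [Int.isClosedEmbedding_coe_real.isInducing.continuousOn_iff]
  have heq := isPreconnected_Icc.constant hcn' (left_mem_Icc.2 hab) (right_mem_Icc.2 hab)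
  have h1 := hn a (left_mem_Icc.2 hab)
  have h2 := hn b (right_mem_Icc.2 hab)
  rw [heq] at h1
  linear_combination h2 - h1

open Classical in
/-- The increment along `[a, b]` of a continuous logarithm of `γ`. -/
noncomputable def dlog (γ : ℝ → ℂ) (a b : ℝ) : ℂ :=
  if h : ∃ L, LogLift γ a b L then h.choose b - h.choose a else 0

lemma LogLift.dlog_eq {γ L : ℝ → ℂ} {a b : ℝ} (h : LogLift γ a b L) (hab : a ≤ b) :
    dlog γ a b = L b - L a := by
  have hex : ∃ L, LogLift γ a b L := ⟨L, h⟩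
  rw [dlog, dif_pos hex]
  exact hex.choose_spec.sub_eq hab h

lemma LogLift.mono {γ L : ℝ → ℂ} {a b c d : ℝ} (h : LogLift γ a b L) (hs : Icc c d ⊆ Icc a b) :
    LogLift γ c d L := ⟨h.1.mono hs, fun t ht => h.2 t (hs ht)⟩

lemma dlog_congr {γ δ : ℝ → ℂ} {a b : ℝ} (h : ∀ t ∈ Icc a b, γ t = δ t) :
    dlog γ a b = dlog δ a b := by
  have : LogLift γ a b = LogLift δ a b := by
    ext L
    exact and_congr_right fun _ => forall₂_congr fun t ht => by rw [h t ht]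
  unfold dlog
  rw [this]

lemma dlog_add {γ : ℝ → ℂ} {a b c : ℝ} (hab : a ≤ b) (hbc : b ≤ c)
    (hγ : ContinuousOn γ (Icc a c)) (h0 : ∀ t ∈ Icc a c, γ t ≠ 0) :
    dlog γ a b + dlog γ b c = dlog γ a c := by
  obtain ⟨L, hL⟩ := exists_logLift (hab.trans hbc) hγ h0
  rw [hL.dlog_eq (hab.trans hbc), (hL.mono (Icc_subset_Icc_right hbc)).dlog_eq hab,
    (hL.mono (Icc_subset_Icc_left hab)).dlog_eq hbc]
  ring

lemma exp_dlog {γ : ℝ → ℂ} {a b : ℝ} (hab : a ≤ b)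
    (hγ : ContinuousOn γ (Icc a b)) (h0 : ∀ t ∈ Icc a b, γ t ≠ 0) :
    exp (dlog γ a b) = γ b / γ a := by
  obtain ⟨L, hL⟩ := exists_logLift hab hγ h0
  rw [hL.dlog_eq hab, Complex.exp_sub, hL.2 _ (right_mem_Icc.2 hab), hL.2 _ (left_mem_Icc.2 hab)]

lemma dlog_mul {γ δ : ℝ → ℂ} {a b : ℝ} (hab : a ≤ b)
    (hγ : ContinuousOn γ (Icc a b)) (h0 : ∀ t ∈ Icc a b, γ t ≠ 0)
    (hδ : ContinuousOn δ (Icc a b)) (h0' : ∀ t ∈ Icc a b, δ t ≠ 0) :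
    dlog (fun t => γ t * δ t) a b = dlog γ a b + dlog δ a b := by
  obtain ⟨L, hL⟩ := exists_logLift hab hγ h0
  obtain ⟨M, hM⟩ := exists_logLift hab hδ h0'
  have : LogLift (fun t => γ t * δ t) a b (fun t => L t + M t) :=
    ⟨hL.1.add hM.1, fun t ht => by rw [Complex.exp_add, hL.2 t ht, hM.2 t ht]⟩
  rw [this.dlog_eq hab, hL.dlog_eq hab, hM.dlog_eq hab]
  ring

lemma dlog_const {c : ℂ} (hc : c ≠ 0) {a b : ℝ} (hab : a ≤ b) : dlog (fun _ => c) a b = 0 := by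
  have : LogLift (fun _ => c) a b (fun _ => log c) :=
    ⟨continuousOn_const, fun t _ => Complex.exp_log hc⟩
  rw [this.dlog_eq hab, sub_self]

lemma dlog_const_mul {γ : ℝ → ℂ} {c : ℂ} (hc : c ≠ 0) {a b : ℝ} (hab : a ≤ b)
    (hγ : ContinuousOn γ (Icc a b)) (h0 : ∀ t ∈ Icc a b, γ t ≠ 0) :
    dlog (fun t => c * γ t) a b = dlog γ a b := by
  rw [dlog_mul hab continuousOn_const (fun _ _ => hc) hγ h0, dlog_const hc hab, zero_add]

lemma dlog_conj {γ : ℝ → ℂ} {a b : ℝ} (hab : a ≤ b)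
    (hγ : ContinuousOn γ (Icc a b)) (h0 : ∀ t ∈ Icc a b, γ t ≠ 0) :
    dlog (fun t => (starRingEnd ℂ) (γ t)) a b = (starRingEnd ℂ) (dlog γ a b) := by
  obtain ⟨L, hL⟩ := exists_logLift hab hγ h0
  have : LogLift (fun t => (starRingEnd ℂ) (γ t)) a b (fun t => (starRingEnd ℂ) (L t)) :=
    ⟨Complex.continuous_conj.comp_continuousOn hL.1, fun t ht => by
      rw [Complex.exp_conj, hL.2 t ht]⟩
  rw [this.dlog_eq hab, hL.dlog_eq hab, map_sub]

lemma dlog_of_slitPlane {γ : ℝ → ℂ} {a b : ℝ} (hab : a ≤ b)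
    (hγ : ContinuousOn γ (Icc a b)) (h0 : ∀ t ∈ Icc a b, γ t ∈ slitPlane) :
    dlog γ a b = log (γ b) - log (γ a) := by
  have : LogLift γ a b (fun t => log (γ t)) :=
    ⟨hγ.clog h0, fun t ht => Complex.exp_log (slitPlane_ne_zero (h0 t ht))⟩
  rw [this.dlog_eq hab]

/-- The increment of a continuous logarithm of `F` along the positively oriented boundary of the
rectangle `[s₀, s₁] × [t₀, t₁]`: `2πi` times the winding number. -/
noncomputable def wind (F : ℝ → ℝ → ℂ) (s₀ s₁ t₀ t₁ : ℝ) : ℂ :=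
  dlog (fun s => F s t₀) s₀ s₁ + dlog (fun t => F s₁ t) t₀ t₁
    - dlog (fun s => F s t₁) s₀ s₁ - dlog (fun t => F s₀ t) t₀ t₁

/-- The winding of `F` along the boundary of the rectangle is an odd (`n = 1`), resp. even
(`n = 0`) number of turns. -/
def WindParity (F : ℝ → ℝ → ℂ) (s₀ s₁ t₀ t₁ : ℝ) (n : ZMod 2) : Prop :=
  ∃ W : ℤ, wind F s₀ s₁ t₀ t₁ = 2 * Real.pi * I * W ∧ (W : ZMod 2) = n

/-- Joint continuity of `F` on a rectangle. -/
abbrev ContRect (F : ℝ → ℝ → ℂ) (s₀ s₁ t₀ t₁ : ℝ) : Prop :=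
  ContinuousOn (fun p : ℝ × ℝ => F p.1 p.2) (Icc s₀ s₁ ×ˢ Icc t₀ t₁)

section Rect

variable {F : ℝ → ℝ → ℂ} {s₀ s₁ t₀ t₁ : ℝ}

lemma ContRect.fst (h : ContRect F s₀ s₁ t₀ t₁) {t : ℝ} (ht : t ∈ Icc t₀ t₁) :
    ContinuousOn (fun s => F s t) (Icc s₀ s₁) :=
  h.comp (f := fun s => (s, t)) (by fun_prop) fun s hs => ⟨hs, ht⟩

lemma ContRect.snd (h : ContRect F s₀ s₁ t₀ t₁) {s : ℝ} (hs : s ∈ Icc s₀ s₁) :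
    ContinuousOn (fun t => F s t) (Icc t₀ t₁) :=
  h.comp (f := fun t => (s, t)) (by fun_prop) fun t ht => ⟨hs, ht⟩

lemma ContRect.mono (h : ContRect F s₀ s₁ t₀ t₁) {s₀' s₁' t₀' t₁' : ℝ}
    (hs : Icc s₀' s₁' ⊆ Icc s₀ s₁) (ht : Icc t₀' t₁' ⊆ Icc t₀ t₁) : ContRect F s₀' s₁' t₀' t₁' :=
  ContinuousOn.mono h (prod_mono hs ht)

lemma wind_add_fst (h : ContRect F s₀ s₁ t₀ t₁) {c : ℝ} (hc : c ∈ Icc s₀ s₁) (ht : t₀ ≤ t₁)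
    (hb : ∀ s ∈ Icc s₀ s₁, F s t₀ ≠ 0) (hu : ∀ s ∈ Icc s₀ s₁, F s t₁ ≠ 0) :
    wind F s₀ c t₀ t₁ + wind F c s₁ t₀ t₁ = wind F s₀ s₁ t₀ t₁ := by
  unfold wind
  rw [← dlog_add hc.1 hc.2 (h.fst (left_mem_Icc.2 ht)) hb,
    ← dlog_add hc.1 hc.2 (h.fst (right_mem_Icc.2 ht)) hu]
  ring

lemma wind_add_snd (h : ContRect F s₀ s₁ t₀ t₁) {c : ℝ} (hc : c ∈ Icc t₀ t₁) (hs : s₀ ≤ s₁)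
    (hb : ∀ t ∈ Icc t₀ t₁, F s₀ t ≠ 0) (hu : ∀ t ∈ Icc t₀ t₁, F s₁ t ≠ 0) :
    wind F s₀ s₁ t₀ c + wind F s₀ s₁ c t₁ = wind F s₀ s₁ t₀ t₁ := by
  unfold wind
  rw [← dlog_add hc.1 hc.2 (h.snd (left_mem_Icc.2 hs)) hb,
    ← dlog_add hc.1 hc.2 (h.snd (right_mem_Icc.2 hs)) hu]
  ring

/-- The winding vanishes when `F` has no zero in the rectangle, because `F` then has a continuous
logarithm there. -/
lemma wind_eq_zero (h : ContRect F s₀ s₁ t₀ t₁) (hs : s₀ ≤ s₁) (ht : t₀ ≤ t₁)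
    (h0 : ∀ s ∈ Icc s₀ s₁, ∀ t ∈ Icc t₀ t₁, F s t ≠ 0) : wind F s₀ s₁ t₀ t₁ = 0 := by
  obtain ⟨L, hL, hexp⟩ := exists_continuous_log
    (fun p : ℝ × ℝ => F (projIcc s₀ s₁ hs p.1) (projIcc t₀ t₁ ht p.2))
    (h.comp_continuous (f := fun p : ℝ × ℝ => ((projIcc s₀ s₁ hs p.1 : ℝ), (projIcc t₀ t₁ ht p.2 : ℝ)))
      ((continuous_subtype_val.comp (continuous_projIcc.comp continuous_fst)).prodMk
        (continuous_subtype_val.comp (continuous_projIcc.comp continuous_snd)))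
      (fun p => ⟨(projIcc s₀ s₁ hs p.1).2, (projIcc t₀ t₁ ht p.2).2⟩))
    (fun p => h0 _ (projIcc s₀ s₁ hs p.1).2 _ (projIcc t₀ t₁ ht p.2).2)
  have hval : ∀ s ∈ Icc s₀ s₁, ∀ t ∈ Icc t₀ t₁, exp (L (s, t)) = F s t := by
    intro s hs' t ht'
    rw [hexp]
    simp only [projIcc_of_mem hs hs', projIcc_of_mem ht ht']
  have hfst : ∀ t ∈ Icc t₀ t₁, LogLift (fun s => F s t) s₀ s₁ (fun s => L (s, t)) := fun t ht' =>
    ⟨(hL.comp (by fun_prop)).continuousOn, fun s hs' => hval s hs' t ht'⟩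
  have hsnd : ∀ s ∈ Icc s₀ s₁, LogLift (fun t => F s t) t₀ t₁ (fun t => L (s, t)) := fun s hs' =>
    ⟨(hL.comp (by fun_prop)).continuousOn, fun t ht' => hval s hs' t ht'⟩
  unfold wind
  rw [(hfst t₀ (left_mem_Icc.2 ht)).dlog_eq hs, (hfst t₁ (right_mem_Icc.2 ht)).dlog_eq hs,
    (hsnd s₀ (left_mem_Icc.2 hs)).dlog_eq ht, (hsnd s₁ (right_mem_Icc.2 hs)).dlog_eq ht]
  ring

/-- A nondegenerate linear map has odd winding along a square around its zero: by its symmetry,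
each half of the boundary contributes the same odd number of half turns. -/
lemma windParity_linear {α β : ℂ} (hdet : det2 α β ≠ 0) (p q : ℝ) {r : ℝ} (hr : 0 < r) :
    WindParity (fun s t => α * ((s - p : ℝ) : ℂ) + β * ((t - q : ℝ) : ℂ))
      (p - r) (p + r) (q - r) (q + r) 1 := by
  set F : ℝ → ℝ → ℂ := fun s t => α * ((s - p : ℝ) : ℂ) + β * ((t - q : ℝ) : ℂ) with hF
  have hF0 : ∀ s t, F s t = 0 → s = p ∧ t = q := by
    intro s t h
    rw [← linearIndependent_iff_det2, LinearIndependent.pair_iff] at hdet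
    have := hdet (s - p) (t - q) (by
      rw [← h, hF]; simp only [Complex.real_smul]; ring)
    exact ⟨by linarith [this.1], by linarith [this.2]⟩
  have hc : ∀ a b c d, ContRect F a b c d := fun a b c d => by
    apply Continuous.continuousOn; rw [hF]; fun_prop
  have hpr : p - r ≤ p + r := by linarith
  have hqr : q - r ≤ q + r := by linarith
  obtain ⟨A, hA⟩ := exists_logLift hpr ((hc (p - r) (p + r) (q - r) (q + r)).fst
    (left_mem_Icc.2 hqr)) (fun s _ h => by linarith [(hF0 _ _ h).2])
  obtain ⟨B, hB⟩ := exists_logLift hqr ((hc (p - r) (p + r) (q - r) (q + r)).snd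
    (right_mem_Icc.2 hpr)) (fun s _ h => by linarith [(hF0 _ _ h).1])
  have hrefl : ∀ s t, F (2 * p - s) (2 * q - t) = - F s t := by
    intro s t; simp only [hF]; push_cast; ring
  have hC : LogLift (fun s => F s (q + r)) (p - r) (p + r) (fun s => A (2 * p - s) + Real.pi * I) := by
    refine ⟨(hA.1.comp (by fun_prop) fun s hs => ?_).add continuousOn_const, fun s hs => ?_⟩
    · constructor <;> linarith [hs.1, hs.2]
    · rw [Complex.exp_add, Complex.exp_pi_mul_I, hA.2 _ (by constructor <;> linarith [hs.1, hs.2])]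
      have := hrefl s (q + r)
      rw [show 2 * q - (q + r) = q - r by ring] at this
      beta_reduce
      rw [this]; ring
  have hD : LogLift (fun t => F (p - r) t) (q - r) (q + r) (fun t => B (2 * q - t) + Real.pi * I) := by
    refine ⟨(hB.1.comp (by fun_prop) fun s hs => ?_).add continuousOn_const, fun s hs => ?_⟩
    · constructor <;> linarith [hs.1, hs.2]
    · rw [Complex.exp_add, Complex.exp_pi_mul_I, hB.2 _ (by constructor <;> linarith [hs.1, hs.2])]
      have := hrefl (p - r) s
      rw [show 2 * p - (p - r) = p + r by ring] at this
      beta_reduce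
      rw [this]; ring
  have hhalf : exp (A (p + r) - A (p - r) + (B (q + r) - B (q - r)) - Real.pi * I) = 1 := by
    rw [Complex.exp_sub, Complex.exp_add, Complex.exp_sub, Complex.exp_sub,
      hA.2 _ (right_mem_Icc.2 hpr), hA.2 _ (left_mem_Icc.2 hpr), hB.2 _ (right_mem_Icc.2 hqr),
      hB.2 _ (left_mem_Icc.2 hqr), Complex.exp_pi_mul_I]
    have h1 := hrefl (p - r) (q - r)
    rw [show 2 * p - (p - r) = p + r by ring, show 2 * q - (q - r) = q + r by ring] at h1
    have h2 : F (p - r) (q - r) ≠ 0 := fun h => by linarith [(hF0 _ _ h).1]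
    have h3 : F (p + r) (q - r) ≠ 0 := fun h => by linarith [(hF0 _ _ h).1]
    beta_reduce
    rw [h1]
    field_simp
  obtain ⟨n, hn⟩ := Complex.exp_eq_one_iff.1 hhalf
  refine ⟨2 * n + 1, ?_, ?_⟩
  · unfold wind
    rw [hA.dlog_eq hpr, hB.dlog_eq hqr, hC.dlog_eq hpr, hD.dlog_eq hqr]
    rw [show 2 * p - (p + r) = p - r by ring, show 2 * p - (p - r) = p + r by ring,
      show 2 * q - (q + r) = q - r by ring, show 2 * q - (q - r) = q + r by ring]
    push_cast
    linear_combination 2 * hn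
  · push_cast
    rw [show (2 : ZMod 2) = 0 from rfl]; ring

/-- The winding does not change when `F` is multiplied by a function close to `1`. -/
lemma wind_mul_slitPlane {G : ℝ → ℝ → ℂ} (hs : s₀ ≤ s₁) (ht : t₀ ≤ t₁)
    (hF : ContRect F s₀ s₁ t₀ t₁) (hG : ContRect G s₀ s₁ t₀ t₁)
    (hbd : ∀ s ∈ Icc s₀ s₁, ∀ t ∈ Icc t₀ t₁, (s = s₀ ∨ s = s₁ ∨ t = t₀ ∨ t = t₁) →
      F s t ≠ 0 ∧ G s t / F s t ∈ slitPlane) :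
    wind G s₀ s₁ t₀ t₁ = wind F s₀ s₁ t₀ t₁ := by
  have key : ∀ (f g : ℝ → ℂ) (a b : ℝ), a ≤ b → ContinuousOn f (Icc a b) → ContinuousOn g (Icc a b) →
      (∀ x ∈ Icc a b, f x ≠ 0 ∧ g x / f x ∈ slitPlane) →
      dlog g a b = dlog f a b + (log (g b / f b) - log (g a / f a)) := by
    intro f g a b hab hf hg h
    have hq : ContinuousOn (fun x => g x / f x) (Icc a b) := hg.div hf fun x hx => (h x hx).1
    rw [← dlog_of_slitPlane (γ := fun x => g x / f x) hab hq fun x hx => (h x hx).2,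
      ← dlog_mul hab hf (fun x hx => (h x hx).1) hq fun x hx => slitPlane_ne_zero (h x hx).2]
    exact dlog_congr fun x hx => by rw [mul_div_cancel₀ _ (h x hx).1]
  have l0 := left_mem_Icc.2 hs
  have l1 := right_mem_Icc.2 hs
  have m0 := left_mem_Icc.2 ht
  have m1 := right_mem_Icc.2 ht
  unfold wind
  rw [key _ _ _ _ hs (hF.fst m0) (hG.fst m0) fun s h => hbd s h t₀ m0 (by simp),
    key _ _ _ _ hs (hF.fst m1) (hG.fst m1) fun s h => hbd s h t₁ m1 (by simp),
    key _ _ _ _ ht (hF.snd l0) (hG.snd l0) fun t h => hbd s₀ l0 t h (by simp),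
    key _ _ _ _ ht (hF.snd l1) (hG.snd l1) fun t h => hbd s₁ l1 t h (by simp)]
  ring

end Rect

/-- At the point `p` the map `F` vanishes and is differentiable with invertible derivative. -/
def NondegZero (F : ℝ → ℝ → ℂ) (p : ℝ × ℝ) : Prop :=
  ∃ α β : ℂ, det2 α β ≠ 0 ∧
    (fun v : ℝ × ℝ => F v.1 v.2 - (α * ((v.1 - p.1 : ℝ) : ℂ) + β * ((v.2 - p.2 : ℝ) : ℂ)))
      =o[𝓝 p] fun v => v - p

lemma exists_norm_le_of_det2_ne_zero {α β : ℂ} (h : det2 α β ≠ 0) :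
    ∃ m : ℝ, 0 < m ∧ ∀ x y : ℝ, m * max |x| |y| ≤ ‖α * (x : ℂ) + β * (y : ℂ)‖ := by
  -- Cramer's rule
  set M := ‖α‖ + ‖β‖ with hM
  have hx : ∀ x y : ℝ, |det2 α β| * |x| ≤ ‖β‖ * ‖α * (x : ℂ) + β * (y : ℂ)‖ := by
    intro x y
    have : det2 α β * x = -((starRingEnd ℂ) β * (α * (x : ℂ) + β * (y : ℂ))).im := by
      simp [det2]; ring
    rw [← abs_mul, this, abs_neg]
    refine (Complex.abs_im_le_norm _).trans ?_
    rw [norm_mul, RCLike.norm_conj]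
  have hy : ∀ x y : ℝ, |det2 α β| * |y| ≤ ‖α‖ * ‖α * (x : ℂ) + β * (y : ℂ)‖ := by
    intro x y
    have : det2 α β * y = ((starRingEnd ℂ) α * (α * (x : ℂ) + β * (y : ℂ))).im := by
      simp [det2]; ring
    rw [← abs_mul, this]
    refine (Complex.abs_im_le_norm _).trans ?_
    rw [norm_mul, RCLike.norm_conj]
  have hdet : 0 < |det2 α β| := abs_pos.2 h
  have hMpos : 0 < M := by
    have hα : α ≠ 0 := by rintro rfl; apply h; simp [det2]
    have := norm_pos_iff.2 hα
    have := norm_nonneg β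
    linarith
  refine ⟨|det2 α β| / M, div_pos hdet hMpos, fun x y => ?_⟩
  rw [div_mul_eq_mul_div, div_le_iff₀ hMpos]
  have hN := norm_nonneg (α * (x : ℂ) + β * (y : ℂ))
  have h1 := norm_nonneg α
  have h2 := norm_nonneg β
  rcases max_cases |x| |y| with ⟨h', -⟩ | ⟨h', -⟩ <;> rw [h'] <;> nlinarith [hx x y, hy x y]

lemma NondegZero.windParity {F : ℝ → ℝ → ℂ} {p : ℝ × ℝ} (h : NondegZero F p) {s₀ s₁ t₀ t₁ : ℝ}
    (hF : ContRect F s₀ s₁ t₀ t₁) (hs : p.1 ∈ Ioo s₀ s₁) (ht : p.2 ∈ Ioo t₀ t₁) :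
    ∃ r₀ > 0, ∀ r, 0 < r → r < r₀ → WindParity F (p.1 - r) (p.1 + r) (p.2 - r) (p.2 + r) 1 := by
  obtain ⟨α, β, hdet, ho⟩ := h
  obtain ⟨m, hm, hmle⟩ := exists_norm_le_of_det2_ne_zero hdet
  have ho' := (Asymptotics.isLittleO_iff.1 ho (half_pos hm))
  obtain ⟨ρ, hρ, hball⟩ := Metric.eventually_nhds_iff.1 ho'
  refine ⟨min ρ (min (min (p.1 - s₀) (s₁ - p.1)) (min (p.2 - t₀) (t₁ - p.2))), ?_, ?_⟩
  · simp only [gt_iff_lt, lt_min_iff, sub_pos]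
    exact ⟨hρ, ⟨hs.1, hs.2⟩, ht.1, ht.2⟩
  intro r hr hr'
  simp only [lt_min_iff] at hr'
  obtain ⟨hr1, ⟨hr2, hr3⟩, hr4, hr5⟩ := hr'
  have hlin := windParity_linear hdet p.1 p.2 hr
  have hsub : ContRect F (p.1 - r) (p.1 + r) (p.2 - r) (p.2 + r) :=
    hF.mono (Icc_subset_Icc (by linarith) (by linarith)) (Icc_subset_Icc (by linarith) (by linarith))
  have heq := wind_mul_slitPlane (F := fun s t => α * ((s - p.1 : ℝ) : ℂ) + β * ((t - p.2 : ℝ) : ℂ))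
    (G := F) (s₀ := p.1 - r) (s₁ := p.1 + r) (t₀ := p.2 - r) (t₁ := p.2 + r)
    (by linarith) (by linarith) (by apply Continuous.continuousOn; fun_prop) hsub ?_
  · unfold WindParity
    rw [heq]
    exact hlin
  intro s hs' t ht' hbd
  have hmax : max |s - p.1| |t - p.2| = r := by
    have h1 : |s - p.1| ≤ r := abs_le.2 ⟨by linarith [hs'.1], by linarith [hs'.2]⟩
    have h2 : |t - p.2| ≤ r := abs_le.2 ⟨by linarith [ht'.1], by linarith [ht'.2]⟩
    apply le_antisymm (max_le h1 h2)
    rcases hbd with h | h | h | h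
    · refine le_max_of_le_left ?_; rw [h, show p.1 - r - p.1 = -r by ring, abs_neg]; exact le_abs_self r
    · refine le_max_of_le_left ?_; rw [h, show p.1 + r - p.1 = r by ring]; exact le_abs_self r
    · refine le_max_of_le_right ?_; rw [h, show p.2 - r - p.2 = -r by ring, abs_neg]; exact le_abs_self r
    · refine le_max_of_le_right ?_; rw [h, show p.2 + r - p.2 = r by ring]; exact le_abs_self r
  have hnorm : ‖((s, t) : ℝ × ℝ) - p‖ = r := by
    rw [Prod.norm_def]; exact hmax
  have hlow := hmle (s - p.1) (t - p.2)
  rw [hmax] at hlow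
  have hclose := hball (y := (s, t)) (by rw [dist_eq_norm, hnorm]; exact hr1)
  rw [hnorm] at hclose
  dsimp only at hclose ⊢
  set Λ := α * ((s - p.1 : ℝ) : ℂ) + β * ((t - p.2 : ℝ) : ℂ) with hΛ
  have hmr : 0 < m * r := mul_pos hm hr
  have hΛ0 : Λ ≠ 0 := norm_pos_iff.1 (hmr.trans_le hlow)
  refine ⟨hΛ0, ?_⟩
  have h1 : F s t / Λ = 1 + (F s t - Λ) / Λ := by field_simp; ring
  rw [h1]
  apply Complex.mem_slitPlane_of_norm_lt_one
  rw [norm_div, div_lt_one (norm_pos_iff.2 hΛ0)]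
  nlinarith

/-- The argument principle modulo `2`: the winding along the boundary of a rectangle has the parity
of the number of zeros inside, if these are nondegenerate. -/
theorem windParity_card {F : ℝ → ℝ → ℂ} {t₀ t₁ : ℝ} (ht : t₀ < t₁) (Z : Finset (ℝ × ℝ)) :
    ∀ {s₀ s₁ : ℝ}, s₀ < s₁ → ContRect F s₀ s₁ t₀ t₁ →
    (∀ p ∈ Z, p.1 ∈ Ioo s₀ s₁ ∧ p.2 ∈ Ioo t₀ t₁ ∧ NondegZero F p) →
    (∀ s ∈ Icc s₀ s₁, ∀ t ∈ Icc t₀ t₁, F s t = 0 → (s, t) ∈ Z) →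
    Set.InjOn Prod.fst (Z : Set (ℝ × ℝ)) → WindParity F s₀ s₁ t₀ t₁ Z.card := by
  classical
  have one : ∀ (s₀ s₁ : ℝ) (p : ℝ × ℝ), ContRect F s₀ s₁ t₀ t₁ → p.1 ∈ Ioo s₀ s₁ →
      p.2 ∈ Ioo t₀ t₁ → NondegZero F p →
      (∀ s ∈ Icc s₀ s₁, ∀ t ∈ Icc t₀ t₁, F s t = 0 → (s, t) = p) → WindParity F s₀ s₁ t₀ t₁ 1 := by
    intro s₀ s₁ p hF hp1 hp2 hnd hz
    obtain ⟨r₀, hr₀, hsmall⟩ := hnd.windParity hF hp1 hp2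
    obtain ⟨r, hr, hrlt⟩ : ∃ r > 0, r < min r₀ (min (min (p.1 - s₀) (s₁ - p.1))
        (min (p.2 - t₀) (t₁ - p.2))) := by
      refine ⟨_, ?_, half_lt_self ?_⟩
      · apply half_pos
        simp only [lt_min_iff, sub_pos]; exact ⟨hr₀, ⟨hp1.1, hp1.2⟩, hp2.1, hp2.2⟩
      · simp only [lt_min_iff, sub_pos]; exact ⟨hr₀, ⟨hp1.1, hp1.2⟩, hp2.1, hp2.2⟩
    simp only [lt_min_iff] at hrlt
    obtain ⟨hr1, ⟨hr2, hr3⟩, hr4, hr5⟩ := hrlt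
    obtain ⟨W, hW, hWp⟩ := hsmall r hr hr1
    refine ⟨W, ?_, hWp⟩
    rw [← hW]
    have hne : ∀ s ∈ Icc s₀ s₁, ∀ t ∈ Icc t₀ t₁, (s ≠ p.1 ∨ t ≠ p.2) → F s t ≠ 0 := by
      intro s hs t ht hst h0
      have := hz s hs t ht h0
      rw [← this] at hst
      simp at hst
    have hs01 : s₀ ≤ s₁ := (hp1.1.trans hp1.2).le
    have a1 : p.1 - r ∈ Icc s₀ s₁ := ⟨by linarith, by linarith⟩
    have a2 : p.1 + r ∈ Icc (p.1 - r) s₁ := ⟨by linarith, by linarith⟩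
    have a3 : p.2 - r ∈ Icc t₀ t₁ := ⟨by linarith, by linarith⟩
    have a4 : p.2 + r ∈ Icc (p.2 - r) t₁ := ⟨by linarith, by linarith⟩
    have hbot : ∀ s ∈ Icc s₀ s₁, F s t₀ ≠ 0 := fun s hs =>
      hne s hs _ (left_mem_Icc.2 ht.le) (Or.inr hp2.1.ne)
    have htop : ∀ s ∈ Icc s₀ s₁, F s t₁ ≠ 0 := fun s hs =>
      hne s hs _ (right_mem_Icc.2 ht.le) (Or.inr hp2.2.ne')
    have sub1 : Icc (p.1 - r) s₁ ⊆ Icc s₀ s₁ := Icc_subset_Icc_left a1.1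
    have sub2 : Icc (p.1 - r) (p.1 + r) ⊆ Icc s₀ s₁ := Icc_subset_Icc a1.1 a2.2
    have sub3 : Icc (p.2 - r) t₁ ⊆ Icc t₀ t₁ := Icc_subset_Icc_left a3.1
    have hF1 : ContRect F (p.1 - r) s₁ t₀ t₁ := hF.mono sub1 subset_rfl
    have hF2 : ContRect F (p.1 - r) (p.1 + r) t₀ t₁ := hF.mono sub2 subset_rfl
    rw [← wind_add_fst hF a1 ht.le hbot htop,
      ← wind_add_fst hF1 a2 ht.le (fun s hs => hbot s (sub1 hs)) (fun s hs => htop s (sub1 hs)),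
      ← wind_add_snd hF2 a3 (by linarith)
        (fun t ht => hne _ a1 t ht (Or.inl (by linarith)))
        (fun t ht => hne _ (sub1 a2) t ht (Or.inl (by linarith))),
      ← wind_add_snd (hF2.mono subset_rfl sub3) a4 (by linarith)
        (fun t ht => hne _ a1 t (sub3 ht) (Or.inl (by linarith)))
        (fun t ht => hne _ (sub1 a2) t (sub3 ht) (Or.inl (by linarith))),
      wind_eq_zero (hF.mono (Icc_subset_Icc_right a1.2) subset_rfl) a1.1 ht.le
        (fun s hs t ht => hne s (Icc_subset_Icc_right a1.2 hs) t ht (Or.inl (by linarith [hs.2]))),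
      wind_eq_zero (hF.mono (Icc_subset_Icc_left (sub1 a2).1) subset_rfl) a2.2 ht.le
        (fun s hs t ht => hne s (Icc_subset_Icc_left (sub1 a2).1 hs) t ht
          (Or.inl (by linarith [hs.1]))),
      wind_eq_zero (hF2.mono subset_rfl (Icc_subset_Icc_right a3.2)) (by linarith) a3.1
        (fun s hs t ht => hne s (sub2 hs) t (Icc_subset_Icc_right a3.2 ht)
          (Or.inr (by linarith [ht.2]))),
      wind_eq_zero (hF2.mono subset_rfl (Icc_subset_Icc_left (sub3 a4).1)) (by linarith) a4.2
        (fun s hs t ht => hne s (sub2 hs) t (Icc_subset_Icc_left (sub3 a4).1 ht)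
          (Or.inr (by linarith [ht.1])))]
    ring
  -- Cut off the zeros one by one, by vertical lines.
  refine Finset.induction_on_max_value Prod.fst Z ?_ ?_
  · intro s₀ s₁ hs hF _ hz _
    refine ⟨0, ?_, by simp⟩
    rw [wind_eq_zero hF hs.le ht.le fun s hs t ht h => by simpa using hz s hs t ht h]
    simp
  · intro p Z hpZ hmax ih s₀ s₁ hs hF hZ hz hinj
    have hp := hZ p (Finset.mem_insert_self _ _)
    have hlt : ∀ q ∈ Z, q.1 < p.1 := fun q hq => lt_of_le_of_ne (hmax q hq) fun h => hpZ (by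
      rwa [← hinj (by simp [hq]) (by simp) h])
    obtain ⟨c, hc0, hcp, hcZ⟩ : ∃ c, s₀ < c ∧ c < p.1 ∧ ∀ q ∈ Z, q.1 < c := by
      set m := (insert s₀ (Z.image Prod.fst)).max' (Finset.insert_nonempty _ _) with hm
      have hm1 : m < p.1 := by
        rw [hm, Finset.max'_lt_iff]
        intro y hy
        rcases Finset.mem_insert.1 hy with rfl | hy
        · exact hp.1.1
        · obtain ⟨q, hq, rfl⟩ := Finset.mem_image.1 hy
          exact hlt q hq
      obtain ⟨c, hc1, hc2⟩ := exists_between hm1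
      refine ⟨c, ?_, hc2, fun q hq => ?_⟩
      · exact (Finset.le_max' _ _ (Finset.mem_insert_self _ _)).trans_lt hc1
      · exact (Finset.le_max' _ _ (Finset.mem_insert_of_mem
          (Finset.mem_image_of_mem _ hq))).trans_lt hc1
    have hcs : c < s₁ := hcp.trans hp.1.2
    have hF1 : ContRect F s₀ c t₀ t₁ := hF.mono (Icc_subset_Icc_right hcs.le) subset_rfl
    have hF2 : ContRect F c s₁ t₀ t₁ := hF.mono (Icc_subset_Icc_left hc0.le) subset_rfl
    obtain ⟨W1, hW1, hp1⟩ := ih hc0 hF1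
      (fun q hq => ⟨⟨(hZ q (Finset.mem_insert_of_mem hq)).1.1, hcZ q hq⟩,
        (hZ q (Finset.mem_insert_of_mem hq)).2⟩)
      (fun s hs t ht h => by
        rcases Finset.mem_insert.1 (hz s ⟨hs.1, hs.2.trans hcs.le⟩ t ht h) with h' | h'
        · rw [← h'] at hcp; exact absurd hs.2 (not_le.2 hcp)
        · exact h')
      (hinj.mono (by simp))
    obtain ⟨W2, hW2, hp2⟩ := one c s₁ p hF2 ⟨hcp, hp.1.2⟩ hp.2.1 hp.2.2
      (fun s hs t ht h => by
        rcases Finset.mem_insert.1 (hz s ⟨hc0.le.trans hs.1, hs.2⟩ t ht h) with h' | h'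
        · exact h'
        · exact absurd (hcZ _ h') (not_lt.2 hs.1))
    have hedge : ∀ t, t ∉ Ioo t₀ t₁ → t ∈ Icc t₀ t₁ → ∀ s ∈ Icc s₀ s₁, F s t ≠ 0 :=
      fun t h1 h2 s hs h0 => h1 (hZ _ (hz s hs t h2 h0)).2.1
    refine ⟨W1 + W2, ?_, ?_⟩
    · rw [← wind_add_fst hF ⟨hc0.le, hcs.le⟩ ht.le
        (hedge _ (by simp) (left_mem_Icc.2 ht.le)) (hedge _ (by simp) (right_mem_Icc.2 ht.le)),
        hW1, hW2]
      push_cast; ring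
    · rw [Finset.card_insert_of_notMem hpZ]
      push_cast
      rw [hp1, hp2]

/-! ### Lifting curves from the projective plane to the sphere -/

/-- The action of `{1, -1}` on the sphere by the antipodal map. -/
@[reducible] noncomputable def signAction : MulAction ℤˣ S2 where
  smul u x := if u = 1 then x else -x
  one_smul x := by
    change (if (1 : ℤˣ) = 1 then x else -x) = x
    simp
  mul_smul u v x := by
    change (if u * v = 1 then x else -x) =
      if u = 1 then (if v = 1 then x else -x) else -(if v = 1 then x else -x)
    rcases Int.units_eq_one_or u with rfl | rfl <;> rcases Int.units_eq_one_or v with rfl | rfl <;>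
      simp

lemma neg_ne_self (x : S2) : -x ≠ x := by
  intro h
  have h1 : -(x : E3) = x := congrArg Subtype.val h
  have h2 : (x : E3) = 0 := by
    have h3 : (2 : ℝ) • (x : E3) = 0 := by
      rw [two_smul]; nth_rewrite 1 [← h1]; simp
    exact (smul_eq_zero.1 h3).resolve_left two_ne_zero
  have h4 : ‖(x : E3)‖ = 1 := by simp
  rw [h2, norm_zero] at h4
  exact zero_ne_one h4

lemma isCoveringMap_toRP2 : IsCoveringMap toRP2 := by
  let _ := signAction
  have hsmul : ∀ (u : ℤˣ) (x : S2), u • x = if u = 1 then x else -x := fun _ _ => rfl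
  have : ContinuousConstSMul ℤˣ S2 := ⟨fun u => by
    rcases Int.units_eq_one_or u with rfl | rfl
    · simpa [hsmul] using (continuous_id' : Continuous fun x : S2 => x)
    · simpa [hsmul] using (continuous_neg : Continuous fun x : S2 => -x)⟩
  have : IsCancelSMul ℤˣ S2 := ⟨fun u v x h => by
    rw [hsmul, hsmul] at h
    rcases Int.units_eq_one_or u with rfl | rfl <;> rcases Int.units_eq_one_or v with rfl | rfl
    · rfl
    · simp at h; exact absurd h.symm (neg_ne_self x)
    · simp at h; exact absurd h (neg_ne_self x)
    · rfl⟩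
  refine (Topology.IsQuotientMap.isQuotientCoveringMap_of_properlyDiscontinuousSMul (G := ℤˣ)
    (isQuotientMap_quotient_mk' : Topology.IsQuotientMap toRP2) ?_).isCoveringMap
  intro x y
  change toRP2 x = toRP2 y ↔ _
  rw [toRP2_eq_iff, MulAction.mem_orbit_iff]
  constructor
  · rintro (h | h)
    · exact ⟨1, by simp [hsmul, h]⟩
    · exact ⟨-1, by simp [hsmul, h]⟩
  · rintro ⟨u, hu⟩
    rw [hsmul] at hu
    split_ifs at hu
    · exact Or.inl hu.symm
    · exact Or.inr hu.symm

lemma exists_lift_toRP2 {c : ℝ → RP2} (hc : ContinuousOn c (Icc 0 1)) {y : S2}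
    (hy : toRP2 y = c 0) :
    ∃ x : ℝ → S2, Continuous x ∧ x 0 = y ∧ ∀ t ∈ Icc (0 : ℝ) 1, toRP2 (x t) = c t := by
  obtain ⟨Γ, hΓ, h0⟩ := isCoveringMap_toRP2.exists_path_lifts
    (⟨fun t => c t, hc.domRestrict⟩ : C(unitInterval, RP2)) y hy.symm
  refine ⟨fun t => Γ (projIcc 0 1 zero_le_one t), Γ.continuous.comp continuous_projIcc, ?_, ?_⟩
  · simpa [projIcc_left] using h0
  · intro t ht
    have := congrFun hΓ (projIcc 0 1 zero_le_one t)
    change toRP2 (Γ (projIcc 0 1 zero_le_one t)) = c t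
    rw [projIcc_of_mem zero_le_one ht] at this ⊢
    exact this

/-- A continuous lift of a curve in the projective plane agrees, near a regular parameter, with the
given regular lift up to a constant sign. -/
lemma IsRegularLiftAt.eq_or_eq_neg {c : ℝ → RP2} {t : ℝ} {y : ℝ → E3}
    (hy : IsRegularLiftAt toRP2 c t y) {x : ℝ → S2} (hx : ContinuousAt x t)
    (hxc : ∀ᶠ r in 𝓝 t, toRP2 (x r) = c r) :
    (∀ᶠ r in 𝓝 t, (x r : E3) = y r) ∨ (∀ᶠ r in 𝓝 t, (x r : E3) = -y r) := by
  have hpm : ∀ᶠ r in 𝓝 t, (x r : E3) = y r ∨ (x r : E3) = -y r := by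
    filter_upwards [hxc, hy.1] with r h1 ⟨h2, h3⟩
    rcases toRP2_eq_iff.1 (h1.trans h3.symm) with h | h
    · exact Or.inl (congrArg Subtype.val h)
    · exact Or.inr (congrArg Subtype.val h)
  have hcont : ContinuousAt (fun r => inner ℝ (x r : E3) (y r)) t :=
    (continuous_subtype_val.continuousAt.comp hx).inner (𝕜 := ℝ) hy.2.1.continuousAt
  have hn : ∀ r, inner ℝ (x r : E3) (x r : E3) = (1 : ℝ) := fun r => by
    rw [real_inner_self_eq_norm_sq]
    have : ‖(x r : E3)‖ = 1 := by simp
    rw [this]; norm_num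
  rcases hpm.self_of_nhds with h | h
  · left
    have h1 : (0 : ℝ) < inner ℝ (x t : E3) (y t) := by rw [← h, hn]; norm_num
    filter_upwards [hpm, hcont.eventually (lt_mem_nhds h1)] with r hr h2
    refine hr.resolve_right fun h3 => ?_
    have h4 : y r = -(x r : E3) := by rw [h3, neg_neg]
    rw [h4, inner_neg_right, hn] at h2
    linarith
  · right
    have h5 : y t = -(x t : E3) := by rw [h, neg_neg]
    have h1 : inner ℝ (x t : E3) (y t) < (0 : ℝ) := by rw [h5, inner_neg_right, hn]; norm_num
    filter_upwards [hpm, hcont.eventually (gt_mem_nhds h1)] with r hr h2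
    refine hr.resolve_left fun h3 => ?_
    rw [← h3, hn] at h2
    linarith

/-! ### A generic vertical axis -/

/-- The reflected curve is a regular lift to the projective plane as well. -/
lemma IsRegularLiftAt.neg {c : ℝ → RP2} {t : ℝ} {y : ℝ → E3}
    (hy : IsRegularLiftAt toRP2 c t y) : IsRegularLiftAt toRP2 c t (-y) := by
  refine ⟨?_, hy.2.1.neg, ?_⟩
  · filter_upwards [hy.1] with r ⟨h1, h2⟩
    refine ⟨by simpa using h1, ?_⟩
    rw [← h2, toRP2_eq_iff]
    right
    apply Subtype.ext
    simp
  · rw [deriv.neg]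
    simpa using hy.2.2

lemma dimH_cone_le (x : ℝ → E3) :
    dimH ((fun q : ℝ × ℝ => q.1 • x q.2) '' (univ ×ˢ {t | ContDiffAt ℝ 1 x t})) ≤ 2 := by
  refine (dimH_image_le_of_locally_lipschitzOn ?_).trans ((dimH_mono (subset_univ _)).trans_eq ?_)
  · rintro ⟨r, t⟩ ⟨-, ht⟩
    have h : ContDiffAt ℝ 1 (fun q : ℝ × ℝ => q.1 • x q.2) (r, t) :=
      contDiffAt_fst.smul (ContDiffAt.comp (r, t) (g := x) ht contDiffAt_snd)
    obtain ⟨K, s, hs, hK⟩ := h.exists_lipschitzOnWith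
    exact ⟨K, s, mem_nhdsWithin_of_mem_nhds hs, hK⟩
  · rw [Real.dimH_univ_eq_finrank]; simp

lemma dimH_plane_le (u v : E3) :
    dimH (range fun q : ℝ × ℝ => q.1 • u + q.2 • v) ≤ 2 := by
  have h : ContDiff ℝ 1 fun q : ℝ × ℝ => q.1 • u + q.2 • v := by fun_prop
  refine h.dimH_range_le.trans_eq ?_
  simp

/-- There is a direction transverse to finitely many given curves and planes. -/
lemma exists_generic_direction {ι κ : Type*} [Finite ι] [Finite κ] (x : ι → ℝ → E3)
    (hx : ∀ i, {t ∈ Icc (0 : ℝ) 1 | ¬ ContDiffAt ℝ 1 (x i) t}.Finite) (u v : κ → E3) :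
    ∃ p : E3, ‖p‖ = 1 ∧ (∀ i, ∀ t ∈ Icc (0 : ℝ) 1, ∀ r : ℝ, p ≠ r • x i t) ∧
      ∀ k, ∀ r s : ℝ, p ≠ r • u k + s • v k := by
  set B : Set E3 :=
    (⋃ i, (fun q : ℝ × ℝ => q.1 • x i q.2) '' (univ ×ˢ {t | ContDiffAt ℝ 1 (x i) t})) ∪
    (⋃ i, ⋃ t ∈ {t ∈ Icc (0 : ℝ) 1 | ¬ ContDiffAt ℝ 1 (x i) t},
      range fun q : ℝ × ℝ => q.1 • x i t + q.2 • x i t) ∪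
    (⋃ k, range fun q : ℝ × ℝ => q.1 • u k + q.2 • v k) with hB
  have hdim : dimH B < Module.finrank ℝ E3 := by
    have h2 : dimH B ≤ 2 := by
      rw [hB, dimH_union, dimH_union]
      refine max_le (max_le ?_ ?_) ?_
      · rw [dimH_iUnion]; exact iSup_le fun i => dimH_cone_le _
      · rw [dimH_iUnion]
        refine iSup_le fun i => ?_
        rw [dimH_bUnion (hx i).countable]
        exact iSup₂_le fun t _ => dimH_plane_le _ _
      · rw [dimH_iUnion]; exact iSup_le fun i => dimH_plane_le _ _
    refine h2.trans_lt ?_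
    simp; norm_num
  have hdense := dense_compl_of_dimH_lt_finrank hdim
  obtain ⟨p, hp0, hpB⟩ := hdense.inter_open_nonempty {0}ᶜ isOpen_compl_singleton
    (exists_ne (0 : E3))
  have hp0' : ‖p‖ ≠ 0 := norm_ne_zero_iff.2 hp0
  have hback : ∀ y : E3, ‖p‖⁻¹ • p = y → p = ‖p‖ • y := fun y h => by
    rw [← h, smul_smul, mul_inv_cancel₀ hp0', one_smul]
  refine ⟨‖p‖⁻¹ • p, by rw [norm_smul, norm_inv, norm_norm, inv_mul_cancel₀ hp0'], ?_, ?_⟩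
  · intro i t ht r h
    apply hpB
    have h' := hback _ h
    by_cases hd : ContDiffAt ℝ 1 (x i) t
    · left; left
      exact mem_iUnion.2 ⟨i, (‖p‖ * r, t), ⟨mem_univ _, hd⟩, by
        simp only
        rw [← smul_smul, ← h']⟩
    · left; right
      refine mem_iUnion.2 ⟨i, mem_iUnion₂.2 ⟨t, ⟨ht, hd⟩, (‖p‖ * r, 0), ?_⟩⟩
      simp only [zero_smul, add_zero]
      rw [← smul_smul, ← h']
  · intro k r s h
    apply hpB
    right
    refine mem_iUnion.2 ⟨k, (‖p‖ * r, ‖p‖ * s), ?_⟩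
    have h' := hback _ h
    simp only
    rw [← smul_smul, ← smul_smul, ← smul_add, ← h']

/-- After a rotation, finitely many given curves avoid the vertical axis and finitely many given
planes do not contain it. -/
lemma exists_generic_rotation {ι κ : Type*} [Finite ι] [Finite κ] (x : ι → ℝ → E3)
    (hx : ∀ i, {t ∈ Icc (0 : ℝ) 1 | ¬ ContDiffAt ℝ 1 (x i) t}.Finite) (u v : κ → E3) :
    ∃ O : E3 ≃ₗᵢ[ℝ] E3, (∀ i, ∀ t ∈ Icc (0 : ℝ) 1, x i t ≠ 0 → horiz (O (x i t)) ≠ 0) ∧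
      ∀ k, ∀ r s : ℝ, horiz (O (r • u k + s • v k)) = 0 → r • u k + s • v k = 0 := by
  obtain ⟨p, hp, h1, h2⟩ := exists_generic_direction x hx u v
  set n : E3 := !₂[0, 0, 1] with hn
  have hn1 : ‖n‖ = 1 := by
    rw [EuclideanSpace.norm_eq, hn]; simp [Fin.sum_univ_three]
  set O : E3 ≃ₗᵢ[ℝ] E3 := (ℝ ∙ (p - n))ᗮ.reflection with hO
  have hOp : O p = n := Submodule.reflection_sub (hp.trans hn1.symm)
  have key : ∀ y : E3, horiz (O y) = 0 → ∃ c : ℝ, y = c • p := by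
    intro y hy
    refine ⟨O y 2, O.injective ?_⟩
    rw [map_smul, hOp]
    have hre := congrArg Complex.re hy
    have him := congrArg Complex.im hy
    simp only [horiz, Complex.zero_re, Complex.zero_im] at hre him
    ext i
    fin_cases i
    · simp [hn, hre]
    · simp [hn, him]
    · simp [hn]
  have key' : ∀ y : E3, horiz (O y) = 0 → (∀ r : ℝ, p ≠ r • y) → y = 0 := by
    intro y hy hr
    obtain ⟨c, rfl⟩ := key y hy
    by_cases hc : c = 0
    · simp [hc]
    · exact absurd (by rw [smul_smul, inv_mul_cancel₀ hc, one_smul]) (hr c⁻¹)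
  refine ⟨O, fun i t ht h0 h => h0 (key' _ h (h1 i t ht)), fun k r s h => key' _ h fun q hq => ?_⟩
  rw [smul_add, smul_smul, smul_smul] at hq
  exact h2 k _ _ hq

/-! ### Mercator coordinates of curves -/

section MercatorCurves

variable (O : E3 ≃ₗᵢ[ℝ] E3)

lemma contDiffAt_merc_comp {x : ℝ → E3} {t : ℝ} (hx : ContDiffAt ℝ 1 x t)
    (hw : horiz (O (x t)) ≠ 0) : ContDiffAt ℝ 1 (fun r => merc (O (x r))) t := by
  have hO : ContDiff ℝ 1 (O : E3 → E3) := O.toContinuousLinearEquiv.contDiff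
  exact (contDiffAt_merc hw).comp t (hO.contDiffAt.comp t hx)

lemma eventuallyEq_unmerc_comp {x : ℝ → E3} {t : ℝ} (hx : ContinuousAt x t)
    (hs : ∀ᶠ r in 𝓝 t, x r ∈ Metric.sphere (0 : E3) 1) (hw : horiz (O (x t)) ≠ 0) :
    x =ᶠ[𝓝 t] (fun a => O.symm (unmerc a)) ∘ fun r => merc (O (x r)) := by
  have hc : ContinuousAt (fun r => horiz (O (x r))) t :=
    (contDiff_horiz.continuous.comp O.continuous).continuousAt.comp hx
  filter_upwards [hs, hc.eventually_ne hw] with r h1 h2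
  have h3 : O (x r) ∈ Metric.sphere (0 : E3) 1 := by
    simpa using h1
  simp only [Function.comp_apply]
  rw [unmerc_merc h3 h2, O.symm_apply_apply]

lemma differentiableAt_symm_unmerc {a : ℂ} (ha : a ≠ 0) :
    DifferentiableAt ℝ (fun a => O.symm (unmerc a)) a := by
  have hO : Differentiable ℝ (O.symm : E3 → E3) :=
    (O.symm.toContinuousLinearEquiv.contDiff (n := 1)).differentiable one_ne_zero
  exact hO.differentiableAt.comp a (differentiableAt_unmerc ha)

lemma deriv_merc_comp_ne_zero {x : ℝ → E3} {t : ℝ} (hx : ContDiffAt ℝ 1 x t)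
    (hs : ∀ᶠ r in 𝓝 t, x r ∈ Metric.sphere (0 : E3) 1) (hw : horiz (O (x t)) ≠ 0)
    (hd : deriv x t ≠ 0) : deriv (fun r => merc (O (x r))) t ≠ 0 := by
  intro h
  apply hd
  have ha := (contDiffAt_merc_comp O hx hw).differentiableAt one_ne_zero
  have hg := differentiableAt_symm_unmerc O (merc_ne_zero hw)
  rw [(eventuallyEq_unmerc_comp O hx.continuousAt hs hw).deriv_eq,
    (hg.hasFDerivAt.comp_hasDerivAt t ha.hasDerivAt).deriv, h, map_zero]

lemma det2_merc_comp_ne_zero {x y : ℝ → E3} {s t : ℝ} (hx : ContDiffAt ℝ 1 x s)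
    (hy : ContDiffAt ℝ 1 y t) (hxs : ∀ᶠ r in 𝓝 s, x r ∈ Metric.sphere (0 : E3) 1)
    (hys : ∀ᶠ r in 𝓝 t, y r ∈ Metric.sphere (0 : E3) 1) (hxy : x s = y t)
    (hw : horiz (O (x s)) ≠ 0) (h : LinearIndependent ℝ ![deriv x s, deriv y t]) :
    det2 (deriv (fun r => merc (O (x r))) s) (deriv (fun r => merc (O (y r))) t) ≠ 0 := by
  rw [← linearIndependent_iff_det2]
  have hw' : horiz (O (y t)) ≠ 0 := by rwa [← hxy]
  refine linearIndependent_of_comp (g := fun a => O.symm (unmerc a))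
    ((contDiffAt_merc_comp O hx hw).differentiableAt one_ne_zero)
    ((contDiffAt_merc_comp O hy hw').differentiableAt one_ne_zero) ?_
    (differentiableAt_symm_unmerc O (merc_ne_zero hw))
    (eventuallyEq_unmerc_comp O hx.continuousAt hxs hw)
    (eventuallyEq_unmerc_comp O hy.continuousAt hys hw') h
  simp only [hxy]

end MercatorCurves

/-! ### Crossing parities from angles of difference vectors -/

/-- Vanishes exactly when the points with Mercator coordinates `a` and `b` are equal or
antipodal. -/
noncomputable def antip (a b : ℂ) : ℂ := (a - b) * (1 + a * cj b)

lemma nondegZero_of_mul {F : ℝ → ℝ → ℂ} {u : ℝ × ℝ → ℂ} {a c : ℝ → ℂ} {a' c' : ℂ} {p : ℝ × ℝ}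
    (hF : ∀ᶠ q in 𝓝 p, F q.1 q.2 = u q * (a q.1 - c q.2)) (hu : DifferentiableAt ℝ u p)
    (hu0 : u p ≠ 0) (ha : HasDerivAt a a' p.1) (hc : HasDerivAt c c' p.2) (h0 : a p.1 = c p.2)
    (hdet : det2 a' c' ≠ 0) : NondegZero F p := by
  refine ⟨u p * a', -(u p * c'), ?_, ?_⟩
  · have : det2 (u p * a') (-(u p * c')) = -(normSq (u p) * det2 a' c') := by
      simp only [det2, Complex.mul_re, Complex.mul_im, Complex.neg_re, Complex.neg_im, normSq_apply]
      ring
    rw [this]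
    exact neg_ne_zero.2 (mul_ne_zero (by simpa using hu0) hdet)
  · have h1 : HasFDerivAt (fun q : ℝ × ℝ => a q.1)
        ((ContinuousLinearMap.toSpanSingleton ℝ a').comp (ContinuousLinearMap.fst ℝ ℝ ℝ)) p :=
      HasFDerivAt.comp p (g := a) ha.hasFDerivAt hasFDerivAt_fst
    have h2 : HasFDerivAt (fun q : ℝ × ℝ => c q.2)
        ((ContinuousLinearMap.toSpanSingleton ℝ c').comp (ContinuousLinearMap.snd ℝ ℝ ℝ)) p :=
      HasFDerivAt.comp p (g := c) hc.hasFDerivAt hasFDerivAt_snd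
    have h3 := (hu.hasFDerivAt.mul (h1.sub h2)).congr_of_eventuallyEq hF
    refine (h3.isLittleO.congr_left ?_)
    intro v
    have hp : F p.1 p.2 = 0 := by rw [hF.self_of_nhds, h0]; simp
    simp [h0, hp]
    ring

section Angles

/-- `θ` is an angle of the complex number `z`. -/
def IsAngle (z : ℂ) (θ : ℝ) : Prop := exp (θ * I) = z / (‖z‖ : ℝ)

lemma isAngle_arg {z : ℂ} (hz : z ≠ 0) : IsAngle z z.arg := by
  have : (‖z‖ : ℂ) ≠ 0 := by exact_mod_cast norm_ne_zero_iff.2 hz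
  rw [IsAngle, eq_div_iff this, mul_comm, Complex.norm_mul_exp_arg_mul_I]

lemma IsAngle.mul {z w : ℂ} {θ φ : ℝ} (h : IsAngle z θ) (k : IsAngle w φ) :
    IsAngle (z * w) (θ + φ) := by
  unfold IsAngle at *
  push_cast
  rw [add_mul, Complex.exp_add, h, k, norm_mul]
  push_cast
  rw [div_mul_div_comm]

lemma IsAngle.inv {z : ℂ} {θ : ℝ} (h : IsAngle z θ) : IsAngle z⁻¹ (-θ) := by
  unfold IsAngle at *
  push_cast
  rw [neg_mul, Complex.exp_neg, h, norm_inv]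
  push_cast
  rw [inv_div, div_eq_mul_inv, div_eq_mul_inv, inv_inv, mul_comm]

lemma IsAngle.div {z w : ℂ} {θ φ : ℝ} (h : IsAngle z θ) (k : IsAngle w φ) :
    IsAngle (z / w) (θ - φ) := by
  rw [div_eq_mul_inv, sub_eq_add_neg]; exact h.mul k.inv

lemma IsAngle.conj {z : ℂ} {θ : ℝ} (h : IsAngle z θ) : IsAngle (cj z) (-θ) := by
  unfold IsAngle at *
  have := congrArg cj h
  rw [← Complex.exp_conj, map_mul, Complex.conj_ofReal, Complex.conj_I, map_div₀,
    Complex.conj_ofReal] at this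
  rw [RCLike.norm_conj, ← this]
  push_cast
  ring_nf

lemma isAngle_neg_one : IsAngle (-1) Real.pi := by
  simp [IsAngle, Complex.exp_pi_mul_I]

lemma IsAngle.neg {z : ℂ} {θ : ℝ} (h : IsAngle z θ) : IsAngle (-z) (θ + Real.pi) := by
  have := h.mul isAngle_neg_one
  rwa [mul_neg_one] at this

lemma IsAngle.neg' {z : ℂ} {θ : ℝ} (h : IsAngle z θ) : IsAngle (-z) (θ - Real.pi) := by
  have := h.div isAngle_neg_one
  rwa [div_neg, div_one] at this

lemma isAngle_exp (z : ℂ) : IsAngle (exp z) z.im := by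
  have h : (Real.exp z.re : ℂ) ≠ 0 := by exact_mod_cast (Real.exp_pos _).ne'
  rw [IsAngle, Complex.norm_exp, eq_div_iff h, Complex.ofReal_exp, ← Complex.exp_add]
  congr 1
  apply Complex.ext <;> simp

lemma IsAngle.eq_add {z : ℂ} {θ φ : ℝ} (h : IsAngle z θ) (k : IsAngle z φ) :
    ∃ n : ℤ, θ = φ + 2 * Real.pi * n := by
  obtain ⟨n, hn⟩ := Complex.exp_eq_exp_iff_exists_int.1 (h.trans k.symm)
  refine ⟨n, ?_⟩
  have := congrArg Complex.im hn
  simp at this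
  linarith

end Angles

section Increments

/-- The change of the angle of `a - z` along the curve `a`. -/
noncomputable def angP (a : ℝ → ℂ) (z : ℂ) : ℝ := (dlog (fun s => a s - z) 0 1).im

/-- The change of the angle of `1 + a * conj z` along the curve `a`; up to a constant factor this
is the difference of `a` and the antipode of `z`. -/
noncomputable def angQ (a : ℝ → ℂ) (z : ℂ) : ℝ := (dlog (fun s => 1 + a s * cj z) 0 1).im

variable {a b : ℝ → ℂ}

lemma antip_ne_zero_iff {a b : ℂ} : antip a b ≠ 0 ↔ a - b ≠ 0 ∧ 1 + a * cj b ≠ 0 :=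
  mul_ne_zero_iff

lemma antip_antipode (a : ℂ) {z : ℂ} (hz : z ≠ 0) :
    a - -1 / cj z = (1 / cj z) * (1 + a * cj z) ∧
      1 + a * cj (-1 / cj z) = (-1 / z) * (a - z) := by
  have hz' : cj z ≠ 0 := by simpa using hz
  constructor
  · field_simp; ring
  · simp only [map_div₀, map_neg, map_one, Complex.conj_conj]
    field_simp; ring

lemma angP_antipode (ha : ContinuousOn a (Icc 0 1)) {z : ℂ} (hz : z ≠ 0)
    (h : ∀ s ∈ Icc (0 : ℝ) 1, antip (a s) z ≠ 0) : angP a (-1 / cj z) = angQ a z := by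
  have hz' : cj z ≠ 0 := by simpa using hz
  unfold angP angQ
  simp only [(antip_antipode _ hz).1]
  rw [dlog_const_mul (by simpa using hz) zero_le_one (by fun_prop)
    fun s hs => (antip_ne_zero_iff.1 (h s hs)).2]

lemma angQ_antipode (ha : ContinuousOn a (Icc 0 1)) {z : ℂ} (hz : z ≠ 0)
    (h : ∀ s ∈ Icc (0 : ℝ) 1, antip (a s) z ≠ 0) : angQ a (-1 / cj z) = angP a z := by
  unfold angP angQ
  simp only [(antip_antipode _ hz).2]
  rw [dlog_const_mul (by simpa using hz) zero_le_one (by fun_prop)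
    fun s hs => (antip_ne_zero_iff.1 (h s hs)).1]

lemma dlog_antip_fst (ha : ContinuousOn a (Icc 0 1)) {z : ℂ}
    (h : ∀ s ∈ Icc (0 : ℝ) 1, antip (a s) z ≠ 0) :
    (dlog (fun s => antip (a s) z) 0 1).im = angP a z + angQ a z := by
  unfold antip
  rw [dlog_mul zero_le_one (by fun_prop) (fun s hs => (antip_ne_zero_iff.1 (h s hs)).1)
    (by fun_prop) (fun s hs => (antip_ne_zero_iff.1 (h s hs)).2)]
  rfl

lemma antip_swap (a z : ℂ) : antip z a = -1 * ((a - z) * cj (1 + a * cj z)) := by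
  simp only [antip, map_add, map_one, map_mul, Complex.conj_conj]
  ring

lemma antip_comm_ne_zero {a z : ℂ} : antip z a ≠ 0 ↔ antip a z ≠ 0 := by
  rw [antip_swap, antip]
  simp only [mul_ne_zero_iff, ne_eq, map_eq_zero, neg_eq_zero, one_ne_zero, not_false_eq_true,
    true_and]

lemma dlog_antip_snd (ha : ContinuousOn a (Icc 0 1)) {z : ℂ}
    (h : ∀ s ∈ Icc (0 : ℝ) 1, antip (a s) z ≠ 0) :
    (dlog (fun s => antip z (a s)) 0 1).im = angP a z - angQ a z := by
  have h1 : ∀ s ∈ Icc (0 : ℝ) 1, a s - z ≠ 0 := fun s hs => (antip_ne_zero_iff.1 (h s hs)).1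
  have h2 : ∀ s ∈ Icc (0 : ℝ) 1, 1 + a s * cj z ≠ 0 := fun s hs => (antip_ne_zero_iff.1 (h s hs)).2
  have h2' : ∀ s ∈ Icc (0 : ℝ) 1, cj (1 + a s * cj z) ≠ 0 := fun s hs => by
    rw [ne_eq, map_eq_zero]; exact h2 s hs
  have hc : ContinuousOn (fun s => 1 + a s * cj z) (Icc 0 1) := by fun_prop
  have hc' : ContinuousOn (fun s => cj (1 + a s * cj z)) (Icc 0 1) :=
    Complex.continuous_conj.comp_continuousOn hc
  have hc1 : ContinuousOn (fun s => a s - z) (Icc 0 1) := by fun_prop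
  simp only [antip_swap]
  rw [dlog_const_mul (γ := fun s => (a s - z) * cj (1 + a s * cj z)) (by norm_num) zero_le_one
    (hc1.mul hc') fun s hs => mul_ne_zero (h1 s hs) (h2' s hs),
    dlog_mul zero_le_one hc1 h1 hc' h2', dlog_conj zero_le_one hc h2]
  simp only [Complex.add_im, Complex.conj_im]
  rfl

/-- The winding of `antip` along the boundary of the square, in terms of angles. -/
lemma wind_antip (ha : ContinuousOn a (Icc 0 1)) (hb : ContinuousOn b (Icc 0 1))
    (ha0 : ∀ t ∈ Icc (0 : ℝ) 1, antip (b t) (a 0) ≠ 0)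
    (ha1 : ∀ t ∈ Icc (0 : ℝ) 1, antip (b t) (a 1) ≠ 0)
    (hb0 : ∀ t ∈ Icc (0 : ℝ) 1, antip (a t) (b 0) ≠ 0)
    (hb1 : ∀ t ∈ Icc (0 : ℝ) 1, antip (a t) (b 1) ≠ 0) :
    (wind (fun s t => antip (a s) (b t)) 0 1 0 1).im =
      (angP a (b 0) + angQ a (b 0)) + (angP b (a 1) - angQ b (a 1))
        - (angP a (b 1) + angQ a (b 1)) - (angP b (a 0) - angQ b (a 0)) := by
  unfold wind
  rw [Complex.sub_im, Complex.sub_im, Complex.add_im, dlog_antip_fst ha hb0, dlog_antip_fst ha hb1,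
    dlog_antip_snd hb ha0, dlog_antip_snd hb ha1]

lemma isAngle_angP (ha : ContinuousOn a (Icc 0 1)) {z : ℂ}
    (h : ∀ s ∈ Icc (0 : ℝ) 1, antip (a s) z ≠ 0) :
    IsAngle ((a 1 - z) / (a 0 - z)) (angP a z) := by
  have h1 : ∀ s ∈ Icc (0 : ℝ) 1, a s - z ≠ 0 := fun s hs => (antip_ne_zero_iff.1 (h s hs)).1
  have := exp_dlog (γ := fun s => a s - z) zero_le_one (by fun_prop) h1
  rw [← this]
  exact isAngle_exp _

lemma isAngle_angQ (ha : ContinuousOn a (Icc 0 1)) {z : ℂ}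
    (h : ∀ s ∈ Icc (0 : ℝ) 1, antip (a s) z ≠ 0) :
    IsAngle ((1 + a 1 * cj z) / (1 + a 0 * cj z)) (angQ a z) := by
  have h1 : ∀ s ∈ Icc (0 : ℝ) 1, 1 + a s * cj z ≠ 0 := fun s hs => (antip_ne_zero_iff.1 (h s hs)).2
  have := exp_dlog (γ := fun s => 1 + a s * cj z) zero_le_one (by fun_prop) h1
  rw [← this]
  exact isAngle_exp _

end Increments

/-- The bit `1` if `m < n`. -/
def bit (m n : ℕ) : ℤ := if m < n then 1 else 0

section Reference

variable {V : Type*} (w : V → ℂ) (ρ : V → ℕ)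

/-- Reference angle of the difference vector of two vertices: antisymmetric up to a half turn,
whose sign is determined by the order of the vertices. -/
noncomputable def refA (v x : V) : ℝ :=
  if ρ x < ρ v then (w v - w x).arg else (w x - w v).arg - Real.pi

/-- Reference angle of `1 + w v * conj (w x)`, chosen antisymmetric. -/
noncomputable def refC (v x : V) : ℝ :=
  if ρ x < ρ v then (1 + w v * cj (w x)).arg else -(1 + w x * cj (w v)).arg

lemma refA_swap (hρ : Function.Injective ρ) {v x : V} (h : v ≠ x) :
    refA w ρ v x = refA w ρ x v + Real.pi * (2 * bit (ρ x) (ρ v) - 1) := by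
  have := hρ.ne h
  unfold refA bit
  rcases lt_or_gt_of_ne this with h | h
  · rw [if_neg h.asymm, if_pos h, if_neg h.asymm]; push_cast; ring
  · rw [if_pos h, if_neg h.asymm, if_pos h]; push_cast; ring

lemma refC_swap (hρ : Function.Injective ρ) {v x : V} (h : v ≠ x) :
    refC w ρ v x = -refC w ρ x v := by
  have := hρ.ne h
  unfold refC
  rcases lt_or_gt_of_ne this with h | h
  · rw [if_neg h.asymm, if_pos h]
  · rw [if_pos h, if_neg h.asymm, neg_neg]

lemma isAngle_refA {v x : V} (h : antip (w v) (w x) ≠ 0) : IsAngle (w v - w x) (refA w ρ v x) := by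
  have h1 := (antip_ne_zero_iff.1 h).1
  unfold refA
  split_ifs
  · exact isAngle_arg h1
  · have := (isAngle_arg (z := w x - w v) (by rwa [← neg_sub, neg_ne_zero])).neg'
    rwa [neg_sub] at this

lemma isAngle_refC {v x : V} (h : antip (w v) (w x) ≠ 0) :
    IsAngle (1 + w v * cj (w x)) (refC w ρ v x) := by
  have h1 := (antip_ne_zero_iff.1 h).2
  unfold refC
  split_ifs
  · exact isAngle_arg h1
  · have h2 := (antip_ne_zero_iff.1 (antip_comm_ne_zero.2 h)).2
    have := (isAngle_arg h2).conj
    simpa [mul_comm] using this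

variable {w ρ}

/-- Comparison of the angle changes along a curve from `w u` to `w v` with the reference angles. -/
lemma exists_turns_of_eq {a : ℝ → ℂ} (ha : ContinuousOn a (Icc 0 1)) {u v x : V}
    (h : ∀ s ∈ Icc (0 : ℝ) 1, antip (a s) (w x) ≠ 0) (h0 : a 0 = w u) (h1 : a 1 = w v) :
    ∃ n m : ℤ, angP a (w x) = refA w ρ v x - refA w ρ u x + 2 * Real.pi * n ∧
      angQ a (w x) = refC w ρ v x - refC w ρ u x + 2 * Real.pi * m := by
  have k0 := h 0 (by simp)
  have k1 := h 1 (by simp)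
  rw [h0] at k0
  rw [h1] at k1
  have hP := isAngle_angP ha h
  have hQ := isAngle_angQ ha h
  rw [h0, h1] at hP hQ
  obtain ⟨n, hn⟩ := hP.eq_add ((isAngle_refA w ρ k1).div (isAngle_refA w ρ k0))
  obtain ⟨m, hm⟩ := hQ.eq_add ((isAngle_refC w ρ k1).div (isAngle_refC w ρ k0))
  exact ⟨n, m, hn, hm⟩

/-- Comparison of the angle changes along a curve from `w u` to the antipode of `w v` with the
reference angles. -/
lemma exists_turns_of_antipode {a : ℝ → ℂ} (ha : ContinuousOn a (Icc 0 1)) {u v x : V}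
    (h : ∀ s ∈ Icc (0 : ℝ) 1, antip (a s) (w x) ≠ 0) (h0 : a 0 = w u) (hv : w v ≠ 0)
    (h1 : a 1 = -1 / cj (w v)) :
    ∃ n m : ℤ, angP a (w x) =
        Real.pi + (w v).arg - refC w ρ v x - refA w ρ u x + 2 * Real.pi * n ∧
      angQ a (w x) = (w v).arg - refA w ρ v x - refC w ρ u x + 2 * Real.pi * m := by
  have hv' : cj (w v) ≠ 0 := by simpa using hv
  have k0 := h 0 (by simp)
  have k1 := h 1 (by simp)
  rw [h0] at k0
  rw [h1] at k1
  have e1 : (-1 / cj (w v)) - w x = -(cj (1 + w v * cj (w x)) / cj (w v)) := by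
    simp only [map_add, map_one, map_mul, Complex.conj_conj]
    field_simp
    ring
  have e2 : 1 + (-1 / cj (w v)) * cj (w x) = cj (w v - w x) / cj (w v) := by
    simp only [map_sub]
    field_simp
    ring
  have k2 : antip (w v) (w x) ≠ 0 := by
    have := antip_ne_zero_iff.1 k1
    rw [e1, e2] at this
    refine antip_ne_zero_iff.2 ⟨fun h => this.2 (by rw [h]; simp), fun h => this.1 (by rw [h]; simp)⟩
  have hP := isAngle_angP ha h
  have hQ := isAngle_angQ ha h
  rw [h0, h1, e1] at hP
  rw [h0, h1, e2] at hQ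
  obtain ⟨n, hn⟩ := hP.eq_add ((((isAngle_refC w ρ k2).conj.div (isAngle_arg hv).conj).neg).div
    (isAngle_refA w ρ k0))
  obtain ⟨m, hm⟩ := hQ.eq_add (((isAngle_refA w ρ k2).conj.div (isAngle_arg hv).conj).div
    (isAngle_refC w ρ k0))
  exact ⟨n, m, by rw [hn]; ring, by rw [hm]; ring⟩

end Reference

/-! ### The parity formula for drawings on the projective plane -/

section Pairs

variable {S : Type} {π : S2 → S} {V : Type*} {G : SimpleGraph V}

/-- The pairs of interior parameters at which two curves meet. -/
def crossPairs (c d : ℝ → S) : Set (ℝ × ℝ) :=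
  {p | p.1 ∈ Ioo (0 : ℝ) 1 ∧ p.2 ∈ Ioo (0 : ℝ) 1 ∧ c p.1 = d p.2}

lemma bijOn_crossPairs {c d : ℝ → S} (hc : InjOn c (Icc 0 1)) (hd : InjOn d (Icc 0 1)) :
    BijOn (fun p : ℝ × ℝ => c p.1) (crossPairs c d) (c '' Ioo 0 1 ∩ d '' Ioo 0 1) := by
  refine ⟨?_, ?_, ?_⟩
  · rintro ⟨s, t⟩ ⟨hs, ht, h⟩
    exact ⟨⟨s, hs, rfl⟩, ⟨t, ht, h.symm⟩⟩
  · rintro ⟨s, t⟩ ⟨hs, ht, h⟩ ⟨s', t'⟩ ⟨hs', ht', h'⟩ heq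
    have h1 : s = s' := hc (Ioo_subset_Icc_self hs) (Ioo_subset_Icc_self hs') heq
    have h2 : t = t' := hd (Ioo_subset_Icc_self ht) (Ioo_subset_Icc_self ht')
      (h.symm.trans (heq.trans h'))
    rw [h1, h2]
  · rintro _ ⟨⟨s, hs, rfl⟩, ⟨t, ht, h⟩⟩
    exact ⟨(s, t), ⟨hs, ht, h.symm⟩, rfl⟩

variable [TopologicalSpace S]

lemma Drawing.cr_eq_ncard (D : Drawing π G) (e f : G.edgeSet) :
    D.cr e f = ((crossPairs (D.curve e) (D.curve f)).ncard : ZMod 2) := by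
  have h := bijOn_crossPairs (D.curve_injOn e) (D.curve_injOn f)
  unfold Drawing.cr Drawing.openArc
  rw [← h.image_eq, h.injOn.ncard_image]

lemma Drawing.finite_crossPairs (D : Drawing π G) {e f : G.edgeSet} (hef : e ≠ f) :
    (crossPairs (D.curve e) (D.curve f)).Finite := by
  have h := bijOn_crossPairs (D.curve_injOn e) (D.curve_injOn f)
  refine Finite.of_finite_image ?_ h.injOn
  rw [h.image_eq]
  exact D.crossings_finite e f hef

/-- Curves of independent edges meet at interior parameters only. -/
lemma Drawing.mem_crossPairs_of_eq (D : Drawing π G) {e f : G.edgeSet} (hef : Independent e f)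
    {s t : ℝ} (hs : s ∈ Icc (0 : ℝ) 1) (ht : t ∈ Icc (0 : ℝ) 1) (h : D.curve e s = D.curve f t) :
    (s, t) ∈ crossPairs (D.curve e) (D.curve f) := by
  have key : ∀ (e : G.edgeSet) (s : ℝ), s ∈ Icc (0 : ℝ) 1 →
      s ∈ Ioo (0 : ℝ) 1 ∨ ∃ v ∈ (e : Sym2 V), D.curve e s = D.vertex v := by
    intro e s hs
    obtain ⟨u, v, huv, h0, h1⟩ := D.curve_ends e
    rcases eq_endpoints_or_mem_Ioo_of_mem_Icc hs with rfl | rfl | h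
    · exact Or.inr ⟨u, by rw [huv]; simp, h0⟩
    · exact Or.inr ⟨v, by rw [huv]; simp, h1⟩
    · exact Or.inl h
  rcases key e s hs with h1 | ⟨v, hv, h1⟩ <;> rcases key f t ht with h2 | ⟨w, hw, h2⟩
  · exact ⟨h1, h2, h⟩
  · exact absurd (h.trans h2) (D.curve_ne_vertex e s h1 w)
  · exact absurd (h.symm.trans h1) (D.curve_ne_vertex f t h2 v)
  · have := D.vertex_injective (h1.symm.trans (h.trans h2))
    exact absurd ⟨hv, this ▸ hw⟩ (hef v)

lemma Independent.ne {e f : G.edgeSet} (h : Independent e f) : e ≠ f := by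
  rintro rfl
  obtain ⟨⟨u, v⟩, huv⟩ := e
  exact h u ⟨by simp, by simp⟩

end Pairs

/-- Angle bookkeeping modulo full turns: the winding number of a pair of curves, expressed through
the numbers of turns of each curve around the ends of the other one, is up to an even number the
sum of these numbers, the interleaving number of the ends, and the product of the signs. -/
lemma turns_parity {V : Type*} {w : V → ℂ} {ρ : V → ℕ} (hρ : Function.Injective ρ) {u v x y : V}
    (hux : u ≠ x) (huy : u ≠ y) (hvx : v ≠ x) (hvy : v ≠ y) {W : ℤ} {le lf : Bool}
    {ne me nf mf : V → ℤ} {p q p' q' : V → ℝ}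
    (hp : ∀ z, z = x ∨ z = y → (le = false → p z = refA w ρ v z - refA w ρ u z + 2 * Real.pi * ne z ∧
      q z = refC w ρ v z - refC w ρ u z + 2 * Real.pi * me z) ∧ (le = true →
      p z = Real.pi + (w v).arg - refC w ρ v z - refA w ρ u z + 2 * Real.pi * ne z ∧
      q z = (w v).arg - refA w ρ v z - refC w ρ u z + 2 * Real.pi * me z))
    (hp' : ∀ z, z = u ∨ z = v → (lf = false → p' z = refA w ρ y z - refA w ρ x z + 2 * Real.pi * nf z ∧
      q' z = refC w ρ y z - refC w ρ x z + 2 * Real.pi * mf z) ∧ (lf = true →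
      p' z = Real.pi + (w y).arg - refC w ρ y z - refA w ρ x z + 2 * Real.pi * nf z ∧
      q' z = (w y).arg - refA w ρ y z - refC w ρ x z + 2 * Real.pi * mf z))
    (hW : 2 * Real.pi * W = (p x + q x) + (if le then -1 else 1) * (p' v - q' v)
      - (p y + q y) - (p' u - q' u)) :
    (W : ZMod 2) = (le.toNat * lf.toNat : ZMod 2) +
      (bit (ρ x) (ρ u) + bit (ρ x) (ρ v) + bit (ρ y) (ρ u) + bit (ρ y) (ρ v) : ℤ) +
      ((ne x + me x : ℤ) + (ne y + me y : ℤ) + (nf u + mf u : ℤ) + (nf v + mf v : ℤ)) := by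
  have hpi : Real.pi ≠ 0 := Real.pi_ne_zero
  have a1 := refA_swap w ρ hρ hux
  have a2 := refA_swap w ρ hρ huy
  have a3 := refA_swap w ρ hρ hvx
  have a4 := refA_swap w ρ hρ hvy
  have c1 := refC_swap w ρ hρ hux
  have c2 := refC_swap w ρ hρ huy
  have c3 := refC_swap w ρ hρ hvx
  have c4 := refC_swap w ρ hρ hvy
  have two : (2 : ZMod 2) = 0 := rfl
  have hx := hp x (Or.inl rfl)
  have hy := hp y (Or.inr rfl)
  have hu := hp' u (Or.inl rfl)
  have hv := hp' v (Or.inr rfl)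
  have red : ∀ k : ℤ, (∃ j : ℤ, W = k + 2 * j) → (W : ZMod 2) = (k : ZMod 2) := by
    rintro k ⟨j, rfl⟩
    push_cast; rw [two]; ring
  have hdiv : ∀ k : ℤ, 2 * Real.pi * W = 2 * Real.pi * (k : ℝ) → W = k := fun k h => by
    exact_mod_cast mul_left_cancel₀ (mul_ne_zero two_ne_zero hpi) h
  cases le <;> cases lf
  · obtain ⟨p1, q1⟩ := hx.1 rfl
    obtain ⟨p2, q2⟩ := hy.1 rfl
    obtain ⟨p3, q3⟩ := hu.1 rfl
    obtain ⟨p4, q4⟩ := hv.1 rfl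
    rw [p1, q1, p2, q2, p3, q3, p4, q4, a1, a2, a3, a4, c1, c2, c3, c4] at hW
    have h2 := hdiv (bit (ρ x) (ρ v) - bit (ρ x) (ρ u) - bit (ρ y) (ρ v) + bit (ρ y) (ρ u)
        + (ne x + me x) - (ne y + me y) + (nf v - mf v) - (nf u - mf u)) (by
      rw [hW]; push_cast; simp; ring)
    rw [red (bit (ρ x) (ρ u) + bit (ρ x) (ρ v) + bit (ρ y) (ρ u) + bit (ρ y) (ρ v) +
      (ne x + me x + (ne y + me y) + (nf u + mf u) + (nf v + mf v)))
      ⟨- bit (ρ x) (ρ u) - bit (ρ y) (ρ v) - (ne y + me y) - nf u - mf v, by rw [h2]; ring⟩]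
    simp
  · obtain ⟨p1, q1⟩ := hx.1 rfl
    obtain ⟨p2, q2⟩ := hy.1 rfl
    obtain ⟨p3, q3⟩ := hu.2 rfl
    obtain ⟨p4, q4⟩ := hv.2 rfl
    rw [p1, q1, p2, q2, p3, q3, p4, q4, a1, a2, a3, a4, c1, c2, c3, c4] at hW
    have h2 := hdiv (bit (ρ x) (ρ v) - bit (ρ x) (ρ u) - bit (ρ y) (ρ v) + bit (ρ y) (ρ u)
        + (ne x + me x) - (ne y + me y) + (nf v - mf v) - (nf u - mf u)) (by
      rw [hW]; push_cast; simp; ring)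
    rw [red (bit (ρ x) (ρ u) + bit (ρ x) (ρ v) + bit (ρ y) (ρ u) + bit (ρ y) (ρ v) +
      (ne x + me x + (ne y + me y) + (nf u + mf u) + (nf v + mf v)))
      ⟨- bit (ρ x) (ρ u) - bit (ρ y) (ρ v) - (ne y + me y) - nf u - mf v, by rw [h2]; ring⟩]
    simp
  · obtain ⟨p1, q1⟩ := hx.2 rfl
    obtain ⟨p2, q2⟩ := hy.2 rfl
    obtain ⟨p3, q3⟩ := hu.1 rfl
    obtain ⟨p4, q4⟩ := hv.1 rfl
    rw [p1, q1, p2, q2, p3, q3, p4, q4, a1, a2, a3, a4, c1, c2, c3, c4] at hW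
    have h2 := hdiv (bit (ρ y) (ρ u) + bit (ρ y) (ρ v) - bit (ρ x) (ρ u) - bit (ρ x) (ρ v)
        + (ne x + me x) - (ne y + me y) - (nf v - mf v) - (nf u - mf u)) (by
      rw [hW]; push_cast; simp; ring)
    rw [red (bit (ρ x) (ρ u) + bit (ρ x) (ρ v) + bit (ρ y) (ρ u) + bit (ρ y) (ρ v) +
      (ne x + me x + (ne y + me y) + (nf u + mf u) + (nf v + mf v)))
      ⟨- bit (ρ x) (ρ u) - bit (ρ x) (ρ v) - (ne y + me y) - nf u - nf v, by rw [h2]; ring⟩]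
    simp
  · obtain ⟨p1, q1⟩ := hx.2 rfl
    obtain ⟨p2, q2⟩ := hy.2 rfl
    obtain ⟨p3, q3⟩ := hu.2 rfl
    obtain ⟨p4, q4⟩ := hv.2 rfl
    rw [p1, q1, p2, q2, p3, q3, p4, q4, a1, a2, a3, a4, c1, c2, c3, c4] at hW
    have h2 := hdiv (bit (ρ y) (ρ u) + bit (ρ y) (ρ v) - bit (ρ x) (ρ u) - bit (ρ x) (ρ v)
        + (ne x + me x) - (ne y + me y) - (nf v - mf v) - (nf u - mf u) - 1) (by
      rw [hW]; push_cast; simp; ring)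
    rw [red (1 + (bit (ρ x) (ρ u) + bit (ρ x) (ρ v) + bit (ρ y) (ρ u) + bit (ρ y) (ρ v) +
      (ne x + me x + (ne y + me y) + (nf u + mf u) + (nf v + mf v))))
      ⟨- bit (ρ x) (ρ u) - bit (ρ x) (ρ v) - (ne y + me y) - nf u - nf v - 1, by rw [h2]; ring⟩]
    simp
    ring

/-- The points of the sphere with nonzero horizontal part are determined by their Mercator
coordinates. -/
lemma eq_of_merc_eq {x y : E3} (hx : x ∈ Metric.sphere (0 : E3) 1) (hy : y ∈ Metric.sphere (0 : E3) 1)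
    (hwx : horiz x ≠ 0) (hwy : horiz y ≠ 0) (h : merc x = merc y) : x = y := by
  rw [← unmerc_merc hx hwx, h, unmerc_merc hy hwy]

lemma horiz_neg (x : E3) : horiz (-x) = -horiz x := by
  apply Complex.ext <;> simp [horiz]

section Antip

variable (O : E3 ≃ₗᵢ[ℝ] E3)

lemma antip_merc_eq_zero_iff {x y : S2} (hx : horiz (O x) ≠ 0) (hy : horiz (O y) ≠ 0) :
    antip (merc (O x)) (merc (O y)) = 0 ↔ toRP2 x = toRP2 y := by
  have hOx : O (x : E3) ∈ Metric.sphere (0 : E3) 1 := by simp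
  have hOy : O (y : E3) ∈ Metric.sphere (0 : E3) 1 := by simp
  have hc : cj (merc (O y)) ≠ 0 := by simpa using merc_ne_zero hy
  have h2 : 1 + merc (O x) * cj (merc (O y)) = 0 ↔ merc (O x) = merc (-O y) := by
    rw [merc_neg _ hy, eq_div_iff hc]
    constructor <;> intro h <;> linear_combination h
  rw [antip, mul_eq_zero, sub_eq_zero, h2, toRP2_eq_iff]
  refine or_congr ⟨fun h => ?_, fun h => by rw [h]⟩ ⟨fun h => ?_, fun h => ?_⟩
  · exact Subtype.ext (O.injective (eq_of_merc_eq hOx hOy hx hy h))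
  · have := eq_of_merc_eq hOx (by simp) hx (by rw [horiz_neg]; simpa using hy) h
    exact Subtype.ext (O.injective (by rw [this]; simp))
  · rw [h]; simp

/-- At a transversal crossing, the map `antip` of the Mercator coordinates of lifts of the two curves
has a nondegenerate zero. -/
lemma nondegZero_antip {c d : ℝ → RP2} {s t : ℝ} (h : CrossTransversally toRP2 c s d t)
    {x y : ℝ → S2} (hx : Continuous x) (hy : Continuous y)
    (hxc : ∀ᶠ r in 𝓝 s, toRP2 (x r) = c r) (hyd : ∀ᶠ r in 𝓝 t, toRP2 (y r) = d r)
    (hwx : horiz (O (x s)) ≠ 0) :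
    NondegZero (fun s t => antip (merc (O (x s))) (merc (O (y t)))) (s, t) := by
  obtain ⟨ξ, η, hξ, hη, hst, hli⟩ := h
  -- Change the sign of both local lifts, so that the first one agrees with the global lift.
  obtain ⟨ξ, η, hξ, hη, hst, hli, hxξ⟩ : ∃ ξ η : ℝ → E3, IsRegularLiftAt toRP2 c s ξ ∧
      IsRegularLiftAt toRP2 d t η ∧ ξ s = η t ∧ LinearIndependent ℝ ![deriv ξ s, deriv η t] ∧
      ∀ᶠ r in 𝓝 s, (x r : E3) = ξ r := by
    rcases hξ.eq_or_eq_neg hx.continuousAt hxc with h | h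
    · exact ⟨ξ, η, hξ, hη, hst, hli, h⟩
    · refine ⟨-ξ, -η, hξ.neg, hη.neg, by simp [hst], ?_, h⟩
      rw [deriv.neg, deriv.neg]
      rw [LinearIndependent.pair_iff] at hli ⊢
      intro p q hpq
      apply hli p q
      rw [smul_neg, smul_neg, ← neg_add, neg_eq_zero] at hpq
      exact hpq
  have hmem : ∀ {c : ℝ → RP2} {s : ℝ} {ξ : ℝ → E3}, IsRegularLiftAt toRP2 c s ξ →
      ∀ᶠ r in 𝓝 s, ξ r ∈ Metric.sphere (0 : E3) 1 := fun h => by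
    filter_upwards [h.1] with r hr using hr.1
  have hwξ : horiz (O (ξ s)) ≠ 0 := by rwa [← hxξ.self_of_nhds]
  have hwη : horiz (O (η t)) ≠ 0 := by rwa [← hst]
  have hdet := det2_merc_comp_ne_zero O hξ.2.1 hη.2.1 (hmem hξ) (hmem hη) hst hwξ hli
  have hda := ((contDiffAt_merc_comp O hξ.2.1 hwξ).differentiableAt one_ne_zero)
  have hdc := ((contDiffAt_merc_comp O hη.2.1 hwη).differentiableAt one_ne_zero)
  have hfst : ∀ᶠ q : ℝ × ℝ in 𝓝 (s, t), (x q.1 : E3) = ξ q.1 := (continuousAt_fst (p := (s, t))).eventually hxξ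
  have hdu : DifferentiableAt ℝ (fun q : ℝ × ℝ => merc (O (ξ q.1))) (s, t) :=
    DifferentiableAt.comp (s, t) (g := fun r => merc (O (ξ r))) hda differentiableAt_fst
  have hdv : DifferentiableAt ℝ (fun q : ℝ × ℝ => merc (O (η q.2))) (s, t) :=
    DifferentiableAt.comp (s, t) (g := fun r => merc (O (η r))) hdc differentiableAt_snd
  have hconj : Differentiable ℝ (fun z : ℂ => cj z) :=
    (Complex.conjCLE.contDiff (n := 1)).differentiable one_ne_zero
  have hdv' : DifferentiableAt ℝ (fun q : ℝ × ℝ => cj (merc (O (η q.2)))) (s, t) :=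
    hconj.differentiableAt.comp (s, t) hdv
  have hz : merc (O (ξ s)) ≠ 0 := merc_ne_zero hwξ
  have hz' : merc (O (η t)) ≠ 0 := merc_ne_zero hwη
  have hzz : 1 + merc (O (η t)) * cj (merc (O (η t))) ≠ 0 := by
    rw [Complex.mul_conj]
    have := Complex.normSq_nonneg (merc (O (η t)))
    exact_mod_cast (by linarith : (1 : ℝ) + normSq (merc (O (η t))) ≠ 0)
  rcases hη.eq_or_eq_neg hy.continuousAt hyd with hyη | hyη
  · have hsnd : ∀ᶠ q : ℝ × ℝ in 𝓝 (s, t), (y q.2 : E3) = η q.2 := (continuousAt_snd (p := (s, t))).eventually hyη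
    refine nondegZero_of_mul (u := fun q => 1 + merc (O (ξ q.1)) * cj (merc (O (η q.2)))) ?_
      ((hdu.mul hdv').const_add _) ?_ hda.hasDerivAt hdc.hasDerivAt ?_ hdet
    · filter_upwards [hfst, hsnd] with q h1 h2
      rw [h1, h2, antip, mul_comm]
    · simp only [hst]; exact hzz
    · simp only [hst]
  · have hsnd : ∀ᶠ q : ℝ × ℝ in 𝓝 (s, t), (y q.2 : E3) = -η q.2 := (continuousAt_snd (p := (s, t))).eventually hyη
    have hev : ∀ᶠ q : ℝ × ℝ in 𝓝 (s, t), horiz (O (η q.2)) ≠ 0 := by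
      have : ContinuousAt (fun q : ℝ × ℝ => horiz (O (η q.2))) (s, t) := by
        refine (contDiff_horiz.continuous.comp O.continuous).continuousAt.comp ?_
        exact ContinuousAt.comp (g := η) hη.2.1.continuousAt continuousAt_snd
      exact this.eventually_ne hwη
    -- Here the second curve is the antipode of the local lift `η`, and `1 + a * conj b` is, up to a
    -- nonvanishing factor, the difference of the two local lifts.
    refine nondegZero_of_mul
      (u := fun q => (merc (O (ξ q.1)) + 1 / cj (merc (O (η q.2)))) * (-1 / merc (O (η q.2)))) ?_
      ?_ ?_ hda.hasDerivAt hdc.hasDerivAt ?_ hdet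
    · filter_upwards [hfst, hsnd, hev] with q h1 h2 h3
      have h4 := merc_ne_zero h3
      have h5 : cj (merc (O (η q.2))) ≠ 0 := by simpa using h4
      rw [h1, h2, antip, map_neg, merc_neg _ h3]
      simp only [map_div₀, map_neg, map_one, Complex.conj_conj]
      field_simp
      ring
    · refine (hdu.add ((differentiableAt_const _).mul (hdv'.inv ?_))).mul
        ((differentiableAt_const _).mul (hdv.inv hz'))
      simpa using hz'
    · have h5 : cj (merc (O (η t))) ≠ 0 := by simpa using hz'
      refine mul_ne_zero ?_ (div_ne_zero (by norm_num) hz')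
      simp only [hst]
      intro h0
      apply hzz
      field_simp at h0
      linear_combination h0
    · simp only [hst]

end Antip

/-- Up to a coboundary `N e x + N e y + N f u + N f v`, the crossing parity of independent edges in a
drawing on the projective plane is the interleaving parity of their ends in an arbitrary fixed order
of the vertices, plus the product of the signs telling whether the edges lift to arcs between the
chosen lifts of their ends. -/
theorem exists_parity_formula {V : Type*} [Finite V] {G : SimpleGraph V} (D : RP2Drawing G)
    {ρ : V → ℕ} (hρ : Function.Injective ρ) :
    ∃ (l : G.edgeSet → ZMod 2) (N : G.edgeSet → V → ZMod 2), ∀ e f : G.edgeSet, ∀ u v x y : V,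
      (e : Sym2 V) = s(u, v) → (f : Sym2 V) = s(x, y) → Independent e f →
      D.cr e f = l e * l f +
        (bit (ρ x) (ρ u) + bit (ρ x) (ρ v) + bit (ρ y) (ρ u) + bit (ρ y) (ρ v) : ℤ) +
        (N e x + N e y + N f u + N f v) := by
  classical
  have hsurj : ∀ c : RP2, ∃ y : S2, toRP2 y = c := Quotient.exists_rep
  choose Y hY using fun v => hsurj (D.vertex v)
  choose src tgt hst h0 h1 using D.curve_ends
  have hlift := fun e => exists_lift_toRP2 (D.curve_continuousOn e) ((hY (src e)).trans (h0 e).symm)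
  choose X hXc hX0 hX using hlift
  have hXev : ∀ e, ∀ t ∈ Ioo (0 : ℝ) 1, ∀ᶠ r in 𝓝 t, toRP2 (X e r) = D.curve e r := by
    intro e t ht
    filter_upwards [isOpen_Ioo.mem_nhds ht] with r hr using hX e r (Ioo_subset_Icc_self hr)
  have hfin : ∀ e, {t ∈ Icc (0 : ℝ) 1 | ¬ ContDiffAt ℝ 1 (fun r => (X e r : E3)) t}.Finite := by
    intro e
    refine ((D.curve_regular e).union (Set.toFinite {0, 1})).subset ?_
    rintro t ⟨ht, hn⟩
    rcases eq_endpoints_or_mem_Ioo_of_mem_Icc ht with rfl | rfl | h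
    · simp
    · simp
    · left
      refine ⟨h, fun ⟨y, hy⟩ => hn ?_⟩
      rcases hy.eq_or_eq_neg (hXc e).continuousAt (hXev e t h) with h' | h'
      · exact hy.2.1.congr_of_eventuallyEq h'
      · exact hy.2.1.neg.congr_of_eventuallyEq h'
  obtain ⟨O, hO, -⟩ := exists_generic_rotation (fun e r => (X e r : E3)) hfin
    (fun k : Empty => k.elim) (fun k : Empty => k.elim)
  have hw : ∀ e, ∀ t ∈ Icc (0 : ℝ) 1, horiz (O (X e t)) ≠ 0 := fun e t ht =>
    hO e t ht (ne_zero_of_mem_unit_sphere _)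
  have hI0 : (0 : ℝ) ∈ Icc (0 : ℝ) 1 := by simp
  have hI1 : (1 : ℝ) ∈ Icc (0 : ℝ) 1 := by simp
  set w : V → ℂ := fun v => merc (O (Y v)) with hwdef
  set a : G.edgeSet → ℝ → ℂ := fun e t => merc (O (X e t)) with hadef
  have hac : ∀ e, ContinuousOn (a e) (Icc 0 1) := fun e t ht =>
    (ContinuousAt.comp (g := merc) (f := fun t => O (X e t))
      (contDiffAt_merc (hw e t ht)).continuousAt (O.continuous.comp (continuous_subtype_val.comp (hXc e))).continuousAt).continuousWithinAt
  have ha0 : ∀ e, a e 0 = w (src e) := fun e => by simp only [hadef, hwdef, hX0]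
  -- the sign of an edge
  have hend : ∀ e, ∃ l : Bool, X e 1 = if l then -Y (tgt e) else Y (tgt e) := by
    intro e
    rcases toRP2_eq_iff.1 (((hX e 1 hI1).trans (h1 e)).trans (hY (tgt e)).symm) with h | h
    · exact ⟨false, by simpa using h⟩
    · exact ⟨true, by simpa using h⟩
  choose l hl using hend
  have hwt : ∀ e, horiz (O (Y (tgt e))) ≠ 0 := by
    intro e
    have h := hw e 1 hI1
    rw [hl] at h
    cases hle : l e
    · simpa [hle] using h
    · rw [hle] at h; simp only [if_true] at h
      have : horiz (-O (Y (tgt e))) ≠ 0 := by simpa using h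
      rw [horiz_neg] at this
      simpa using this
  have hws : ∀ e, horiz (O (Y (src e))) ≠ 0 := by
    intro e
    have h := hw e 0 hI0
    rwa [hX0] at h
  have ha1 : ∀ e, a e 1 = if l e then -1 / cj (w (tgt e)) else w (tgt e) := by
    intro e
    simp only [hadef, hwdef, hl]
    cases l e
    · simp
    · simp only [if_true]
      rw [← merc_neg _ (hwt e)]; simp
  -- the curve of an edge does not pass through the other vertices
  have hane : ∀ (e : G.edgeSet) (z : V), z ∉ (e : Sym2 V) → horiz (O (Y z)) ≠ 0 →
      ∀ t ∈ Icc (0 : ℝ) 1, antip (a e t) (w z) ≠ 0 := by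
    intro e z hz hwz t ht h
    rw [antip_merc_eq_zero_iff O (hw e t ht) hwz, hX e t ht, hY] at h
    rcases eq_endpoints_or_mem_Ioo_of_mem_Icc ht with rfl | rfl | h'
    · rw [h0] at h; apply hz; rw [← D.vertex_injective h, hst e]; simp
    · rw [h1] at h; apply hz; rw [← D.vertex_injective h, hst e]; simp
    · exact D.curve_ne_vertex e t h' z h
  have hturn : ∀ (e : G.edgeSet) (z : V), ∃ n m : ℤ, z ∉ (e : Sym2 V) → horiz (O (Y z)) ≠ 0 →
      (l e = false → angP (a e) (w z) = refA w ρ (tgt e) z - refA w ρ (src e) z + 2 * Real.pi * n ∧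
      angQ (a e) (w z) = refC w ρ (tgt e) z - refC w ρ (src e) z + 2 * Real.pi * m) ∧ (l e = true →
      angP (a e) (w z) = Real.pi + (w (tgt e)).arg - refC w ρ (tgt e) z - refA w ρ (src e) z
        + 2 * Real.pi * n ∧
      angQ (a e) (w z) = (w (tgt e)).arg - refA w ρ (tgt e) z - refC w ρ (src e) z
        + 2 * Real.pi * m) := by
    intro e z
    by_cases hz : z ∉ (e : Sym2 V) ∧ horiz (O (Y z)) ≠ 0
    · have hne := hane e z hz.1 hz.2
      have h1' := ha1 e
      cases hle : l e
      · rw [hle] at h1'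
        obtain ⟨n, m, hnm⟩ := exists_turns_of_eq (ρ := ρ) (hac e) hne (ha0 e)
          (by simpa using h1')
        exact ⟨n, m, fun _ _ => ⟨fun _ => hnm, fun h => by simp at h⟩⟩
      · rw [hle] at h1'
        obtain ⟨n, m, hnm⟩ := exists_turns_of_antipode (ρ := ρ) (hac e) hne (ha0 e)
          (merc_ne_zero (hwt e)) (by simpa using h1')
        exact ⟨n, m, fun _ _ => ⟨fun h => by simp at h, fun _ => hnm⟩⟩
    · exact ⟨0, 0, fun h h' => absurd ⟨h, h'⟩ hz⟩
  choose n m hnm using hturn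
  refine ⟨fun e => (l e).toNat, fun e z => ((n e z + m e z : ℤ) : ZMod 2), ?_⟩
  have main : ∀ e f : G.edgeSet, Independent e f →
      D.cr e f = ((l e).toNat * (l f).toNat : ZMod 2) + (bit (ρ (src f)) (ρ (src e)) +
        bit (ρ (src f)) (ρ (tgt e)) + bit (ρ (tgt f)) (ρ (src e)) + bit (ρ (tgt f)) (ρ (tgt e)) : ℤ) +
        ((n e (src f) + m e (src f) : ℤ) + (n e (tgt f) + m e (tgt f) : ℤ) +
          (n f (src e) + m f (src e) : ℤ) + (n f (tgt e) + m f (tgt e) : ℤ)) := by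
    intro e f hef
    have hfe : Independent f e := fun v h => hef v h.symm
    have hef' := Independent.ne hef
    have se : src e ∈ (e : Sym2 V) := by rw [hst e]; simp
    have te : tgt e ∈ (e : Sym2 V) := by rw [hst e]; simp
    have sf : src f ∈ (f : Sym2 V) := by rw [hst f]; simp
    have tf : tgt f ∈ (f : Sym2 V) := by rw [hst f]; simp
    have nse : src e ∉ (f : Sym2 V) := fun h => hef _ ⟨se, h⟩
    have nte : tgt e ∉ (f : Sym2 V) := fun h => hef _ ⟨te, h⟩
    have nsf : src f ∉ (e : Sym2 V) := fun h => hef _ ⟨h, sf⟩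
    have ntf : tgt f ∉ (e : Sym2 V) := fun h => hef _ ⟨h, tf⟩
    set F : ℝ → ℝ → ℂ := fun s t => antip (a e s) (a f t) with hF
    have hFz : ∀ s ∈ Icc (0 : ℝ) 1, ∀ t ∈ Icc (0 : ℝ) 1, (F s t = 0 ↔ D.curve e s = D.curve f t) := by
      intro s hs t ht
      rw [hF]
      simp only [hadef]
      rw [antip_merc_eq_zero_iff O (hw e s hs) (hw f t ht), hX e s hs, hX f t ht]
    have hcont : ContRect F 0 1 0 1 := by
      have h1 : ContinuousOn (fun p : ℝ × ℝ => a e p.1) (Icc 0 1 ×ˢ Icc 0 1) :=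
        (hac e).comp continuousOn_fst fun p hp => hp.1
      have h2 : ContinuousOn (fun p : ℝ × ℝ => a f p.2) (Icc 0 1 ×ˢ Icc 0 1) :=
        (hac f).comp continuousOn_snd fun p hp => hp.2
      exact (h1.sub h2).mul (continuousOn_const.add (h1.mul (Complex.continuous_conj.comp_continuousOn h2)))
    have hfinZ := D.finite_crossPairs hef'
    obtain ⟨W, hW, hWcard⟩ := windParity_card (F := F) one_pos hfinZ.toFinset one_pos hcont
      (fun p hp => by
        rw [Finite.mem_toFinset] at hp
        obtain ⟨hp1, hp2, hp3⟩ := hp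
        refine ⟨hp1, hp2, ?_⟩
        exact nondegZero_antip O (D.crossings_transversal e f hef' _ hp1 _ hp2 hp3) (hXc e) (hXc f)
          (hXev e _ hp1) (hXev f _ hp2) (hw e _ (Ioo_subset_Icc_self hp1)))
      (fun s hs t ht h => by
        rw [Finite.mem_toFinset]
        exact D.mem_crossPairs_of_eq hef hs ht ((hFz s hs t ht).1 h))
      (by
        rintro ⟨s, t⟩ hp ⟨s', t'⟩ hq (rfl : s = s')
        rw [Finite.coe_toFinset] at hp hq
        have := D.curve_injOn f (Ioo_subset_Icc_self hp.2.1) (Ioo_subset_Icc_self hq.2.1)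
          (hp.2.2.symm.trans hq.2.2)
        simp only at this
        rw [this])
    rw [D.cr_eq_ncard, ncard_eq_toFinset_card _ hfinZ, ← hWcard]
    have hzero : ∀ (e f : G.edgeSet) (t : ℝ), Independent f e → t ∈ Icc (0 : ℝ) 1 → (t = 0 ∨ t = 1) →
        ∀ s ∈ Icc (0 : ℝ) 1, antip (a f s) (a e t) ≠ 0 := by
      intro e f t hfe ht h s hs h0
      rw [antip_merc_eq_zero_iff O (hw f s hs) (hw e t ht), hX e t ht, hX f s hs] at h0
      have := (D.mem_crossPairs_of_eq hfe hs ht h0).2.1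
      rcases h with rfl | rfl <;> simp at this
    have hwind := wind_antip (hac e) (hac f) (hzero e f 0 hfe hI0 (Or.inl rfl))
      (hzero e f 1 hfe hI1 (Or.inr rfl)) (hzero f e 0 hef hI0 (Or.inl rfl))
      (hzero f e 1 hef hI1 (Or.inr rfl))
    have hW2 : 2 * Real.pi * W = (wind F 0 1 0 1).im := by
      rw [hW]; simp
    -- the contribution of the final vertex of `f` to the angles along `e`
    have hS : angP (a e) (a f 1) + angQ (a e) (a f 1) =
        angP (a e) (w (tgt f)) + angQ (a e) (w (tgt f)) := by
      have hne := hane e (tgt f) ntf (hwt f)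
      rw [ha1 f]
      cases l f
      · simp
      · simp only [if_true]
        rw [angP_antipode (hac e) (merc_ne_zero (hwt f)) hne,
          angQ_antipode (hac e) (merc_ne_zero (hwt f)) hne, add_comm]
    have hT : angP (a f) (a e 1) - angQ (a f) (a e 1) =
        (if l e then -1 else 1) * (angP (a f) (w (tgt e)) - angQ (a f) (w (tgt e))) := by
      have hne := hane f (tgt e) nte (hwt e)
      rw [ha1 e]
      cases l e
      · simp
      · simp only [if_true]
        rw [angP_antipode (hac f) (merc_ne_zero (hwt e)) hne,
          angQ_antipode (hac f) (merc_ne_zero (hwt e)) hne]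
        ring
    rw [← hW2, hS, hT, ha0 e, ha0 f] at hwind
    refine turns_parity (w := w) hρ (ne_of_mem_of_not_mem sf nse).symm (ne_of_mem_of_not_mem tf nse).symm
      (ne_of_mem_of_not_mem sf nte).symm (ne_of_mem_of_not_mem tf nte).symm (le := l e) (lf := l f) (ne := n e) (me := m e)
      (nf := n f) (mf := m f) (p := fun z => angP (a e) (w z)) (q := fun z => angQ (a e) (w z))
      (p' := fun z => angP (a f) (w z)) (q' := fun z => angQ (a f) (w z)) ?_ ?_ hwind
    · rintro z (rfl | rfl)
      · exact hnm e _ nsf (hws f)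
      · exact hnm e _ ntf (hwt f)
    · rintro z (rfl | rfl)
      · exact hnm f _ nse (hws e)
      · exact hnm f _ nte (hwt e)
  intro e f u v x y he hf hef
  rw [main e f hef]
  have he' := (hst e).symm.trans he
  have hf' := (hst f).symm.trans hf
  rw [Sym2.eq_iff] at he' hf'
  rcases he' with ⟨h1, h2⟩ | ⟨h1, h2⟩ <;> rcases hf' with ⟨h3, h4⟩ | ⟨h3, h4⟩ <;>
    rw [h1, h2, h3, h4] <;> push_cast <;> ring

/-! ### Piecewise linear functions and their sign changes -/

/-- The piecewise linear interpolation of a function on the integers. -/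
noncomputable def pl (y : ℤ → ℝ) (s : ℝ) : ℝ := y ⌊s⌋ + (s - ⌊s⌋) * (y (⌊s⌋ + 1) - y ⌊s⌋)

lemma pl_int (y : ℤ → ℝ) (m : ℤ) : pl y m = y m := by simp [pl]

lemma pl_eq (y : ℤ → ℝ) {m : ℤ} {s : ℝ} (h : s ∈ Icc (m : ℝ) (m + 1)) :
    pl y s = y m + (s - m) * (y (m + 1) - y m) := by
  rcases h.2.eq_or_lt with rfl | h2
  · have := pl_int y (m + 1)
    push_cast at this
    rw [this]; ring
  · have : ⌊s⌋ = m := Int.floor_eq_iff.2 ⟨h.1, h2⟩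
    rw [pl, this]

lemma pl_sub (y z : ℤ → ℝ) (s : ℝ) : pl (fun m => y m - z m) s = pl y s - pl z s := by
  simp only [pl]; ring

lemma pl_shift (y : ℤ → ℝ) (k : ℤ) (s : ℝ) : pl (fun m => y (m - k)) s = pl y (s - k) := by
  have h1 : ⌊s - k⌋ = ⌊s⌋ - k := Int.floor_sub_intCast s k
  simp only [pl, h1]
  rw [show ⌊s⌋ + 1 - k = ⌊s⌋ - k + 1 by ring]
  push_cast
  ring

lemma continuous_pl (y : ℤ → ℝ) : Continuous (pl y) := by
  rw [continuous_iff_continuousAt]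
  intro s
  set m := ⌊s⌋ with hm
  have hc : Continuous fun r : ℝ => y m + max (r - m) 0 * (y (m + 1) - y m)
      + min (r - m) 0 * (y m - y (m - 1)) := by fun_prop
  refine hc.continuousAt.congr ?_
  have h1 : (m : ℝ) - 1 < s := by linarith [Int.floor_le s]
  have h2 : s < m + 1 := Int.lt_floor_add_one s
  filter_upwards [Ioo_mem_nhds h1 h2] with r hr
  rcases le_total (m : ℝ) r with h | h
  · rw [pl_eq y ⟨h, hr.2.le⟩, max_eq_left (by linarith), min_eq_right (by linarith)]; ring
  · have h' : r ∈ Icc (((m - 1 : ℤ)) : ℝ) ((m - 1 : ℤ) + 1) := by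
      push_cast; exact ⟨hr.1.le, by linarith⟩
    rw [pl_eq y h', max_eq_right (by linarith), min_eq_left (by linarith)]
    push_cast
    rw [sub_add_cancel]; ring

/-- The bit telling whether a real number is positive. -/
noncomputable def posBit (x : ℝ) : ZMod 2 := if 0 < x then 1 else 0

lemma posBit_neg {x : ℝ} (hx : x ≠ 0) : posBit (-x) = 1 + posBit x := by
  unfold posBit
  rcases lt_or_gt_of_ne hx with h | h
  · rw [if_pos (by linarith), if_neg (by linarith)]; rfl
  · rw [if_neg (by linarith), if_pos (by linarith)]; rfl

lemma pl_zeros_unit (d : ℤ → ℝ) (m : ℤ) (h0 : d m ≠ 0) (h1 : d (m + 1) ≠ 0) :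
    {s ∈ Ioc (m : ℝ) (m + 1) | pl d s = 0}.Finite ∧
      (({s ∈ Ioc (m : ℝ) (m + 1) | pl d s = 0}.ncard : ℕ) : ZMod 2) =
        posBit (d m) + posBit (d (m + 1)) := by
  by_cases hs : posBit (d m) = posBit (d (m + 1))
  · have hempty : {s ∈ Ioc (m : ℝ) (m + 1) | pl d s = 0} = ∅ := by
      ext s
      simp only [mem_ofPred_eq, mem_empty_iff_false, iff_false, not_and]
      intro hsm
      rw [pl_eq d ⟨hsm.1.le, hsm.2⟩]
      have e : d m + (s - m) * (d (m + 1) - d m) = (1 - (s - m)) * d m + (s - m) * d (m + 1) := by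
        ring
      rw [e]
      have a1 : 0 ≤ 1 - (s - m) := by linarith [hsm.2]
      have a2 : 0 < s - m := by linarith [hsm.1]
      unfold posBit at hs
      rcases lt_or_gt_of_ne h0 with h | h <;> rcases lt_or_gt_of_ne h1 with h' | h'
      · nlinarith [mul_nonneg a1 (by linarith : 0 ≤ -d m), mul_pos a2 (by linarith : 0 < -d (m+1))]
      · rw [if_neg (by linarith), if_pos h'] at hs; simp at hs
      · rw [if_pos h, if_neg (by linarith)] at hs; simp at hs
      · nlinarith [mul_nonneg a1 h.le, mul_pos a2 h']
    rw [hempty, hs]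
    exact ⟨finite_empty, by rw [ncard_empty, CharTwo.add_self_eq_zero]; rfl⟩
  · have hlt : d m * d (m + 1) < 0 := by
      unfold posBit at hs
      rcases lt_or_gt_of_ne h0 with h | h <;> rcases lt_or_gt_of_ne h1 with h' | h'
      · rw [if_neg (by linarith), if_neg (by linarith)] at hs; simp at hs
      · exact mul_neg_of_neg_of_pos h h'
      · exact mul_neg_of_pos_of_neg h h'
      · rw [if_pos h, if_pos h'] at hs; simp at hs
    have hne : d m - d (m + 1) ≠ 0 := fun h => by
      rw [sub_eq_zero.1 h] at hlt; nlinarith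
    have hsing : {s ∈ Ioc (m : ℝ) (m + 1) | pl d s = 0} = {m + d m / (d m - d (m + 1))} := by
      ext s
      simp only [mem_ofPred_eq, mem_singleton_iff]
      constructor
      · rintro ⟨h, hz⟩
        rw [pl_eq d ⟨h.1.le, h.2⟩] at hz
        rw [← sub_eq_iff_eq_add', eq_div_iff hne]
        linear_combination -hz
      · have hq : 0 < d m / (d m - d (m + 1)) ∧ d m / (d m - d (m + 1)) < 1 := by
          rcases lt_or_gt_of_ne h0 with h | h
          · have h' : 0 < d (m + 1) := by nlinarith
            constructor
            · exact div_pos_of_neg_of_neg h (by linarith)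
            · rw [div_lt_one_of_neg (by linarith)]; linarith
          · have h' : d (m + 1) < 0 := by nlinarith
            constructor
            · exact div_pos h (by linarith)
            · rw [div_lt_one (by linarith)]; linarith
        rintro rfl
        have hq' := add_lt_add_right hq.2 (m : ℝ)
        have hq0 := lt_add_of_pos_right (m : ℝ) hq.1
        refine ⟨⟨hq0, hq'.le⟩, ?_⟩
        rw [pl_eq d ⟨hq0.le, hq'.le⟩]
        field_simp
        ring
    rw [hsing]
    refine ⟨finite_singleton _, ?_⟩
    rw [ncard_singleton]
    have : ∀ a b : ZMod 2, a ≠ b → ((1 : ℕ) : ZMod 2) = a + b := by decide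
    exact this _ _ hs

/-- The parity of the number of zeros of a piecewise linear function is determined by its signs at
the ends. -/
lemma pl_zeros (d : ℤ → ℝ) {A B : ℤ} (hAB : A ≤ B) (h : ∀ m, A ≤ m → m ≤ B → d m ≠ 0) :
    {s ∈ Icc (A : ℝ) B | pl d s = 0}.Finite ∧
      (({s ∈ Icc (A : ℝ) B | pl d s = 0}.ncard : ℕ) : ZMod 2) = posBit (d A) + posBit (d B) := by
  induction B, hAB using Int.leInduction with
  | base =>
    have hempty : {s ∈ Icc (A : ℝ) A | pl d s = 0} = ∅ := by
      ext s
      simp only [Icc_self, mem_singleton_iff, mem_ofPred_eq, mem_empty_iff_false, iff_false, not_and]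
      rintro rfl
      rw [pl_int]
      exact h A le_rfl le_rfl
    rw [hempty]
    exact ⟨finite_empty, by rw [ncard_empty, CharTwo.add_self_eq_zero]; rfl⟩
  | succ B hAB ih =>
    obtain ⟨f1, c1⟩ := ih fun m h1 h2 => h m h1 (by omega)
    obtain ⟨f2, c2⟩ := pl_zeros_unit d B (h B hAB (by omega)) (h (B + 1) (by omega) le_rfl)
    have hunion : {s ∈ Icc (A : ℝ) (B + 1 : ℤ) | pl d s = 0} =
        {s ∈ Icc (A : ℝ) B | pl d s = 0} ∪ {s ∈ Ioc (B : ℝ) (B + 1) | pl d s = 0} := by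
      have hAB' : (A : ℝ) ≤ B := by exact_mod_cast hAB
      ext s
      simp only [mem_ofPred_eq, mem_union, mem_Icc, mem_Ioc]
      push_cast
      constructor
      · rintro ⟨⟨h1, h2⟩, h3⟩
        rcases le_or_gt s B with h4 | h4
        · exact Or.inl ⟨⟨h1, h4⟩, h3⟩
        · exact Or.inr ⟨⟨h4, h2⟩, h3⟩
      · rintro (⟨⟨h1, h2⟩, h3⟩ | ⟨⟨h1, h2⟩, h3⟩)
        · exact ⟨⟨h1, by linarith⟩, h3⟩
        · exact ⟨⟨by linarith, h2⟩, h3⟩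
    have hdisj : Disjoint {s ∈ Icc (A : ℝ) B | pl d s = 0} {s ∈ Ioc (B : ℝ) (B + 1) | pl d s = 0} := by
      rw [Set.disjoint_left]
      rintro s ⟨h1, -⟩ ⟨h2, -⟩
      exact absurd h1.2 (not_le.2 h2.1)
    rw [hunion]
    refine ⟨f1.union f2, ?_⟩
    rw [ncard_union_eq hdisj f1 f2, Nat.cast_add, c1, c2]
    have : ∀ a b c : ZMod 2, a + b + (b + c) = a + c := by decide
    exact this _ _ _

/-! ### Spiral drawings on the sphere -/

/-- The heights of a spiral winding once around the axis and then on, from the `i`-th to the `j`-th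
of `n` equidistant points of the equator, when it passes over the `m`-th point: the sign is
prescribed by `β`, but negative at the first pass over its own end and positive after one turn.  The
absolute values are increasing, and distinct for different edges, which are numbered by `idx`. -/
noncomputable def hgt (n N : ℕ) (i j idx : ℤ) (β : ℤ → ZMod 2) (m : ℤ) : ℝ :=
  if m = i ∨ m = j + n then 0
  else (if i + n ≤ m ∨ (m ≠ j ∧ β (m % n) = 1) then 1 else -1) * ((m * N + idx + 1 : ℤ) : ℝ)

section Heights

variable {n N : ℕ} {i j idx : ℤ} {β : ℤ → ZMod 2}

lemma hgt_left : hgt n N i j idx β i = 0 := by simp [hgt]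

lemma hgt_right : hgt n N i j idx β (j + n) = 0 := by simp [hgt]

lemma level_pos (hidx : 0 ≤ idx) {m : ℤ} (h1 : 0 ≤ m) : (0 : ℝ) < ((m * N + idx + 1 : ℤ) : ℝ) := by
  have : (0 : ℤ) < m * N + idx + 1 := by
    have := mul_nonneg h1 (Int.natCast_nonneg N)
    omega
  exact_mod_cast this

lemma hgt_abs (hi : 0 ≤ i) (hidx : 0 ≤ idx) {m : ℤ} (h1 : i < m) (h2 : m < j + n) :
    |hgt n N i j idx β m| = ((m * N + idx + 1 : ℤ) : ℝ) := by
  rw [hgt, if_neg (by omega), abs_mul, abs_of_nonneg (level_pos hidx (by omega)).le]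
  split_ifs <;> simp

lemma hgt_ne_zero (hi : 0 ≤ i) (hidx : 0 ≤ idx) {m : ℤ} (h1 : i < m) (h2 : m < j + n) :
    hgt n N i j idx β m ≠ 0 := by
  rw [← abs_pos, hgt_abs hi hidx h1 h2]
  exact level_pos hidx (by omega)

lemma posBit_sign {P : Prop} [Decidable P] {c : ℝ} (hc : 0 < c) :
    posBit ((if P then 1 else -1) * c) = if P then 1 else 0 := by
  unfold posBit
  by_cases h : P
  · rw [if_pos h, if_pos h, one_mul, if_pos hc]
  · rw [if_neg h, if_neg h, if_neg (by linarith)]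

lemma posBit_hgt (hi : 0 ≤ i) (hidx : 0 ≤ idx) {m : ℤ} (h1 : i < m) (h2 : m < j + n) :
    posBit (hgt n N i j idx β m) =
      if i + n ≤ m then 1 else if m = j then 0 else β (m % n) := by
  rw [hgt, if_neg (by omega), posBit_sign (level_pos hidx (by omega : 0 ≤ m))]
  have hb : β (m % n) ≠ 1 → β (m % n) = 0 := by
    generalize β (m % n) = b; revert b; decide
  split_ifs <;> simp_all

/-- The second turn of a spiral runs above the first one. -/
lemma hgt_lt (hN : 0 < N) (hi : 0 ≤ i) (hij : i < j) (hj : j < n) (hidx : 0 ≤ idx) {m : ℤ} (h1 : i ≤ m)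
    (h2 : m ≤ j) : hgt n N i j idx β m < hgt n N i j idx β (m + n) := by
  rcases h1.eq_or_lt with rfl | h1
  · rw [hgt_left, hgt, if_neg (by omega), if_pos (Or.inl le_rfl), one_mul]
    exact level_pos hidx (by omega)
  rcases h2.eq_or_lt with rfl | h2
  · rw [hgt_right, hgt, if_neg (by omega), if_neg (by push Not; exact ⟨by omega, fun h => absurd rfl h⟩)]
    have := level_pos (N := N) hidx (by omega : 0 ≤ m)
    linarith
  · have e1 := hgt_abs (N := N) (β := β) hi hidx h1 (by omega : m < j + n)
    refine (le_abs_self _).trans_lt ?_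
    rw [e1, hgt, if_neg (by omega), if_pos (Or.inl (by omega)), one_mul]
    have h3 : m * N < (m + n) * N := mul_lt_mul_of_pos_right (by omega) (by omega)
    exact_mod_cast (by omega : m * N + idx + 1 < (m + n) * N + idx + 1)

end Heights

/-- The combinatorial data of one edge of a spiral drawing: its end positions `i < j` among `n`
positions, its number `idx` among `N` edges, and the prescribed sides `β`. -/
structure Spiral (n N : ℕ) where
  i : ℤ
  j : ℤ
  idx : ℤ
  β : ℤ → ZMod 2
  hi : 0 ≤ i
  hij : i < j
  hj : j < n
  hidx : 0 ≤ idx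
  hidxN : idx < N

namespace Spiral

variable {n N : ℕ} (S T : Spiral n N)

/-- The height of the spiral over the integral positions. -/
noncomputable def y (m : ℤ) : ℝ := hgt n N S.i S.j S.idx S.β m

/-- The cylindrical coordinates of the spiral through the heights `y` over the position `s`. -/
noncomputable def helix (n : ℕ) (y : ℤ → ℝ) (s : ℝ) : ℂ := ⟨pl y s, 2 * Real.pi / n * s⟩

/-- The affine reparametrization of the unit interval by the positions from `i` to `j + n`. -/
noncomputable def pos (t : ℝ) : ℝ := S.i + t * (S.j + n - S.i)

/-- The spiral as a curve on the sphere. -/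
noncomputable def curve (t : ℝ) : S2 := pt (helix n S.y (S.pos t))

lemma width_pos : (0 : ℝ) < S.j + n - S.i := by
  have := S.hij; have := S.hj; have := S.hi
  exact_mod_cast (by omega : (0 : ℤ) < S.j + n - S.i)

lemma pos_mem_Icc {t : ℝ} : S.pos t ∈ Icc (S.i : ℝ) (S.j + n) ↔ t ∈ Icc (0 : ℝ) 1 := by
  have := S.width_pos
  unfold pos
  constructor
  · rintro ⟨h1, h2⟩
    exact ⟨by nlinarith, by nlinarith⟩
  · rintro ⟨h1, h2⟩
    exact ⟨by nlinarith, by nlinarith⟩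

lemma pos_mem_Ioo {t : ℝ} : S.pos t ∈ Ioo (S.i : ℝ) (S.j + n) ↔ t ∈ Ioo (0 : ℝ) 1 := by
  have := S.width_pos
  unfold pos
  constructor
  · rintro ⟨h1, h2⟩
    exact ⟨by nlinarith, by nlinarith⟩
  · rintro ⟨h1, h2⟩
    exact ⟨by nlinarith, by nlinarith⟩

lemma pos_injective : Function.Injective S.pos := by
  intro t t' h
  have := S.width_pos
  unfold pos at h
  exact mul_right_cancel₀ this.ne' (add_left_cancel h)

lemma exists_pos_eq (s : ℝ) : ∃ t, S.pos t = s := by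
  have := S.width_pos
  refine ⟨(s - S.i) / (S.j + n - S.i), ?_⟩
  unfold pos
  field_simp
  ring

lemma n_pos (S : Spiral n N) : 0 < n := by have := S.hij; have := S.hj; have := S.hi; omega

lemma exp_helix_eq_iff (hn : 0 < n) {y z : ℤ → ℝ} {s s' : ℝ} :
    exp (helix n y s) = exp (helix n z s') ↔ ∃ k : ℤ, s' = s - (k * n : ℤ) ∧ pl y s = pl z s' := by
  have hn' : (0 : ℝ) < n := by exact_mod_cast hn
  have hpi := Real.pi_pos
  rw [exp_eq_exp_iff]
  simp only [helix]
  constructor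
  · rintro ⟨h1, k, hk⟩
    refine ⟨k, ?_, h1⟩
    field_simp at hk
    push_cast
    linarith
  · rintro ⟨k, rfl, h1⟩
    refine ⟨h1, k, ?_⟩
    push_cast
    field_simp
    ring

/-- Positions on two spirals that differ by full turns differ by at most one turn. -/
lemma turn_bound {s s' : ℝ} {k : ℤ} (hs : s ∈ Icc (S.i : ℝ) (S.j + n))
    (hs' : s' ∈ Icc (T.i : ℝ) (T.j + n)) (h : s' = s - (k * n : ℤ)) : -1 ≤ k ∧ k ≤ 1 := by
  have a1 : (S.j : ℝ) + n < 2 * n := by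
    have := S.hj
    exact_mod_cast (by omega : S.j + n < 2 * n)
  have a2 : (T.j : ℝ) + n < 2 * n := by
    have := T.hj
    exact_mod_cast (by omega : T.j + n < 2 * n)
  have a3 : (0 : ℝ) ≤ S.i := by exact_mod_cast S.hi
  have a4 : (0 : ℝ) ≤ T.i := by exact_mod_cast T.hi
  have hn : (0 : ℝ) < n := by exact_mod_cast S.n_pos
  push_cast at h
  constructor
  · by_contra hk
    have : (k : ℝ) ≤ -2 := by exact_mod_cast (by omega : k ≤ -2)
    nlinarith [hs.1, hs.2, hs'.1, hs'.2]
  · by_contra hk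
    have : (2 : ℝ) ≤ k := by exact_mod_cast (by omega : 2 ≤ k)
    nlinarith [hs.1, hs.2, hs'.1, hs'.2]

lemma N_pos (S : Spiral n N) : 0 < N := by have := S.hidx; have := S.hidxN; omega

lemma pl_pos (d : ℤ → ℝ) {A B : ℤ} (h : ∀ m, A ≤ m → m ≤ B → 0 < d m) {s : ℝ}
    (hs : s ∈ Icc (A : ℝ) B) : 0 < pl d s := by
  have h1 : A ≤ ⌊s⌋ := Int.le_floor.2 hs.1
  have h2 : ⌊s⌋ ≤ B := by exact_mod_cast (Int.floor_le s).trans hs.2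
  have h3 : (0 : ℝ) ≤ s - ⌊s⌋ := by linarith [Int.floor_le s]
  have h4 := Int.lt_floor_add_one s
  unfold pl
  rcases h2.eq_or_lt with h2 | h2
  · have h5 : s = ⌊s⌋ := le_antisymm (by rw [h2]; exact hs.2) (Int.floor_le s)
    have h6 : s - ⌊s⌋ = 0 := by linarith
    rw [h6, zero_mul, add_zero]
    exact h _ h1 (by omega)
  · have h5 := h ⌊s⌋ h1 (by omega)
    have h6 := h (⌊s⌋ + 1) (by omega) (by omega)
    nlinarith

/-- A spiral does not meet itself. -/
lemma injOn_curve : InjOn S.curve (Icc 0 1) := by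
  have key : ∀ s s' : ℝ, s ∈ Icc (S.i : ℝ) (S.j + n) → s' ∈ Icc (S.i : ℝ) (S.j + n) →
      s' = s - (1 * n : ℤ) → pl S.y s = pl S.y s' → False := by
    intro s s' hs hs' h heq
    push_cast at h
    have := pl_pos (fun m => S.y (m - (-n)) - S.y m) (A := S.i) (B := S.j) (s := s')
      (fun m h1 h2 => by
        have := hgt_lt (β := S.β) S.N_pos S.hi S.hij S.hj S.hidx h1 h2
        simp only [y, sub_neg_eq_add]
        linarith) ⟨hs'.1, by linarith [hs.2]⟩
    rw [pl_sub, pl_shift S.y] at this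
    push_cast at this
    rw [show s' - -(n : ℝ) = s by linarith] at this
    linarith
  intro t ht t' ht' h
  rw [← S.pos_mem_Icc] at ht ht'
  obtain ⟨k, hk, heq⟩ := (exp_helix_eq_iff S.n_pos).1 (pt_eq_iff.1 h)
  obtain ⟨h1, h2⟩ := turn_bound S S ht ht' hk
  apply S.pos_injective
  obtain rfl | rfl | rfl : k = 0 ∨ k = 1 ∨ k = -1 := by omega
  · simp at hk; exact hk.symm
  · exact (key _ _ ht ht' hk heq).elim
  · refine (key _ _ ht' ht ?_ heq.symm).elim
    push_cast at hk ⊢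
    linarith

lemma y_i : S.y S.i = 0 := hgt_left

lemma y_j : S.y (S.j + n) = 0 := hgt_right

lemma y_ne_zero {m : ℤ} (h1 : S.i < m) (h2 : m < S.j + n) : S.y m ≠ 0 :=
  hgt_ne_zero S.hi S.hidx h1 h2

variable {S T}

/-- Two different spirals have different heights over the integral positions, except at ends. -/
lemma y_ne (hST : S.idx ≠ T.idx) {m m' : ℤ} (h1 : S.i < m) (h2 : m < S.j + n)
    (h1' : T.i ≤ m') (h2' : m' ≤ T.j + n) : S.y m ≠ T.y m' := by
  intro h
  rcases h1'.eq_or_lt with rfl | h1'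
  · exact S.y_ne_zero h1 h2 (h.trans T.y_i)
  rcases h2'.eq_or_lt with rfl | h2'
  · exact S.y_ne_zero h1 h2 (h.trans T.y_j)
  have e := congrArg abs h
  unfold y at e
  rw [hgt_abs S.hi S.hidx h1 h2, hgt_abs T.hi T.hidx h1' h2', Int.cast_inj] at e
  apply hST
  have e' : S.idx - T.idx = N * (m' - m) := by linear_combination e
  have b1 := S.hidx; have b2 := S.hidxN; have b3 := T.hidx; have b4 := T.hidxN
  have := Int.eq_zero_of_abs_lt_dvd ⟨_, e'⟩ (abs_lt.2 ⟨by omega, by omega⟩)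
  omega

end Spiral

namespace Spiral

variable {n N : ℕ} {S T : Spiral n N}

/-- The slope of a spiral over the unit interval starting at `m`. -/
noncomputable def slope (S : Spiral n N) (m : ℤ) : ℝ := S.y (m + 1) - S.y m

lemma contDiffAt_of_affine {L : ℝ → ℂ} {a b : ℂ} {t : ℝ}
    (h : L =ᶠ[𝓝 t] fun r : ℝ => a + (r : ℂ) * b) : ContDiffAt ℝ 1 L t ∧ deriv L t = b := by
  have hd : ContDiff ℝ 1 fun r : ℝ => a + (r : ℂ) * b :=
    contDiff_const.add (Complex.ofRealCLM.contDiff.mul contDiff_const)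
  refine ⟨hd.contDiffAt.congr_of_eventuallyEq h, ?_⟩
  rw [h.deriv_eq]
  have := ((Complex.ofRealCLM.hasDerivAt (x := t)).mul_const b).const_add a
  simpa using this.deriv

/-- Between integral positions, a spiral is a segment in cylindrical coordinates. -/
lemma helix_affine {t : ℝ} (h : S.pos t ≠ ⌊S.pos t⌋) :
    ContDiffAt ℝ 1 (fun r => helix n S.y (S.pos r)) t ∧
      deriv (fun r => helix n S.y (S.pos r)) t =
        ⟨(S.j + n - S.i) * S.slope ⌊S.pos t⌋, (S.j + n - S.i) * (2 * Real.pi / n)⟩ := by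
  set m := ⌊S.pos t⌋ with hm
  apply contDiffAt_of_affine (a := ⟨S.y m + (S.i - m) * S.slope m, 2 * Real.pi / n * S.i⟩)
  have h1 : (m : ℝ) < S.pos t := lt_of_le_of_ne (Int.floor_le _) (Ne.symm h)
  have h2 : S.pos t < m + 1 := Int.lt_floor_add_one _
  have hc : ContinuousAt S.pos t := by unfold pos; fun_prop
  filter_upwards [hc (Ioo_mem_nhds h1 h2)] with r hr
  have hr' : S.pos r ∈ Icc (m : ℝ) (m + 1) := ⟨hr.1.le, hr.2.le⟩
  apply Complex.ext
  · simp only [helix, pl_eq S.y hr', slope]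
    simp [pos]
    ring
  · simp [helix, pos]
    ring

/-- At a common point of two different spirals, none of them is at an integral position, and their
slopes differ. -/
lemma slope_ne (hST : S.idx ≠ T.idx) {s s' : ℝ} {k : ℤ} (hs : s ∈ Ioo (S.i : ℝ) (S.j + n))
    (hs' : s' ∈ Ioo (T.i : ℝ) (T.j + n)) (hk : s' = s - (k * n : ℤ)) (h : pl S.y s = pl T.y s') :
    s ≠ ⌊s⌋ ∧ s' ≠ ⌊s'⌋ ∧ ⌊s'⌋ = ⌊s⌋ - k * n ∧ S.slope ⌊s⌋ ≠ T.slope ⌊s'⌋ := by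
  have hf : ⌊s'⌋ = ⌊s⌋ - k * n := by rw [hk]; exact Int.floor_sub_intCast s _
  have hSn := S.hj
  have hSij := S.hij
  have hi0 := S.hi
  have a1 : S.i ≤ ⌊s⌋ := Int.le_floor.2 hs.1.le
  have a2 : ⌊s⌋ < S.j + n := by
    have := (Int.floor_le s).trans_lt hs.2
    exact_mod_cast this
  have a3 : T.i ≤ ⌊s'⌋ := Int.le_floor.2 hs'.1.le
  have a4 : ⌊s'⌋ < T.j + n := by
    have := (Int.floor_le s').trans_lt hs'.2
    exact_mod_cast this
  have b1 : s ≠ ⌊s⌋ := by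
    intro he
    have he' : s' = ⌊s'⌋ := by rw [hf, hk]; push_cast; linarith
    rw [he, he', pl_int, pl_int] at h
    refine y_ne hST ?_ a2 a3 a4.le h
    have := hs.1
    rw [he] at this
    exact_mod_cast this
  refine ⟨b1, ?_, hf, ?_⟩
  · intro he
    apply b1
    rw [hf] at he
    push_cast at he hk
    linarith
  · intro hsl
    have e : s' - ⌊s'⌋ = s - ⌊s⌋ := by rw [hf, hk]; push_cast; ring
    have hy : S.y ⌊s⌋ = T.y ⌊s'⌋ := by
      unfold pl at h
      unfold slope at hsl
      rw [e, ← hsl] at h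
      linarith
    rcases a1.eq_or_lt with a1 | a1
    · refine y_ne (m := ⌊s⌋ + 1) (m' := ⌊s'⌋ + 1) hST (by omega) (by omega) (by omega) (by omega) ?_
      unfold slope at hsl
      linarith
    · exact y_ne hST a1 a2 a3 a4.le hy

lemma exists_turn {t t' : ℝ} (ht : t ∈ Icc (0 : ℝ) 1) (ht' : t' ∈ Icc (0 : ℝ) 1)
    (h : S.curve t = T.curve t') : ∃ k : ℤ, (-1 ≤ k ∧ k ≤ 1) ∧
      T.pos t' = S.pos t - (k * n : ℤ) ∧ pl S.y (S.pos t) = pl T.y (T.pos t') := by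
  obtain ⟨k, hk, heq⟩ := (exp_helix_eq_iff S.n_pos).1 (pt_eq_iff.1 h)
  exact ⟨k, turn_bound S T (S.pos_mem_Icc.2 ht) (T.pos_mem_Icc.2 ht') hk, hk, heq⟩

lemma crossTransversally_curve (hST : S.idx ≠ T.idx) {t t' : ℝ} (ht : t ∈ Ioo (0 : ℝ) 1)
    (ht' : t' ∈ Ioo (0 : ℝ) 1) (h : S.curve t = T.curve t') :
    CrossTransversally id S.curve t T.curve t' := by
  obtain ⟨k, -, hk, heq⟩ := exists_turn (Ioo_subset_Icc_self ht) (Ioo_subset_Icc_self ht') h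
  obtain ⟨b1, b2, -, b4⟩ := slope_ne hST (S.pos_mem_Ioo.2 ht) (T.pos_mem_Ioo.2 ht') hk heq
  obtain ⟨c1, d1⟩ := helix_affine b1
  obtain ⟨c2, d2⟩ := helix_affine b2
  refine crossTransversally_pt (Eventually.of_forall fun r => rfl) (Eventually.of_forall fun r => rfl)
    c1 c2 (pt_eq_iff.1 h) ?_
  rw [d1, d2, det2]
  have hn : (0 : ℝ) < n := by exact_mod_cast S.n_pos
  have e : ((S.j + n - S.i : ℝ) * S.slope ⌊S.pos t⌋) * ((T.j + n - T.i) * (2 * Real.pi / n)) -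
      ((S.j + n - S.i) * (2 * Real.pi / n)) * ((T.j + n - T.i) * T.slope ⌊T.pos t'⌋) =
      ((S.j + n - S.i) * (T.j + n - T.i) * (2 * Real.pi / n)) *
        (S.slope ⌊S.pos t⌋ - T.slope ⌊T.pos t'⌋) := by ring
  rw [e]
  refine mul_ne_zero (mul_ne_zero (mul_ne_zero S.width_pos.ne' T.width_pos.ne') ?_)
    (sub_ne_zero.2 b4)
  have := Real.pi_pos
  positivity

lemma finite_crossPairs_curve (hST : S.idx ≠ T.idx) : (crossPairs S.curve T.curve).Finite := by
  have hsub : crossPairs S.curve T.curve ⊆ ⋃ q ∈ (Icc 0 (2 * n : ℤ) ×ˢ Icc (-1 : ℤ) 1),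
      {p ∈ crossPairs S.curve T.curve | ⌊S.pos p.1⌋ = q.1 ∧
        T.pos p.2 = S.pos p.1 - (q.2 * n : ℤ) ∧ pl S.y (S.pos p.1) = pl T.y (T.pos p.2)} := by
    rintro ⟨t, t'⟩ ⟨ht, ht', h⟩
    obtain ⟨k, hkb, hk, heq⟩ := exists_turn (Ioo_subset_Icc_self ht) (Ioo_subset_Icc_self ht') h
    simp only [mem_iUnion]
    have h1 := S.pos_mem_Ioo.2 ht
    refine ⟨(⌊S.pos t⌋, k), ⟨⟨?_, ?_⟩, hkb⟩, ⟨ht, ht', h⟩, rfl, hk, heq⟩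
    · exact S.hi.trans (Int.le_floor.2 h1.1.le)
    · have h2 : ⌊S.pos t⌋ < S.j + n := by
        have := (Int.floor_le (S.pos t)).trans_lt h1.2
        exact_mod_cast this
      have := S.hj
      simp only
      omega
  refine Finite.subset (Finite.biUnion ((finite_Icc _ _).prod (finite_Icc _ _)) ?_) hsub
  rintro ⟨m, k⟩ -
  apply Set.Subsingleton.finite
  rintro ⟨t1, t1'⟩ ⟨⟨ht, ht', -⟩, hm, hk, heq⟩ ⟨t2, t2'⟩ ⟨-, hm2, hk2, heq2⟩
  simp only at ht ht' hm hk heq hm2 hk2 heq2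
  obtain ⟨-, -, b3, b4⟩ := slope_ne hST (S.pos_mem_Ioo.2 ht) (T.pos_mem_Ioo.2 ht') hk heq
  have b3' : ⌊T.pos t2'⌋ = ⌊S.pos t2⌋ - k * n := by rw [hk2]; exact Int.floor_sub_intCast _ _
  have e1 : T.pos t1' - ⌊T.pos t1'⌋ = S.pos t1 - m := by rw [b3, hk, hm]; push_cast; ring
  have e2 : T.pos t2' - ⌊T.pos t2'⌋ = S.pos t2 - m := by rw [b3', hk2, hm2]; push_cast; ring
  have hpos : S.pos t1 = S.pos t2 := by
    by_contra hne
    apply b4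
    unfold pl at heq heq2
    unfold slope
    rw [e1, b3, hm] at heq
    rw [e2, b3', hm2] at heq2
    rw [hm, b3, hm]
    have : (S.pos t1 - S.pos t2) * ((S.y (m + 1) - S.y m) - (T.y (m - k * n + 1) - T.y (m - k * n)))
        = 0 := by linear_combination heq - heq2
    rcases mul_eq_zero.1 this with h | h
    · exact absurd (sub_eq_zero.1 h) hne
    · exact sub_eq_zero.1 h
  have h1 := S.pos_injective hpos
  have h2 := T.pos_injective (by rw [hk, hk2, hpos] : T.pos t1' = T.pos t2')
  rw [h1, h2]

/-! ### Crossing parities of spirals -/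

lemma posBit_y (S : Spiral n N) {m : ℤ} (h1 : S.i < m) (h2 : m < S.j + n) : posBit (S.y m) =
    if S.i + n ≤ m then 1 else if m = S.j then 0 else S.β (m % n) :=
  posBit_hgt S.hi S.hidx h1 h2

/-- The ends of two spirals are at different positions. -/
structure Apart (S T : Spiral n N) : Prop where
  idx : S.idx ≠ T.idx
  ii : S.i ≠ T.i
  ij : S.i ≠ T.j
  ji : S.j ≠ T.i
  jj : S.j ≠ T.j

lemma Apart.ends (h : Apart S T) {m k : ℤ} (hk : -1 ≤ k ∧ k ≤ 1) (hm : m = S.i ∨ m = S.j + n) :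
    m - k * n ≠ T.i ∧ m - k * n ≠ T.j + n := by
  have := h.ii; have := h.ij; have := h.ji; have := h.jj
  have := S.hi; have := S.hij; have := S.hj; have := T.hi; have := T.hij; have := T.hj
  obtain rfl | rfl | rfl : k = 0 ∨ k = 1 ∨ k = -1 := by omega
  all_goals omega

lemma Apart.y_ne (h : Apart S T) {m k : ℤ} (hk : -1 ≤ k ∧ k ≤ 1) (h1 : S.i ≤ m)
    (h2 : m ≤ S.j + n) (h1' : T.i ≤ m - k * n) (h2' : m - k * n ≤ T.j + n) :
    S.y m ≠ T.y (m - k * n) := by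
  by_cases hm : m = S.i ∨ m = S.j + n
  · obtain ⟨e1, e2⟩ := h.ends hk hm
    exact (Spiral.y_ne h.idx.symm (lt_of_le_of_ne h1' (Ne.symm e1)) (lt_of_le_of_ne h2' e2) h1 h2).symm
  · push Not at hm
    exact Spiral.y_ne h.idx (lt_of_le_of_ne h1 (Ne.symm hm.1)) (lt_of_le_of_ne h2 hm.2) h1' h2'

/-- The crossings of two spirals at which the positions differ by `k` turns. -/
def turnPairs (S T : Spiral n N) (k : ℤ) : Set (ℝ × ℝ) :=
  {p ∈ crossPairs S.curve T.curve | T.pos p.2 = S.pos p.1 - (k * n : ℤ)}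

lemma Apart.card_turnPairs (h : Apart S T) {k : ℤ} (hk : -1 ≤ k ∧ k ≤ 1) :
    ((turnPairs S T k).ncard : ZMod 2) =
      if max S.i (T.i + k * n) ≤ min (S.j + n) (T.j + n + k * n) then
        posBit (S.y (max S.i (T.i + k * n)) - T.y (max S.i (T.i + k * n) - k * n)) +
        posBit (S.y (min (S.j + n) (T.j + n + k * n)) -
          T.y (min (S.j + n) (T.j + n + k * n) - k * n)) else 0 := by
  set A := max S.i (T.i + k * n) with hA
  set B := min (S.j + n) (T.j + n + k * n) with hB
  set d : ℤ → ℝ := fun m => S.y m - T.y (m - k * n) with hd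
  have hpl : ∀ s, pl d s = pl S.y s - pl T.y (s - (k * n : ℤ)) := fun s => by
    rw [hd, pl_sub, pl_shift T.y]
  have hAB : ∀ s : ℝ, s ∈ Icc (A : ℝ) B ↔ s ∈ Icc (S.i : ℝ) (S.j + n) ∧
      s - (k * n : ℤ) ∈ Icc (T.i : ℝ) (T.j + n) := by
    intro s
    rw [hA, hB]
    push_cast
    simp only [mem_Icc, max_le_iff, le_min_iff]
    constructor
    · rintro ⟨⟨h1, h2⟩, h3, h4⟩
      exact ⟨⟨h1, h3⟩, by linarith, by linarith⟩
    · rintro ⟨⟨h1, h2⟩, h3, h4⟩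
      exact ⟨⟨h1, by linarith⟩, h2, by linarith⟩
  have hbij : BijOn (fun p : ℝ × ℝ => S.pos p.1) (turnPairs S T k)
      {s ∈ Icc (A : ℝ) B | pl d s = 0} := by
    refine ⟨?_, ?_, ?_⟩
    · rintro ⟨t, t'⟩ ⟨⟨ht, ht', heq⟩, hk'⟩
      simp only at ht ht' heq hk'
      refine ⟨(hAB _).2 ⟨S.pos_mem_Icc.2 (Ioo_subset_Icc_self ht), ?_⟩, ?_⟩
      · rw [← hk']
        exact T.pos_mem_Icc.2 (Ioo_subset_Icc_self ht')
      · have e := (exp_eq_exp_iff.1 (pt_eq_iff.1 heq)).1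
        simp only [helix] at e
        simp only [hpl]
        rw [← hk', e, sub_self]
    · rintro ⟨t1, t1'⟩ ⟨-, h1⟩ ⟨t2, t2'⟩ ⟨-, h2⟩ heq
      simp only at h1 h2 heq
      rw [S.pos_injective heq, T.pos_injective (by rw [h1, h2, heq] : T.pos t1' = T.pos t2')]
    · rintro s ⟨hs, hz⟩
      obtain ⟨h1, h2⟩ := (hAB s).1 hs
      obtain ⟨t, rfl⟩ := S.exists_pos_eq s
      obtain ⟨t', ht'⟩ := T.exists_pos_eq (S.pos t - (k * n : ℤ))
      rw [hpl, sub_eq_zero] at hz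
      have e1 : t ∈ Ioo (0 : ℝ) 1 := by
        rw [← S.pos_mem_Ioo]
        refine ⟨lt_of_le_of_ne h1.1 fun he => ?_, lt_of_le_of_ne h1.2 fun he => ?_⟩
        · rw [← he, ← Int.cast_sub, pl_int, pl_int] at hz
          rw [← he, ← Int.cast_sub] at h2
          exact h.y_ne hk le_rfl (by have := S.hij; have := S.n_pos; omega) (by exact_mod_cast h2.1)
            (by exact_mod_cast h2.2) hz
        · rw [he, show (S.j + n : ℝ) = ((S.j + n : ℤ) : ℝ) by push_cast; rfl, ← Int.cast_sub,
            pl_int, pl_int] at hz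
          rw [he, show (S.j + n : ℝ) = ((S.j + n : ℤ) : ℝ) by push_cast; rfl, ← Int.cast_sub] at h2
          exact h.y_ne hk (by have := S.hij; have := S.n_pos; omega) le_rfl (by exact_mod_cast h2.1)
            (by exact_mod_cast h2.2) hz
      have e2 : t' ∈ Ioo (0 : ℝ) 1 := by
        rw [← T.pos_mem_Ioo, ht']
        have hST : ∀ m : ℤ, (m : ℝ) = S.pos t - (k * n : ℤ) → T.i ≤ m → m ≤ T.j + n →
            pl S.y (S.pos t) = pl T.y (S.pos t - (k * n : ℤ)) → False := by
          intro m hm m1 m2 hz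
          have hm' : S.pos t = ((m + k * n : ℤ) : ℝ) := by push_cast at hm ⊢; linarith
          rw [← hm, hm', pl_int, pl_int] at hz
          rw [hm'] at h1
          have := h.y_ne hk (m := m + k * n) (by exact_mod_cast h1.1) (by exact_mod_cast h1.2)
          rw [add_sub_cancel_right] at this
          exact this m1 m2 hz
        have hT := T.hij
        refine ⟨lt_of_le_of_ne h2.1 fun he => ?_, lt_of_le_of_ne h2.2 fun he => ?_⟩
        · exact hST T.i he le_rfl (by omega) hz
        · exact hST (T.j + n) (by rw [he]; push_cast; rfl) (by omega) le_rfl hz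
      refine ⟨(t, t'), ⟨⟨e1, e2, ?_⟩, ht'⟩, rfl⟩
      exact pt_eq_iff.2 ((exp_helix_eq_iff S.n_pos).2 ⟨k, ht', by rw [ht']; exact hz⟩)
  rw [← hbij.injOn.ncard_image, hbij.image_eq]
  split_ifs with hle
  · refine (pl_zeros d hle fun m h1 h2 => sub_ne_zero.2 (h.y_ne hk ?_ ?_ ?_ ?_)).2
    · exact (le_max_left _ _).trans h1
    · exact h2.trans (min_le_left _ _)
    · have := (le_max_right S.i (T.i + k * n)).trans h1
      omega
    · have := h2.trans (min_le_right (S.j + n) (T.j + n + k * n))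
      omega
  · have : {s ∈ Icc (A : ℝ) B | pl d s = 0} = ∅ := by
      ext s
      simp only [mem_ofPred_eq, mem_empty_iff_false, iff_false, not_and]
      intro hs
      exact absurd (by exact_mod_cast hs.1.trans hs.2) hle
    rw [this, ncard_empty]
    rfl

lemma posBit_left {m m' : ℤ} (hm : m = S.i ∨ m = S.j + n) (h1 : T.i < m')
    (h2 : m' < T.j + n) : posBit (S.y m - T.y m') =
      1 + if T.i + n ≤ m' then 1 else if m' = T.j then 0 else T.β (m' % n) := by
  have : S.y m = 0 := by
    rcases hm with rfl | rfl
    exacts [S.y_i, S.y_j]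
  rw [this, zero_sub, posBit_neg (T.y_ne_zero h1 h2), T.posBit_y h1 h2]

lemma posBit_right {m m' : ℤ} (hm : m' = T.i ∨ m' = T.j + n) (h1 : S.i < m)
    (h2 : m < S.j + n) : posBit (S.y m - T.y m') =
      if S.i + n ≤ m then 1 else if m = S.j then 0 else S.β (m % n) := by
  have : T.y m' = 0 := by
    rcases hm with rfl | rfl
    exacts [T.y_i, T.y_j]
  rw [this, sub_zero, S.posBit_y h1 h2]

lemma emod_i (S : Spiral n N) : S.i % n = S.i :=
  Int.emod_eq_of_lt S.hi (S.hij.trans S.hj)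

lemma emod_j (S : Spiral n N) : S.j % n = S.j :=
  Int.emod_eq_of_lt (S.hi.trans S.hij.le) S.hj

lemma Apart.card_turnPairs_zero (h : Apart S T) : ((turnPairs S T 0).ncard : ZMod 2) =
    (if S.i < T.i then S.β T.i else 1 + T.β S.i) +
    (if S.j < T.j then 1 + (if T.i < S.j then 1 else T.β S.j) else
      (if S.i < T.j then 1 else S.β T.j)) := by
  have := h.ii; have := h.ij; have := h.ji; have := h.jj
  have := S.hi; have := S.hij; have := S.hj; have := T.hi; have := T.hij; have := T.hj
  rw [h.card_turnPairs (by norm_num)]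
  simp only [zero_mul, add_zero, sub_zero]
  rw [if_pos (by omega)]
  congr 1
  · split_ifs with h1
    · rw [max_eq_right h1.le, posBit_right (Or.inl rfl) h1 (by omega), if_neg (by omega),
        if_neg (by omega), T.emod_i]
    · rw [max_eq_left (by omega), posBit_left (Or.inl rfl) (by omega) (by omega),
        if_neg (by omega), if_neg (by omega), S.emod_i]
  · split_ifs with h1 h2 h2
    · rw [min_eq_left (by omega), posBit_left (Or.inr rfl) (by omega) (by omega),
        if_pos (by omega)]
    · rw [min_eq_left (by omega), posBit_left (Or.inr rfl) (by omega) (by omega),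
        if_neg (by omega), if_neg (by omega), Int.add_emod_right, S.emod_j]
    · rw [min_eq_right (by omega), posBit_right (Or.inr rfl) (by omega) (by omega),
        if_pos (by omega)]
    · rw [min_eq_right (by omega), posBit_right (Or.inr rfl) (by omega) (by omega),
        if_neg (by omega), if_neg (by omega), Int.add_emod_right, T.emod_j]

lemma Apart.card_turnPairs_one (h : Apart S T) : ((turnPairs S T 1).ncard : ZMod 2) =
    if T.i < S.j then (if S.i < T.i then 1 else S.β T.i) + (1 + T.β S.j) else 0 := by
  have := h.ii; have := h.ij; have := h.ji; have := h.jj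
  have := S.hi; have := S.hij; have := S.hj; have := T.hi; have := T.hij; have := T.hj
  rw [h.card_turnPairs (by norm_num)]
  simp only [one_mul]
  by_cases h1 : T.i < S.j
  · rw [if_pos (by omega), if_pos h1, max_eq_right (by omega), min_eq_left (by omega),
      posBit_right (Or.inl (by omega)) (by omega) (by omega),
      posBit_left (Or.inr rfl) (by omega) (by omega)]
    congr 1
    · split_ifs <;> first | omega | rfl | rw [Int.add_emod_right, T.emod_i]
    · rw [if_neg (by omega), if_neg (by omega), add_sub_cancel_right, S.emod_j]
  · rw [if_neg (by omega), if_neg h1]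

lemma Apart.card_turnPairs_neg_one (h : Apart S T) : ((turnPairs S T (-1)).ncard : ZMod 2) =
    if S.i < T.j then (1 + if T.i < S.i then 1 else T.β S.i) + S.β T.j else 0 := by
  have := h.ii; have := h.ij; have := h.ji; have := h.jj
  have := S.hi; have := S.hij; have := S.hj; have := T.hi; have := T.hij; have := T.hj
  rw [h.card_turnPairs (by norm_num)]
  simp only [neg_one_mul, sub_neg_eq_add]
  by_cases h1 : S.i < T.j
  · rw [if_pos (by omega), if_pos h1, max_eq_left (by omega), min_eq_right (by omega),
      posBit_left (Or.inl rfl) (by omega) (by omega),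
      posBit_right (Or.inr (by omega)) (by omega) (by omega)]
    congr 1
    · congr 1
      split_ifs <;> first | omega | rfl | rw [Int.add_emod_right, S.emod_i]
    · rw [if_neg (by omega), if_neg (by omega), add_neg_cancel_right, T.emod_j]
  · rw [if_neg (by omega), if_neg h1]

/-- Spirals with disjoint ends cross as often, modulo 2, as prescribed by the sides `β`, up to a
correction that tells whether their ends interleave. -/
theorem Apart.card_crossPairs (h : Apart S T) :
    ((crossPairs S.curve T.curve).ncard : ZMod 2) =
      ((if T.i < S.i then 1 else 0) + (if T.i < S.j then 1 else 0) +
      (if T.j < S.i then 1 else 0) + (if T.j < S.j then 1 else 0)) +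
      (S.β T.i + S.β T.j + T.β S.i + T.β S.j) := by
  have hfin := finite_crossPairs_curve h.idx
  have hunion : crossPairs S.curve T.curve =
      turnPairs S T 0 ∪ turnPairs S T 1 ∪ turnPairs S T (-1) := by
    ext ⟨t, t'⟩
    constructor
    · intro hp
      obtain ⟨k, hkb, hk, -⟩ :=
        exists_turn (Ioo_subset_Icc_self hp.1) (Ioo_subset_Icc_self hp.2.1) hp.2.2
      obtain rfl | rfl | rfl : k = 0 ∨ k = 1 ∨ k = -1 := by omega
      · exact Or.inl (Or.inl ⟨hp, hk⟩)
      · exact Or.inl (Or.inr ⟨hp, hk⟩)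
      · exact Or.inr ⟨hp, hk⟩
    · rintro ((hp | hp) | hp) <;> exact hp.1
  have hdisj : ∀ k l : ℤ, k ≠ l → Disjoint (turnPairs S T k) (turnPairs S T l) := by
    intro k l hkl
    rw [Set.disjoint_left]
    rintro ⟨t, t'⟩ ⟨-, h1⟩ ⟨-, h2⟩
    rw [h1] at h2
    have h3 : (k * n : ℤ) = l * n := by
      have := sub_right_injective h2
      exact_mod_cast this
    exact hkl (mul_right_cancel₀ (by have := S.n_pos; omega) h3)
  have hf : ∀ k, (turnPairs S T k).Finite := fun k => hfin.subset fun p hp => hp.1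
  rw [hunion, ncard_union_eq (disjoint_union_left.2 ⟨hdisj _ _ (by norm_num),
    hdisj _ _ (by norm_num)⟩) ((hf _).union (hf _)) (hf _),
    ncard_union_eq (hdisj _ _ (by norm_num)) (hf _) (hf _)]
  push_cast
  rw [h.card_turnPairs_zero, h.card_turnPairs_one, h.card_turnPairs_neg_one]
  have := h.ii; have := h.ij; have := h.ji; have := h.jj
  have := S.hij; have := T.hij
  generalize S.β T.i = a
  generalize S.β T.j = b
  generalize T.β S.i = c
  generalize T.β S.j = d
  rcases lt_or_gt_of_ne h.ii with h1 | h1 <;> rcases lt_or_gt_of_ne h.ij with h2 | h2 <;>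
    rcases lt_or_gt_of_ne h.ji with h3 | h3 <;> rcases lt_or_gt_of_ne h.jj with h4 | h4 <;>
    first
    | omega
    | (simp only [h1, h2, h3, h4, not_lt_of_gt h1, not_lt_of_gt h2, not_lt_of_gt h3,
        not_lt_of_gt h4, if_true, if_false]
       revert a b c d
       decide)

end Spiral

/-! ### Spiral drawings of a graph -/

section

variable {V : Type*} {G : SimpleGraph V}

/-- Every edge can be written with its ends in increasing order. -/
lemma exists_ordered_ends {ρ : V → ℕ} (hρ : Function.Injective ρ) (e : G.edgeSet) :
    ∃ u v : V, (e : Sym2 V) = s(u, v) ∧ ρ u < ρ v := by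
  obtain ⟨⟨a, b⟩, hab⟩ := e
  have hne : a ≠ b := G.ne_of_adj hab
  rcases lt_or_gt_of_ne (hρ.ne hne) with h | h
  · exact ⟨a, b, rfl, h⟩
  · exact ⟨b, a, Sym2.eq_swap, h⟩

/-- A drawing made of spirals on the sphere realizes every crossing parity that differs from the
interleaving number of the ends by a sum of terms depending on one edge and one vertex. -/
theorem exists_spiral_drawing [Finite V] (ρ : V → ℕ) (hρ : Function.Injective ρ) (n : ℕ) (hn : ∀ v, ρ v < n)
    (β : G.edgeSet → V → ZMod 2) : ∃ D : SphereDrawing G, ∀ (e f : G.edgeSet) (u v x y : V),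
      (e : Sym2 V) = s(u, v) → (f : Sym2 V) = s(x, y) → Independent e f →
      D.cr e f = (bit (ρ x) (ρ u) + bit (ρ x) (ρ v) + bit (ρ y) (ρ u) + bit (ρ y) (ρ v) : ℤ) +
        (β e x + β e y + β f u + β f v) := by
  classical
  obtain ⟨N, ⟨idx⟩⟩ := Finite.exists_equiv_fin G.edgeSet
  choose lo hi hlohi hlt using exists_ordered_ends (G := G) hρ
  have hcast : Function.Injective fun v => ((ρ v : ℕ) : ℤ) := fun a b h => hρ (Nat.cast_injective h)
  let S : G.edgeSet → Spiral n N := fun e =>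
    { i := ρ (lo e)
      j := ρ (hi e)
      idx := (idx e : ℕ)
      β := Function.extend (fun v => ((ρ v : ℕ) : ℤ)) (β e) 0
      hi := by positivity
      hij := by exact_mod_cast hlt e
      hj := by exact_mod_cast hn _
      hidx := by positivity
      hidxN := by exact_mod_cast (idx e).2 }
  have hSβ : ∀ e v, (S e).β (ρ v : ℕ) = β e v := fun e v => hcast.extend_apply _ _ v
  have hidx : ∀ e f, e ≠ f → (S e).idx ≠ (S f).idx := by
    intro e f hef h
    exact hef (idx.injective (Fin.ext (Nat.cast_injective h)))
  let vert : V → S2 := fun v => pt ⟨0, 2 * Real.pi / n * ρ v⟩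
  have hvert : ∀ v (e : G.edgeSet) (t : ℝ), (S e).curve t = vert v → ∃ k : ℤ,
      (S e).pos t = ((ρ v : ℤ) + k * n : ℤ) ∧ (S e).y ((ρ v : ℤ) + k * n) = 0 := by
    intro v e t h
    have hv : (⟨0, 2 * Real.pi / n * ρ v⟩ : ℂ) = Spiral.helix n (fun _ => 0) (ρ v : ℤ) := by
      apply Complex.ext <;> simp [Spiral.helix, pl]
    have h' := pt_eq_iff.1 h
    rw [hv] at h'
    obtain ⟨k, hk, heq⟩ := (Spiral.exp_helix_eq_iff (S e).n_pos).1 h'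
    have e1 : (S e).pos t = ((ρ v : ℤ) + k * n : ℤ) := by push_cast at hk ⊢; linarith
    refine ⟨k, e1, ?_⟩
    rw [e1, pl_int, pl_int] at heq
    exact heq
  refine ⟨{ vertex := vert
            vertex_injective := ?_
            curve := fun e => (S e).curve
            curve_continuousOn := ?_
            curve_injOn := fun e => (S e).injOn_curve
            curve_ends := ?_
            curve_ne_vertex := ?_
            curve_regular := ?_
            crossings_finite := ?_
            crossings_transversal := ?_ }, ?_⟩
  · intro u v h
    have hv : ∀ v, (⟨0, 2 * Real.pi / n * ρ v⟩ : ℂ) = Spiral.helix n (fun _ => 0) (ρ v : ℤ) := by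
      intro v; apply Complex.ext <;> simp [Spiral.helix, pl]
    have h' := pt_eq_iff.1 h
    rw [hv, hv] at h'
    have hn0 : 0 < n := (Nat.zero_le _).trans_lt (hn u)
    obtain ⟨k, hk, -⟩ := (Spiral.exp_helix_eq_iff hn0).1 h'
    have hk' : (ρ u : ℤ) - ρ v = n * k := by
      have : (ρ v : ℤ) = ρ u - k * n := by exact_mod_cast hk
      linear_combination -this
    have := Int.eq_zero_of_abs_lt_dvd ⟨_, hk'⟩ (abs_lt.2 ⟨by have := hn v; omega, by have := hn u; omega⟩)
    exact hρ (by omega)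
  · intro e
    apply Continuous.continuousOn
    have h1 : Continuous (S e).pos := by unfold Spiral.pos; fun_prop
    have h2 : Continuous fun t => Spiral.helix n (S e).y ((S e).pos t) := by
      have : (fun t => Spiral.helix n (S e).y ((S e).pos t)) = fun t =>
          (pl (S e).y ((S e).pos t) : ℂ) + ((2 * Real.pi / n * (S e).pos t : ℝ) : ℂ) * I := by
        funext t
        apply Complex.ext <;> simp [Spiral.helix]
      rw [this]
      exact (Complex.continuous_ofReal.comp ((continuous_pl _).comp h1)).add
        ((Complex.continuous_ofReal.comp (continuous_const.mul h1)).mul continuous_const)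
    exact continuous_pt.comp h2
  · intro e
    refine ⟨lo e, hi e, hlohi e, ?_, ?_⟩
    · refine pt_eq_iff.2 (congrArg exp ?_)
      have h0 : (S e).pos 0 = ((S e).i : ℤ) := by simp [Spiral.pos]
      apply Complex.ext
      · simp only [Spiral.helix, h0, pl_int]
        exact (S e).y_i
      · simp only [Spiral.helix, h0]
        simp [S]
    · refine pt_eq_iff.2 (exp_eq_exp_iff.2 ?_)
      have h0 : (S e).pos 1 = ((S e).j + n : ℤ) := by simp [Spiral.pos]
      simp only [Spiral.helix, h0, pl_int]
      refine ⟨(S e).y_j, 1, ?_⟩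
      have : (0 : ℝ) < n := by exact_mod_cast (S e).n_pos
      simp [S]
      field_simp
  · intro e t ht v h
    obtain ⟨k, hk, hy⟩ := hvert v e t h
    have := (S e).pos_mem_Ioo.2 ht
    rw [hk] at this
    exact (S e).y_ne_zero (by exact_mod_cast this.1) (by exact_mod_cast this.2) hy
  · intro e
    have hfin : ((S e).pos ⁻¹' ((fun m : ℤ => (m : ℝ)) '' Icc 0 (2 * n))).Finite :=
      ((finite_Icc _ _).image _).preimage ((S e).pos_injective.injOn)
    refine hfin.subset ?_
    rintro t ⟨ht, hreg⟩
    have ht' := (S e).pos_mem_Ioo.2 ht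
    by_contra hnot
    apply hreg
    obtain ⟨hc, hd⟩ := (S e).helix_affine (t := t) (by
      intro he
      apply hnot
      refine ⟨⌊(S e).pos t⌋, ⟨(S e).hi.trans (Int.le_floor.2 ht'.1.le), ?_⟩, he.symm⟩
      have h2 : ⌊(S e).pos t⌋ < (S e).j + n := by
        have := (Int.floor_le ((S e).pos t)).trans_lt ht'.2
        exact_mod_cast this
      have := (S e).hj
      omega)
    refine regularAt_pt (π := id) (Eventually.of_forall fun r => rfl) hc ?_
    rw [hd]
    intro h0
    have him := congrArg Complex.im h0
    have h1 := (S e).width_pos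
    have hn0 : (0 : ℝ) < n := by exact_mod_cast (S e).n_pos
    have hpi := Real.pi_pos
    have : 0 < ((S e).j + n - (S e).i) * (2 * Real.pi / n) := by positivity
    exact this.ne' him
  · intro e f hef
    have hb := bijOn_crossPairs (S e).injOn_curve (S f).injOn_curve
    rw [← hb.image_eq]
    exact (Spiral.finite_crossPairs_curve (hidx e f hef)).image _
  · intro e f hef s hs t ht h
    exact Spiral.crossTransversally_curve (hidx e f hef) hs ht h
  · intro e f u v x y he hf hef
    rw [Drawing.cr_eq_ncard]
    have hne : ∀ a b : V, a ∈ (e : Sym2 V) → b ∈ (f : Sym2 V) → ((ρ a : ℕ) : ℤ) ≠ ρ b := by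
      intro a b ha hb h
      have := hcast h
      subst this
      exact hef a ⟨ha, hb⟩
    have hlo : ∀ e : G.edgeSet, lo e ∈ (e : Sym2 V) ∧ hi e ∈ (e : Sym2 V) := fun e => by
      rw [hlohi e]; simp
    have hA : (S e).Apart (S f) :=
      ⟨hidx e f hef.ne, hne _ _ (hlo e).1 (hlo f).1, hne _ _ (hlo e).1 (hlo f).2,
        hne _ _ (hlo e).2 (hlo f).1, hne _ _ (hlo e).2 (hlo f).2⟩
    have key := hA.card_crossPairs
    have hi1 : ∀ e, (S e).i = ((ρ (lo e) : ℕ) : ℤ) := fun e => rfl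
    have hj1 : ∀ e, (S e).j = ((ρ (hi e) : ℕ) : ℤ) := fun e => rfl
    rw [hi1, hi1, hj1, hj1, hSβ, hSβ, hSβ, hSβ] at key
    simp only [Nat.cast_lt] at key
    have hbit : ∀ a b : ℕ, ((bit a b : ℤ) : ZMod 2) = if a < b then 1 else 0 := by
      intro a b; unfold bit; split_ifs <;> simp
    push_cast
    simp only [hbit]
    refine key.trans ?_
    have he' := (hlohi e).symm.trans he
    have hf' := (hlohi f).symm.trans hf
    rw [Sym2.eq_iff] at he' hf'
    rcases he' with ⟨h1, h2⟩ | ⟨h1, h2⟩ <;> rcases hf' with ⟨h3, h4⟩ | ⟨h3, h4⟩ <;>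
      rw [h1, h2, h3, h4] <;> ring

/-- Correcting the spirals according to the parity formula turns a Hanani–Tutte drawing on the
projective plane into a projective Hanani–Tutte drawing on the sphere. -/
theorem exists_isProjectiveHT [Finite V] (D : RP2Drawing G) (hD : IsHT D) :
    ∃ (D' : SphereDrawing G) (l : G.edgeSet → ZMod 2), IsProjectiveHT D' l := by
  obtain ⟨n, ⟨ρ⟩⟩ := Finite.exists_equiv_fin V
  have hρ : Function.Injective fun v => (ρ v : ℕ) := fun a b h => ρ.injective (Fin.ext h)
  obtain ⟨l, N, hN⟩ := exists_parity_formula D hρ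
  obtain ⟨D', hD'⟩ := exists_spiral_drawing (fun v => (ρ v : ℕ)) hρ n (fun v => (ρ v).2) N
  refine ⟨D', l, fun e f hef => ?_⟩
  obtain ⟨⟨u, v⟩, he⟩ : ∃ q : V × V, (e : Sym2 V) = Sym2.mk q.1 q.2 :=
    ⟨_, (Quot.out_eq (e : Sym2 V)).symm⟩
  obtain ⟨⟨x, y⟩, hf⟩ : ∃ q : V × V, (f : Sym2 V) = Sym2.mk q.1 q.2 :=
    ⟨_, (Quot.out_eq (f : Sym2 V)).symm⟩
  have h1 := hN e f u v x y he hf hef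
  have h2 := hD' e f u v x y he hf hef
  rw [hD e f hef] at h1
  rw [h2]
  have key : ∀ a b c : ZMod 2, 0 = a + b + c → b + c = a := by decide
  exact key _ _ _ h1

end

/-! ### Drawings on the cylinder -/

/-- A continuous logarithm of a differentiable curve is differentiable. -/
lemma contDiffAt_of_exp {l : ℝ → ℂ} (hl : Continuous l) {t : ℝ}
    (h : ContDiffAt ℝ 1 (fun r => exp (l r)) t) : ContDiffAt ℝ 1 l t := by
  have hev : l =ᶠ[𝓝 t] fun r => log (exp (l r) / exp (l t)) + l t := by
    have h1 : ∀ᶠ r in 𝓝 t, ‖l r - l t‖ < Real.pi := by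
      have : Tendsto (fun r => ‖l r - l t‖) (𝓝 t) (𝓝 ‖l t - l t‖) :=
        ((hl.sub continuous_const).norm).continuousAt
      rw [sub_self, norm_zero] at this
      exact this.eventually_lt_const Real.pi_pos
    filter_upwards [h1] with r hr
    have h2 := abs_lt.1 ((Complex.abs_im_le_norm _).trans_lt hr)
    rw [← Complex.exp_sub, Complex.log_exp h2.1 h2.2.le, sub_add_cancel]
  refine ContDiffAt.congr_of_eventuallyEq ?_ hev
  refine ContDiffAt.add ?_ contDiffAt_const
  have h2 : ContDiffAt ℝ 1 log (exp (l t) / exp (l t)) := by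
    rw [div_self (exp_ne_zero _)]
    exact (contDiffAt_log (n := 1) (by simp)).restrict_scalars ℝ
  exact h2.comp t (h.div_const _)

/-- A drawing on the sphere without poles, in cylindrical coordinates: the imaginary part is the
angle, defined modulo `2π` only, and the real part a height.  Orientation and origin of the height
are such that the drawing stays at positive heights. -/
structure CylDrawing {V : Type*} (G : SimpleGraph V) where
  L : G.edgeSet → ℝ → ℂ
  P : V → ℂ
  cont : ∀ e, Continuous (L e)
  L_pos : ∀ e t, 0 < (L e t).re
  P_pos : ∀ v, 0 < (P v).re
  P_inj : ∀ u v, exp (P u) = exp (P v) → u = v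
  injOn : ∀ e, InjOn (fun t => exp (L e t)) (Icc 0 1)
  ends : ∀ e : G.edgeSet, ∃ u v : V, (e : Sym2 V) = s(u, v) ∧
    exp (L e 0) = exp (P u) ∧ exp (L e 1) = exp (P v)
  ne_vertex : ∀ e, ∀ t ∈ Ioo (0 : ℝ) 1, ∀ w, exp (L e t) ≠ exp (P w)
  regular : ∀ e, {t ∈ Ioo (0 : ℝ) 1 | ¬ (ContDiffAt ℝ 1 (L e) t ∧ deriv (L e) t ≠ 0)}.Finite
  finite : ∀ e f, e ≠ f → (crossPairs (fun t => exp (L e t)) (fun t => exp (L f t))).Finite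
  transversal : ∀ e f, e ≠ f → ∀ s ∈ Ioo (0 : ℝ) 1, ∀ t ∈ Ioo (0 : ℝ) 1,
    exp (L e s) = exp (L f t) →
      ContDiffAt ℝ 1 (L e) s ∧ ContDiffAt ℝ 1 (L f) t ∧ det2 (deriv (L e) s) (deriv (L f) t) ≠ 0
  turning : ∀ e, ∃ s ∈ Icc (0 : ℝ) 1, ∃ t ∈ Icc (0 : ℝ) 1, (L e s).im ≠ (L e t).im

/-- Reversal of the height, with a new origin. -/
noncomputable def flip (K : ℝ) (a : ℂ) : ℂ := K - (starRingEnd ℂ) a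

lemma exp_flip_eq_iff (K : ℝ) {a b : ℂ} : exp (flip K a) = exp (flip K b) ↔ exp a = exp b := by
  rw [exp_eq_exp_iff, exp_eq_exp_iff]
  simp [flip]

lemma exp_eq_of_flip (K : ℝ) (a : ℂ) : exp a = exp (flip K (flip K a)) := by
  congr 1
  apply Complex.ext <;> simp [flip]

lemma contDiff_flip (K : ℝ) : ContDiff ℝ 1 (flip K) :=
  contDiff_const.sub Complex.conjCLE.contDiff

lemma differentiable_exp_flip (K : ℝ) : Differentiable ℝ fun a => exp (flip K a) :=
  (Complex.differentiable_exp (𝕜 := ℝ)).comp ((contDiff_flip K).differentiable one_ne_zero)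

/-- A drawing on the sphere has cylindrical coordinates with respect to a generic axis. The axis
misses the edges and vertices; for every edge it is also not in the plane spanned by two chosen
points of the edge, which are therefore at different angles. -/
theorem exists_cylDrawing {V : Type*} [Finite V] {G : SimpleGraph V} (D : SphereDrawing G) :
    ∃ C : CylDrawing G, ∀ e f, ∀ s ∈ Icc (0 : ℝ) 1, ∀ t ∈ Icc (0 : ℝ) 1,
      D.curve e s = D.curve f t ↔ exp (C.L e s) = exp (C.L f t) := by
  classical
  set F : G.edgeSet → ℝ → E3 := fun e t => (D.curve e t : E3) with hF
  -- At a regular parameter the curve itself, as a curve in space, is regular.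
  have hlift : ∀ e t x, IsRegularLiftAt id (D.curve e) t x → x =ᶠ[𝓝 t] F e := by
    intro e t x hx
    filter_upwards [hx.1] with r hr
    obtain ⟨h, hr⟩ := hr
    exact congrArg Subtype.val hr
  have hnorm : ∀ e t, ‖F e t‖ = 1 := fun e t => mem_sphere_zero_iff_norm.1 (D.curve e t).2
  have hFne : ∀ e t, F e t ≠ 0 := fun e t h => by
    have := hnorm e t
    rw [h, norm_zero] at this
    exact zero_ne_one this
  obtain ⟨O, hO1, hO2⟩ := exists_generic_rotation
    (ι := G.edgeSet) (κ := G.edgeSet ⊕ V) (x := F) (by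
      intro e
      refine ((D.curve_regular e).union (toFinite {0, 1})).subset ?_
      rintro t ⟨ht, hc⟩
      rcases eq_endpoints_or_mem_Ioo_of_mem_Icc ht with rfl | rfl | h
      · exact Or.inr (by simp)
      · exact Or.inr (by simp)
      · refine Or.inl ⟨h, fun ⟨x, hx⟩ => hc ?_⟩
        exact hx.2.1.congr_of_eventuallyEq (hlift e t x hx).symm)
    (Sum.elim (fun e => F e (1 / 3)) fun v => (D.vertex v : E3))
    (Sum.elim (fun e => F e (2 / 3)) fun v => 0)
  have hOe : ∀ e t, t ∈ Icc (0 : ℝ) 1 → horiz (O (F e t)) ≠ 0 := fun e t ht => hO1 e t ht (hFne e t)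
  have hOv : ∀ v, horiz (O (D.vertex v : E3)) ≠ 0 := by
    intro v h
    have := hO2 (Sum.inr v) 1 0 (by simpa using h)
    simp only [Sum.elim_inr, one_smul, zero_smul, add_zero] at this
    have h2 := (D.vertex v).2
    rw [this] at h2
    simp at h2
  have hmerc : ∀ a b : S2, horiz (O (a : E3)) ≠ 0 → horiz (O (b : E3)) ≠ 0 →
      (merc (O (a : E3)) = merc (O (b : E3)) ↔ a = b) := by
    intro a b ha hb
    refine ⟨fun h => ?_, fun h => by rw [h]⟩
    have ha' : O (a : E3) ∈ Metric.sphere (0 : E3) 1 := by simp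
    have hb' : O (b : E3) ∈ Metric.sphere (0 : E3) 1 := by simp
    apply Subtype.ext
    apply O.injective
    rw [← unmerc_merc ha' ha, ← unmerc_merc hb' hb, h]
  set y : G.edgeSet → ℝ → ℂ := fun e t => merc (O (F e (projIcc 0 1 zero_le_one t))) with hy
  have hy1 : ∀ e, ∀ t ∈ Icc (0 : ℝ) 1, y e t = merc (O (F e t)) := fun e t ht => by
    simp only [hy, projIcc_of_mem zero_le_one ht]
  have hyc : ∀ e, Continuous (y e) := by
    intro e
    have h1 : Continuous fun t : ℝ => O (F e (projIcc 0 1 zero_le_one t)) := by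
      refine O.continuous.comp (continuous_subtype_val.comp ?_)
      exact (D.curve_continuousOn e).domRestrict.comp continuous_projIcc
    rw [continuous_iff_continuousAt]
    intro t
    have h2 := (contDiffAt_merc (hOe e (projIcc 0 1 zero_le_one t)
      (projIcc 0 1 zero_le_one t).2)).continuousAt
    exact ContinuousAt.comp (f := fun t : ℝ => O (F e (projIcc 0 1 zero_le_one t))) h2 h1.continuousAt
  have hy0 : ∀ e t, y e t ≠ 0 := fun e t => merc_ne_zero (hOe e _ (projIcc 0 1 zero_le_one t).2)
  choose l hlc hl using fun e => exists_continuous_log (y e) (hyc e) (hy0 e)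
  have hbound : ∃ K : ℝ, (∀ e t, (l e t).re < K) ∧ ∀ v, (log (merc (O (D.vertex v : E3)))).re < K := by
    have h1 : ∀ e, ∃ K, ∀ t, (l e t).re ≤ K := by
      intro e
      obtain ⟨K, hK⟩ := (isCompact_Icc (a := (0 : ℝ)) (b := 1)).bddAbove_image
        (f := fun t => (l e t).re) (Complex.continuous_re.comp (hlc e)).continuousOn
      refine ⟨K, fun t => ?_⟩
      have h3 : exp (l e t) = exp (l e (projIcc 0 1 zero_le_one t)) := by
        rw [hl, hl]
        simp only [hy, projIcc_val]
      rw [(exp_eq_exp_iff.1 h3).1]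
      exact hK ⟨_, (projIcc 0 1 zero_le_one t).2, rfl⟩
    choose K1 hK1 using h1
    obtain ⟨A, hA⟩ := (finite_range K1).bddAbove
    obtain ⟨B, hB⟩ := (finite_range fun v => (log (merc (O (D.vertex v : E3)))).re).bddAbove
    refine ⟨max A B + 1, fun e t => ?_, fun v => ?_⟩
    · have := (hK1 e t).trans ((hA ⟨e, rfl⟩).trans (le_max_left A B))
      linarith
    · have h4 := hB ⟨v, rfl⟩
      simp only at h4
      have := h4.trans (le_max_right A B)
      linarith
  obtain ⟨K, hK1, hK2⟩ := hbound
  have hexp : ∀ e f, ∀ s ∈ Icc (0 : ℝ) 1, ∀ t ∈ Icc (0 : ℝ) 1,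
      D.curve e s = D.curve f t ↔ exp (flip K (l e s)) = exp (flip K (l f t)) := by
    intro e f s hs t ht
    rw [exp_flip_eq_iff, hl, hl, hy1 e s hs, hy1 f t ht]
    exact (hmerc _ _ (hOe e s hs) (hOe f t ht)).symm
  have hexpv : ∀ e v, ∀ s ∈ Icc (0 : ℝ) 1, D.curve e s = D.vertex v ↔
      exp (flip K (l e s)) = exp (flip K (log (merc (O (D.vertex v : E3))))) := by
    intro e v s hs
    rw [exp_flip_eq_iff, hl, Complex.exp_log (merc_ne_zero (hOv v)), hy1 e s hs]
    exact (hmerc _ _ (hOe e s hs) (hOv v)).symm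
  -- regularity of the lifts
  have hreg : ∀ e, ∀ t ∈ Ioo (0 : ℝ) 1, ∀ x, IsRegularLiftAt id (D.curve e) t x →
      ContDiffAt ℝ 1 (l e) t ∧ (fun r => exp (l e r)) =ᶠ[𝓝 t] fun r => merc (O (x r)) := by
    intro e t ht x hx
    have hx' := hlift e t x hx
    have hev : (fun r => exp (l e r)) =ᶠ[𝓝 t] fun r => merc (O (x r)) := by
      filter_upwards [hx', Ioo_mem_nhds ht.1 ht.2] with r hr hr'
      rw [hl, hy1 e r (Ioo_subset_Icc_self hr'), hr]
    refine ⟨contDiffAt_of_exp (hlc e) (ContDiffAt.congr_of_eventuallyEq ?_ hev), hev⟩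
    refine contDiffAt_merc_comp O hx.2.1 ?_
    rw [hx'.self_of_nhds]
    exact hOe e t (Ioo_subset_Icc_self ht)
  have hsph : ∀ e t x, IsRegularLiftAt id (D.curve e) t x →
      ∀ᶠ r in 𝓝 t, x r ∈ Metric.sphere (0 : E3) 1 := fun e t x hx => by
    filter_upwards [hx.1] with r hr
    exact hr.1
  refine ⟨{ L := fun e t => flip K (l e t)
            P := fun v => flip K (log (merc (O (D.vertex v : E3))))
            cont := fun e => (contDiff_flip K).continuous.comp (hlc e)
            L_pos := fun e t => by simpa [flip] using hK1 e t
            P_pos := fun v => by simpa [flip] using hK2 v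
            P_inj := ?_
            injOn := ?_
            ends := ?_
            ne_vertex := ?_
            regular := ?_
            finite := ?_
            transversal := ?_
            turning := ?_ }, hexp⟩
  · intro u v h
    rw [exp_flip_eq_iff, Complex.exp_log (merc_ne_zero (hOv u)),
      Complex.exp_log (merc_ne_zero (hOv v))] at h
    exact D.vertex_injective ((hmerc _ _ (hOv u) (hOv v)).1 h)
  · intro e s hs t ht h
    exact D.curve_injOn e hs ht ((hexp e e s hs t ht).2 h)
  · intro e
    obtain ⟨u, v, h, h0, h1⟩ := D.curve_ends e
    exact ⟨u, v, h, (hexpv e u 0 (by simp)).1 h0, (hexpv e v 1 (by simp)).1 h1⟩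
  · intro e t ht w h
    exact D.curve_ne_vertex e t ht w ((hexpv e w t (Ioo_subset_Icc_self ht)).2 h)
  · intro e
    refine (D.curve_regular e).subset ?_
    rintro t ⟨ht, hn⟩
    refine ⟨ht, fun ⟨x, hx⟩ => hn ?_⟩
    obtain ⟨h1, h2⟩ := hreg e t ht x hx
    have h3 : ContDiffAt ℝ 1 (fun r => flip K (l e r)) t := (contDiff_flip K).contDiffAt.comp t h1
    refine ⟨h3, fun h0 => ?_⟩
    have hw : horiz (O (x t)) ≠ 0 := by
      rw [(hlift e t x hx).self_of_nhds]
      exact hOe e t (Ioo_subset_Icc_self ht)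
    refine deriv_merc_comp_ne_zero O hx.2.1 (hsph e t x hx) hw hx.2.2 ?_
    rw [← h2.deriv_eq]
    have h4 : (fun r => exp (l e r)) = (fun a => exp (flip K a)) ∘ fun r => flip K (l e r) := by
      funext r; exact exp_eq_of_flip K _
    rw [h4, ((differentiable_exp_flip K _).hasFDerivAt.comp_hasDerivAt t
      (h3.differentiableAt one_ne_zero).hasDerivAt).deriv]
    change (fderiv ℝ _ _) (deriv (fun r => flip K (l e r)) t) = 0
    rw [h0, map_zero]
  · intro e f hef
    refine (D.finite_crossPairs hef).subset ?_
    rintro ⟨s, t⟩ ⟨hs, ht, h⟩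
    exact ⟨hs, ht, (hexp e f s (Ioo_subset_Icc_self hs) t (Ioo_subset_Icc_self ht)).2 h⟩
  · intro e f hef s hs t ht h
    obtain ⟨x, z, hx, hz, hxz, hind⟩ := D.crossings_transversal e f hef s hs t ht
      ((hexp e f s (Ioo_subset_Icc_self hs) t (Ioo_subset_Icc_self ht)).2 h)
    obtain ⟨h1, h2⟩ := hreg e s hs x hx
    obtain ⟨h1', h2'⟩ := hreg f t ht z hz
    have h3 : ContDiffAt ℝ 1 (fun r => flip K (l e r)) s := (contDiff_flip K).contDiffAt.comp s h1
    have h3' : ContDiffAt ℝ 1 (fun r => flip K (l f r)) t :=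
      (contDiff_flip K).contDiffAt.comp t h1'
    refine ⟨h3, h3', ?_⟩
    have hw : horiz (O (x s)) ≠ 0 := by
      rw [(hlift e s x hx).self_of_nhds]
      exact hOe e s (Ioo_subset_Icc_self hs)
    have key := det2_merc_comp_ne_zero O hx.2.1 hz.2.1 (hsph e s x hx) (hsph f t z hz) hxz hw hind
    rw [← h2.deriv_eq, ← h2'.deriv_eq] at key
    rw [← linearIndependent_iff_det2] at key ⊢
    -- The logarithms may differ by a period; a translate of the second one does not.
    obtain ⟨hre, k, hk⟩ := exp_eq_exp_iff.1 h
    set c : ℂ := (k * (2 * Real.pi) : ℝ) * I with hc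
    have hd' : deriv (fun r => flip K (l f r) + c) t = deriv (fun r => flip K (l f r)) t := by
      rw [deriv_add_const]
    rw [← hd']
    refine linearIndependent_of_comp (g := fun a => exp (flip K a))
      (h3.differentiableAt one_ne_zero) ((h3'.differentiableAt one_ne_zero).add_const c) ?_
      (differentiable_exp_flip K _) ?_ ?_ key
    · apply Complex.ext
      · simpa [hc] using hre
      · simpa [hc] using hk
    · exact Eventually.of_forall fun r => exp_eq_of_flip K _
    · refine Eventually.of_forall fun r => (exp_eq_of_flip K _).trans ?_
      rw [Function.comp_apply, exp_flip_eq_iff, exp_eq_exp_iff]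
      refine ⟨by simp [hc], -k, by simp [hc]⟩
  · intro e
    have ht1 : (1 / 3 : ℝ) ∈ Icc (0 : ℝ) 1 := by constructor <;> norm_num
    have ht2 : (2 / 3 : ℝ) ∈ Icc (0 : ℝ) 1 := by constructor <;> norm_num
    refine ⟨1 / 3, ht1, 2 / 3, ht2, fun him => ?_⟩
    -- With equal angles, some combination of the two points is on the axis.
    have hh : ∀ t ∈ Icc (0 : ℝ) 1, horiz (O (F e t)) =
        (‖horiz (O (F e t))‖ : ℝ) * exp ((l e t).im * I) := by
      intro t ht
      have h1 : exp (l e t) = merc (O (F e t)) := (hl e t).trans (hy1 e t ht)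
      have h2 := eq_ptE_of_exp_eq (by simp [hnorm]) (hOe e t ht) h1
      have h3 : horiz (O (F e t)) = (‖cyl (l e t)‖⁻¹ : ℝ) * exp ((l e t).im * I) := by
        rw [h2]
        apply Complex.ext
        · rw [Complex.re_ofReal_mul, Complex.exp_ofReal_mul_I_re]
          simp [horiz, ptE, cyl]
        · rw [Complex.im_ofReal_mul, Complex.exp_ofReal_mul_I_im]
          simp [horiz, ptE, cyl]
      have h4 : ‖horiz (O (F e t))‖ = ‖cyl (l e t)‖⁻¹ := by
        rw [h3, norm_mul, Complex.norm_exp_ofReal_mul_I, mul_one, Complex.norm_real,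
          Real.norm_of_nonneg (by positivity)]
      rw [h4]
      exact h3
    have him' : (l e (1 / 3)).im = (l e (2 / 3)).im := by simpa [flip] using him
    set a := ‖horiz (O (F e (1 / 3)))‖ with ha
    set b := ‖horiz (O (F e (2 / 3)))‖ with hb
    have ha0 : 0 < a := norm_pos_iff.2 (hOe e _ ht1)
    have hb0 : 0 < b := norm_pos_iff.2 (hOe e _ ht2)
    have hlin : ∀ (r s : ℝ) (p q : E3), horiz (r • p + s • q) = r * horiz p + s * horiz q := by
      intro r s p q
      apply Complex.ext <;> simp [horiz]
    have hcomb := hO2 (Sum.inl e) b (-a) (by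
      simp only [Sum.elim_inl]
      rw [map_add, map_smul, map_smul, hlin, hh _ ht1, hh _ ht2, ← ha, ← hb, him']
      push_cast
      ring)
    simp only [Sum.elim_inl] at hcomb
    have heq : b • F e (1 / 3) = a • F e (2 / 3) := by
      rw [neg_smul, ← sub_eq_add_neg] at hcomb
      exact sub_eq_zero.1 hcomb
    have hab : b = a := by
      have := congrArg norm heq
      rwa [norm_smul, norm_smul, hnorm, hnorm, mul_one, mul_one, Real.norm_of_nonneg hb0.le,
        Real.norm_of_nonneg ha0.le] at this
    rw [hab] at heq
    have := D.curve_injOn e ht1 ht2 (Subtype.ext (smul_right_injective E3 ha0.ne' heq))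
    norm_num at this

/-! ### Meridians met by a curve -/

lemma exp_mul_I_eq_iff {a b : ℝ} :
    exp (a * I) = exp (b * I) ↔ ∃ k : ℤ, a = b + k * (2 * Real.pi) := by
  rw [exp_eq_exp_iff]
  simp

/-- The parameters at which a curve with angle `φ` meets the meridian of angle `θ`. -/
def Hits (φ : ℝ → ℝ) (θ : ℝ) : Set ℝ := {t ∈ Icc (0 : ℝ) 1 | exp (φ t * I) = exp (θ * I)}

lemma Hits.congr {φ : ℝ → ℝ} {θ θ' : ℝ} (h : exp (θ * I) = exp (θ' * I)) :
    Hits φ θ = Hits φ θ' := by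
  unfold Hits; rw [h]

/-- If a curve is nowhere tangent to a meridian, then its intersections with the meridian move
continuously when the meridian is rotated slightly. -/
theorem exists_continuation {φ : ℝ → ℝ} (hφ : Continuous φ) {θ : ℝ}
    (hreg : ∀ t ∈ Hits φ θ, t ∈ Ioo (0 : ℝ) 1 ∧ ContDiffAt ℝ 1 φ t ∧ deriv φ t ≠ 0) :
    (Hits φ θ).Finite ∧ ∃ g : ℝ → ℝ → ℝ, (∀ h ∈ Hits φ θ, g h 0 = h ∧ ContinuousAt (g h) 0 ∧
      ∀ᶠ τ in 𝓝 (0 : ℝ), φ (g h τ) = φ h + τ) ∧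
      ∀ᶠ τ in 𝓝 (0 : ℝ), BijOn (fun h => g h τ) (Hits φ θ) (Hits φ (θ + τ)) := by
  have hloc : ∀ h ∈ Hits φ θ, ∃ g : ℝ → ℝ, g 0 = h ∧ ContinuousAt g 0 ∧
      (∀ᶠ τ in 𝓝 (0 : ℝ), φ (g τ) = φ h + τ) ∧ ∀ᶠ t in 𝓝 h, g (φ t - φ h) = t := by
    intro h hh
    obtain ⟨-, hc, hd⟩ := hreg h hh
    have hs : HasStrictDerivAt φ (deriv φ h) h := hc.hasStrictDerivAt one_ne_zero
    have hadd : ContinuousAt (fun τ : ℝ => φ h + τ) 0 := by fun_prop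
    have h0 : φ h + 0 = φ h := add_zero _
    refine ⟨fun τ => hs.localInverse φ _ h hd (φ h + τ), ?_, ?_, ?_, ?_⟩
    · simp only [h0]
      exact HasStrictFDerivAt.localInverse_apply_image _
    · have hcont := (hs.to_localInverse hd).hasDerivAt.continuousAt
      rw [← h0] at hcont
      exact ContinuousAt.comp (f := fun τ : ℝ => φ h + τ) hcont hadd
    · have := hs.eventually_right_inverse hd
      rw [← h0] at this
      exact hadd.eventually this
    · filter_upwards [hs.eventually_left_inverse hd] with t ht
      rw [add_sub_cancel]
      exact ht
  choose! g hg0 hgc hgr hgl using hloc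
  have hexp : Continuous fun t => exp (φ t * I) := by fun_prop
  -- Near a parameter of the compact interval, all hits of nearby meridians are accounted for.
  have hnear : ∀ t ∈ Icc (0 : ℝ) 1, ∀ᶠ z : ℝ × ℝ in 𝓝 (0, t), z.2 ∈ Hits φ (θ + z.1) →
      ∃ h ∈ Hits φ θ, h = t ∧ z.2 = g h z.1 := by
    intro t ht
    by_cases hh : t ∈ Hits φ θ
    · have h1 : ∀ᶠ z : ℝ × ℝ in 𝓝 (0, t), g t (φ z.2 - φ t) = z.2 :=
        (continuousAt_snd (p := ((0 : ℝ), t))).eventually (hgl t hh)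
      have h2 : ∀ᶠ z : ℝ × ℝ in 𝓝 (0, t), |φ z.2 - φ t - z.1| < 2 * Real.pi := by
        have hc : ContinuousAt (fun z : ℝ × ℝ => |φ z.2 - φ t - z.1|) (0, t) := by fun_prop
        refine hc.eventually_lt continuousAt_const ?_
        simp [Real.pi_pos]
      filter_upwards [h1, h2] with z h1 h2 hz
      refine ⟨t, hh, rfl, ?_⟩
      have e1 : exp (φ z.2 * I) = exp ((φ t + z.1 : ℝ) * I) := by
        rw [hz.2]
        push_cast
        rw [add_mul, add_mul, Complex.exp_add, Complex.exp_add, hh.2]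
      obtain ⟨k, hk⟩ := exp_mul_I_eq_iff.1 e1
      have hk0 : k = 0 := by
        rw [show φ z.2 - φ t - z.1 = k * (2 * Real.pi) by linarith, abs_mul,
          abs_of_pos Real.two_pi_pos, mul_lt_iff_lt_one_left Real.two_pi_pos] at h2
        have h3 : |k| < 1 := by exact_mod_cast h2
        exact Int.abs_lt_one_iff.1 h3
      rw [hk0] at hk
      rw [← h1]
      congr 1
      simp only [Int.cast_zero, zero_mul, add_zero] at hk
      linarith
    · have hne : exp (φ t * I) ≠ exp ((θ + 0 : ℝ) * I) := fun h => hh ⟨ht, by simpa using h⟩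
      have h1 : ∀ᶠ z : ℝ × ℝ in 𝓝 (0, t), exp (φ z.2 * I) ≠ exp ((θ + z.1 : ℝ) * I) := by
        have hc1 : ContinuousAt (fun z : ℝ × ℝ => exp (φ z.2 * I)) (0, t) := by fun_prop
        have hc2 : ContinuousAt (fun z : ℝ × ℝ => exp ((θ + z.1 : ℝ) * I)) (0, t) := by fun_prop
        exact hc1.ne_iff_eventually_ne hc2 |>.1 hne
      filter_upwards [h1] with z hz hz'
      exact absurd hz'.2 hz
  have hfin : (Hits φ θ).Finite := by
    by_contra hinf
    obtain ⟨t, ht, hacc⟩ := Set.Infinite.exists_accPt_of_subset_isCompact hinf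
      (isCompact_Icc (a := (0 : ℝ)) (b := 1)) fun t ht => ht.1
    rw [accPt_iff_frequently] at hacc
    have h1 : ∀ᶠ r in 𝓝 t, r ∈ Hits φ θ → r = t := by
      have hc : ContinuousAt (fun r : ℝ => ((0 : ℝ), r)) t := by fun_prop
      filter_upwards [hc.eventually (hnear t ht)] with r hr hr'
      obtain ⟨h, hh, rfl, h2⟩ := hr (by simpa using hr')
      rw [hg0 h hh] at h2
      exact h2
    obtain ⟨r, ⟨h2, h3⟩, h4⟩ := (hacc.and_eventually h1).exists
    exact h2 (h4 h3)
  refine ⟨hfin, g, fun h hh => ⟨hg0 h hh, hgc h hh, hgr h hh⟩, ?_⟩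
  have hsurj := (isCompact_Icc (a := (0 : ℝ)) (b := 1)).eventually_forall_of_forall_eventually
    (P := fun τ t => t ∈ Hits φ (θ + τ) → ∃ h ∈ Hits φ θ, t = g h τ) (x₀ := (0 : ℝ)) fun t ht => by
      filter_upwards [hnear t ht] with z hz hz'
      obtain ⟨h, hh, -, h2⟩ := hz hz'
      exact ⟨h, hh, h2⟩
  have hmem : ∀ᶠ τ in 𝓝 (0 : ℝ), ∀ h ∈ Hits φ θ, g h τ ∈ Hits φ (θ + τ) := by
    rw [eventually_all_finite hfin]
    intro h hh
    have h1 : ∀ᶠ τ in 𝓝 (0 : ℝ), g h τ ∈ Ioo (0 : ℝ) 1 := by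
      have := (hgc h hh).eventually_mem (s := Ioo (0 : ℝ) 1) (by
        rw [hg0 h hh]
        exact Ioo_mem_nhds (hreg h hh).1.1 (hreg h hh).1.2)
      exact this
    filter_upwards [h1, hgr h hh] with τ h2 h3
    refine ⟨Ioo_subset_Icc_self h2, ?_⟩
    rw [h3]
    push_cast
    rw [add_mul, add_mul, Complex.exp_add, Complex.exp_add, hh.2]
  have hinj : ∀ᶠ τ in 𝓝 (0 : ℝ), ∀ h ∈ Hits φ θ, ∀ h' ∈ Hits φ θ, g h τ = g h' τ → h = h' := by
    rw [eventually_all_finite hfin]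
    intro h hh
    rw [eventually_all_finite hfin]
    intro h' hh'
    by_cases heq : h = h'
    · exact Eventually.of_forall fun _ _ => heq
    · have : ∀ᶠ τ in 𝓝 (0 : ℝ), g h τ ≠ g h' τ :=
        (hgc h hh).ne_iff_eventually_ne (hgc h' hh') |>.1 (by rwa [hg0 h hh, hg0 h' hh'])
      filter_upwards [this] with τ h1 h2
      exact absurd h2 h1
  filter_upwards [hsurj, hmem, hinj] with τ h1 h2 h3
  refine ⟨h2, fun h hh h' hh' => h3 h hh h' hh', fun t ht => ?_⟩
  obtain ⟨h, hh, h4⟩ := h1 t ht.1 ht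
  exact ⟨h, hh, h4.symm⟩

namespace CylDrawing

variable {V : Type*} {G : SimpleGraph V} (C : CylDrawing G)

/-- The angle along an edge. -/
noncomputable def ang (e : G.edgeSet) (t : ℝ) : ℝ := (C.L e t).im

lemma continuous_ang (e : G.edgeSet) : Continuous (C.ang e) :=
  Complex.continuous_im.comp (C.cont e)

lemma deriv_ang {e : G.edgeSet} {t : ℝ} (h : ContDiffAt ℝ 1 (C.L e) t) :
    ContDiffAt ℝ 1 (C.ang e) t ∧ deriv (C.ang e) t = (deriv (C.L e) t).im := by
  refine ⟨Complex.imCLM.contDiff.contDiffAt.comp t h, ?_⟩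
  exact (Complex.imCLM.hasFDerivAt.comp_hasDerivAt t
    (h.differentiableAt one_ne_zero).hasDerivAt).deriv

lemma exp_L_eq_iff {e f : G.edgeSet} {s t : ℝ} : exp (C.L e s) = exp (C.L f t) ↔
    (C.L e s).re = (C.L f t).re ∧ exp (C.ang e s * I) = exp (C.ang f t * I) := by
  rw [exp_eq_exp_iff, exp_mul_I_eq_iff]
  rfl

/-- A meridian in general position with respect to the drawing: it contains no vertex and no
crossing, and the edges meet it transversally only. -/
structure Generic (θ : ℝ) : Prop where
  regular : ∀ f, ∀ t ∈ Hits (C.ang f) θ, t ∈ Ioo (0 : ℝ) 1 ∧ ContDiffAt ℝ 1 (C.L f) t ∧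
    (deriv (C.L f) t).im ≠ 0
  crossing : ∀ f, ∀ t ∈ Hits (C.ang f) θ, ∀ f', f' ≠ f → ∀ s ∈ Ioo (0 : ℝ) 1,
    exp (C.L f t) ≠ exp (C.L f' s)
  vertex : ∀ v, exp ((C.P v).im * I) ≠ exp (θ * I)

lemma Generic.congr {θ θ' : ℝ} (h : C.Generic θ) (hθ : exp (θ * I) = exp (θ' * I)) :
    C.Generic θ' := by
  refine ⟨fun f t ht => ?_, fun f t ht => ?_, fun v => ?_⟩
  · rw [← Hits.congr hθ] at ht; exact h.regular f t ht
  · rw [← Hits.congr hθ] at ht; exact h.crossing f t ht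
  · rw [← hθ]; exact h.vertex v

open MeasureTheory in
/-- Almost every meridian is in general position, by Sard's theorem. -/
lemma volume_not_generic [Finite V] : volume {θ | ¬ C.Generic θ} = 0 := by
  -- the exceptional parameters on an edge
  set X : G.edgeSet → Set ℝ := fun f =>
    {t ∈ Ioo (0 : ℝ) 1 | ¬ (ContDiffAt ℝ 1 (C.L f) t ∧ deriv (C.L f) t ≠ 0)} ∪ {0, 1} ∪
      ⋃ f' ∈ {f' | f ≠ f'}, Prod.fst '' crossPairs (fun t => exp (C.L f t)) fun t => exp (C.L f' t)
    with hX
  set Y : G.edgeSet → Set ℝ := fun f =>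
    {t | ContDiffAt ℝ 1 (C.L f) t ∧ (deriv (C.L f) t).im = 0} with hY
  set Z : Set ℝ := (⋃ f, (C.ang f '' X f ∪ C.ang f '' Y f)) ∪ range fun v => (C.P v).im with hZ
  have hXfin : ∀ f, (X f).Finite := fun f =>
    ((C.regular f).union (toFinite _)).union
      (Finite.biUnion (toFinite _) fun f' hf' => (C.finite f f' hf').image _)
  have hYnull : ∀ f, volume (C.ang f '' Y f) = 0 := by
    intro f
    refine addHaar_image_eq_zero_of_det_fderivWithin_eq_zero volume
      (f' := fun _ => (0 : ℝ →L[ℝ] ℝ)) ?_ ?_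
    · rintro t ⟨h1, h2⟩
      obtain ⟨h3, h4⟩ := C.deriv_ang h1
      have h5 := (h3.differentiableAt one_ne_zero).hasDerivAt
      rw [h4, h2] at h5
      have h6 := h5.hasFDerivAt
      have h7 : (ContinuousLinearMap.toSpanSingleton ℝ (0 : ℝ)) = (0 : ℝ →L[ℝ] ℝ) := by
        ext; simp
      rw [h7] at h6
      exact h6.hasFDerivWithinAt
    · intro t _
      simp [ContinuousLinearMap.det]
  have hZnull : volume Z = 0 := by
    refine measure_union_null ?_ ((finite_range _).measure_zero _)
    rw [measure_iUnion_null_iff]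
    intro f
    exact measure_union_null (((hXfin f).image _).measure_zero _) (hYnull f)
  have hsub : {θ | ¬ C.Generic θ} ⊆ ⋃ k : ℤ, (fun θ => θ + k * (2 * Real.pi)) ⁻¹' Z := by
    intro θ hθ
    by_contra hnot
    apply hθ
    have hnot' : ∀ a : ℝ, exp (a * I) = exp (θ * I) → a ∉ Z := by
      intro a ha haZ
      obtain ⟨k, hk⟩ := exp_mul_I_eq_iff.1 ha
      exact hnot (mem_iUnion.2 ⟨k, by rw [mem_preimage, ← hk]; exact haZ⟩)
    have hXn : ∀ f, ∀ t ∈ Hits (C.ang f) θ, t ∉ X f := fun f t ht h =>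
      hnot' _ ht.2 (Or.inl (mem_iUnion.2 ⟨f, Or.inl ⟨t, h, rfl⟩⟩))
    have hYn : ∀ f, ∀ t ∈ Hits (C.ang f) θ, t ∉ Y f := fun f t ht h =>
      hnot' _ ht.2 (Or.inl (mem_iUnion.2 ⟨f, Or.inr ⟨t, h, rfl⟩⟩))
    have hIoo : ∀ f, ∀ t ∈ Hits (C.ang f) θ, t ∈ Ioo (0 : ℝ) 1 := by
      intro f t ht
      rcases eq_endpoints_or_mem_Ioo_of_mem_Icc ht.1 with rfl | rfl | h
      · exact absurd (Or.inl (Or.inr (by simp))) (hXn f 0 ht)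
      · exact absurd (Or.inl (Or.inr (by simp))) (hXn f 1 ht)
      · exact h
    refine ⟨fun f t ht => ?_, fun f t ht f' hf' s hs heq => ?_, fun v hv => ?_⟩
    · have h1 := hIoo f t ht
      have h2 : ContDiffAt ℝ 1 (C.L f) t := by
        by_contra h
        exact hXn f t ht (Or.inl (Or.inl ⟨h1, fun h' => h h'.1⟩))
      exact ⟨h1, h2, fun h => hYn f t ht ⟨h2, h⟩⟩
    · refine hXn f t ht (Or.inr (mem_biUnion (x := f') hf'.symm ?_))
      exact ⟨(t, s), ⟨hIoo f t ht, hs, heq⟩, rfl⟩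
    · exact hnot' _ hv (Or.inr ⟨v, rfl⟩)
  refine measure_mono_null hsub ?_
  rw [measure_iUnion_null_iff]
  intro k
  rw [measure_preimage_add_right]
  exact hZnull

open MeasureTheory in
/-- Points of given intervals off a null set can be chosen to be distinct modulo `2π`. -/
lemma exists_distinct_angles {ι : Type*} [Finite ι] {a b : ι → ℝ} (hab : ∀ i, a i < b i)
    {B : Set ℝ} (hB : volume B = 0) : ∃ θ : ι → ℝ, (∀ i, θ i ∈ Ioo (a i) (b i) \ B) ∧
      ∀ i j, i ≠ j → exp (θ i * I) ≠ exp (θ j * I) := by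
  classical
  have key : ∀ s : Finset ι, ∃ θ : ι → ℝ, (∀ i ∈ s, θ i ∈ Ioo (a i) (b i) \ B) ∧
      ∀ i ∈ s, ∀ j ∈ s, i ≠ j → exp (θ i * I) ≠ exp (θ j * I) := by
    intro s
    induction s using Finset.induction with
    | empty => exact ⟨0, by simp, by simp⟩
    | insert i s hi ih =>
      obtain ⟨θ, h1, h2⟩ := ih
      obtain ⟨x, hx, hx'⟩ : ∃ x ∈ Ioo (a i) (b i), x ∉ B ∪ ⋃ j : ι, ⋃ k : ℤ,
          {θ j + k * (2 * Real.pi)} := by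
        by_contra! hcon
        have hnull : volume (B ∪ ⋃ j : ι, ⋃ k : ℤ, {θ j + k * (2 * Real.pi)}) = 0 := by
          refine measure_union_null hB (measure_iUnion_null fun j => measure_iUnion_null fun k => ?_)
          exact (finite_singleton _).measure_zero _
        have := measure_mono_null (fun x hx => hcon x hx) hnull
        rw [Real.volume_Ioo, ENNReal.ofReal_eq_zero] at this
        linarith [hab i]
      have hxj : ∀ j, exp (x * I) ≠ exp (θ j * I) := by
        intro j h
        obtain ⟨k, hk⟩ := exp_mul_I_eq_iff.1 h
        exact hx' (Or.inr (mem_iUnion.2 ⟨j, mem_iUnion.2 ⟨k, hk⟩⟩))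
      refine ⟨Function.update θ i x, fun j hj => ?_, fun j hj k hk hjk => ?_⟩
      · by_cases hji : j = i
        · subst hji
          rw [Function.update_self]
          exact ⟨hx, fun h => hx' (Or.inl h)⟩
        · rw [Function.update_of_ne hji]
          exact h1 j (Finset.mem_of_mem_insert_of_ne hj hji)
      · by_cases hji : j = i
        · subst hji
          rw [Function.update_self, Function.update_of_ne hjk.symm]
          exact hxj k
        · by_cases hki : k = i
          · subst hki
            rw [Function.update_self, Function.update_of_ne hji]
            exact (hxj j).symm
          · rw [Function.update_of_ne hji, Function.update_of_ne hki]
            exact h2 j (Finset.mem_of_mem_insert_of_ne hj hji) k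
              (Finset.mem_of_mem_insert_of_ne hk hki) hjk
  have := Fintype.ofFinite ι
  obtain ⟨θ, h1, h2⟩ := key Finset.univ
  exact ⟨θ, fun i => h1 i (Finset.mem_univ i), fun i j => h2 i (Finset.mem_univ i) j (Finset.mem_univ j)⟩

/-- Every edge has a point, on a generic meridian of its own, such that the edge does not meet the
meridian below this point. -/
theorem exists_bases [Finite V] : ∃ t₀ : G.edgeSet → ℝ,
    (∀ e, t₀ e ∈ Ioo (0 : ℝ) 1 ∧ C.Generic (C.ang e (t₀ e)) ∧
      ∀ t ∈ Hits (C.ang e) (C.ang e (t₀ e)), t ≠ t₀ e → (C.L e (t₀ e)).re < (C.L e t).re) ∧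
    ∀ e f, e ≠ f → exp (C.ang e (t₀ e) * I) ≠ exp (C.ang f (t₀ f) * I) := by
  choose s hs t ht hst using C.turning
  obtain ⟨θ, hθ, hθne⟩ := exists_distinct_angles
    (a := fun e => min (C.ang e (s e)) (C.ang e (t e)))
    (b := fun e => max (C.ang e (s e)) (C.ang e (t e)))
    (fun e => min_lt_max.2 (hst e)) C.volume_not_generic
  have hgen : ∀ e, C.Generic (θ e) := fun e => not_not.1 (hθ e).2
  have hmin : ∀ e, ∃ r ∈ Hits (C.ang e) (θ e), ∀ r' ∈ Hits (C.ang e) (θ e),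
      (C.L e r).re ≤ (C.L e r').re := by
    intro e
    have hfin : (Hits (C.ang e) (θ e)).Finite :=
      (exists_continuation (C.continuous_ang e) fun r hr => by
        obtain ⟨h1, h2, h3⟩ := (hgen e).regular e r hr
        obtain ⟨h4, h5⟩ := C.deriv_ang h2
        exact ⟨h1, h4, by rwa [h5]⟩).1
    have hne : (Hits (C.ang e) (θ e)).Nonempty := by
      obtain ⟨r, hr, hr'⟩ := intermediate_value_uIcc (C.continuous_ang e).continuousOn
        (show θ e ∈ uIcc (C.ang e (s e)) (C.ang e (t e)) from Ioo_subset_Icc_self (hθ e).1)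
      exact ⟨r, (ordConnected_Icc.uIcc_subset (hs e) (ht e)) hr, by rw [hr']⟩
    exact hfin.exists_minimalFor (fun r => (C.L e r).re) _ hne |>.imp fun r hr =>
      ⟨hr.1, fun r' hr' => le_of_not_gt fun h => absurd (hr.2 hr' h.le) (not_le.2 h)⟩
  choose r hr hrmin using hmin
  have hexp : ∀ e, exp (θ e * I) = exp (C.ang e (r e) * I) := fun e => (hr e).2.symm
  refine ⟨r, fun e => ⟨((hgen e).regular e _ (hr e)).1, (hgen e).congr C (hexp e), ?_⟩, ?_⟩
  · intro r' hr' hne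
    rw [← Hits.congr (hexp e)] at hr'
    refine lt_of_le_of_ne (hrmin e r' hr') fun heq => hne ?_
    refine (C.injOn e (hr e).1 hr'.1 ?_).symm
    exact C.exp_L_eq_iff.2 ⟨heq, (hr e).2.trans hr'.2.symm⟩
  · intro e f hef
    rw [← hexp, ← hexp]
    exact hθne e f hef

end CylDrawing

/-! ### Fingers towards the crosscap -/

lemma eventually_uIcc {g : ℝ → ℝ} (hg : ContinuousAt g 0) {P : ℝ → ℝ → Prop}
    (h : ∀ᶠ z : ℝ × ℝ in 𝓝 (g 0, 0), P z.1 z.2) :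
    ∀ᶠ δ in 𝓝 (0 : ℝ), ∀ s ∈ uIcc (g (-δ)) (g δ), P s δ ∧ P s (-δ) := by
  rw [nhds_prod_eq] at h
  obtain ⟨p, hp, q, hq, hpq⟩ := eventually_prod_iff.1 h
  obtain ⟨r, hr, hball⟩ := Metric.eventually_nhds_iff_ball.1 hp
  have hneg : Tendsto (fun δ : ℝ => -δ) (𝓝 0) (𝓝 0) := by
    have := (continuous_neg (G := ℝ)).tendsto 0
    rwa [neg_zero] at this
  have h1 := hg.eventually (Metric.ball_mem_nhds (g 0) hr)
  filter_upwards [h1, hneg.eventually h1, hq, hneg.eventually hq] with δ a1 a2 a3 a4 s hs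
  have : s ∈ Metric.ball (g 0) r := by
    have hoc : OrdConnected (Metric.ball (g 0) r) := by
      rw [Real.ball_eq_Ioo]
      exact ordConnected_Ioo
    exact hoc.uIcc_subset a2 a1 hs
  exact ⟨hpq (hball s this) a3, hpq (hball s this) a4⟩

/-- The data used to lead edges through the crosscap.  A finger runs along the two meridians at
angles `θ e ± δ`, from the parameters `foot e (±δ)` of the edge `e` down to the height `ε`, below
the drawing.  Every edge `f` crosses the parts of the two meridians below the feet equally
often, and no edge crosses `e` between the two feet, where the finger replaces `e`. -/
structure Fingers {V : Type*} {G : SimpleGraph V} (C : CylDrawing G) where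
  θ : G.edgeSet → ℝ
  δ : ℝ
  ε : ℝ
  foot : G.edgeSet → ℝ → ℝ
  δ_pos : 0 < δ
  δ_lt : δ < Real.pi / 2
  ε_pos : 0 < ε
  lt_L : ∀ f, ∀ t ∈ Icc (0 : ℝ) 1, ε < (C.L f t).re
  lt_P : ∀ v, ε < (C.P v).re
  foot_mem : ∀ e τ, τ = δ ∨ τ = -δ → foot e τ ∈ Ioo (0 : ℝ) 1
  ang_foot : ∀ e τ, τ = δ ∨ τ = -δ → C.ang e (foot e τ) = θ e + τ
  regular : ∀ e f τ, τ = δ ∨ τ = -δ → ∀ t ∈ Hits (C.ang f) (θ e + τ),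
    t ∈ Ioo (0 : ℝ) 1 ∧ ContDiffAt ℝ 1 (C.L f) t ∧ (deriv (C.L f) t).im ≠ 0
  not_mem : ∀ e f τ, τ = δ ∨ τ = -δ → f ≠ e → ∀ t ∈ Hits (C.ang f) (θ e + τ),
    t ∉ uIcc (foot f (-δ)) (foot f δ)
  low_finite : ∀ e f τ, τ = δ ∨ τ = -δ →
    {t ∈ Hits (C.ang f) (θ e + τ) | (C.L f t).re < (C.L e (foot e τ)).re}.Finite
  low_ncard : ∀ e f, {t ∈ Hits (C.ang f) (θ e + δ) | (C.L f t).re < (C.L e (foot e δ)).re}.ncard =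
    {t ∈ Hits (C.ang f) (θ e + -δ) | (C.L f t).re < (C.L e (foot e (-δ))).re}.ncard
  low_self : ∀ e τ, τ = δ ∨ τ = -δ → ∀ t ∈ Hits (C.ang e) (θ e + τ),
    (C.L e (foot e τ)).re ≤ (C.L e t).re
  no_cross : ∀ e f, f ≠ e → ∀ s ∈ uIcc (foot e (-δ)) (foot e δ), ∀ t ∈ Icc (0 : ℝ) 1,
    exp (C.L e s) ≠ exp (C.L f t)
  apart : ∀ e f, e ≠ f → ∃ α, 2 * δ < α ∧ α < 2 * Real.pi - 2 * δ ∧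
    ∃ k : ℤ, θ f - θ e = α + k * (2 * Real.pi)
  vertex : ∀ e τ, τ = δ ∨ τ = -δ → ∀ v, exp ((C.P v).im * I) ≠ exp ((θ e + τ : ℝ) * I)

open CylDrawing in
/-- Thin fingers along generic meridians through the points given by `exists_bases` have all the
properties required, since a generic meridian is met transversally and its hits move continuously
with the angle. -/
theorem exists_fingers {V : Type*} [Finite V] {G : SimpleGraph V} (C : CylDrawing G) :
    Nonempty (Fingers C) := by
  obtain ⟨t₀, hbase, hne⟩ := C.exists_bases
  set θ : G.edgeSet → ℝ := fun e => C.ang e (t₀ e) with hθ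
  have hgen : ∀ e, C.Generic (θ e) := fun e => (hbase e).2.1
  have ht₀ : ∀ e, t₀ e ∈ Hits (C.ang e) (θ e) := fun e =>
    ⟨Ioo_subset_Icc_self (hbase e).1, rfl⟩
  have hcont := fun e f => exists_continuation (C.continuous_ang f) (θ := θ e) fun t ht => by
    obtain ⟨h1, h2, h3⟩ := (hgen e).regular f t ht
    obtain ⟨h4, h5⟩ := C.deriv_ang h2
    exact ⟨h1, h4, by rwa [h5]⟩
  choose hfin g hg hbij using hcont
  set foot : G.edgeSet → ℝ → ℝ := fun e τ => g e e (t₀ e) τ with hfoot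
  have hfoot0 : ∀ e, foot e 0 = t₀ e := fun e => (hg e e _ (ht₀ e)).1
  have hfootc : ∀ e, ContinuousAt (foot e) 0 := fun e => (hg e e _ (ht₀ e)).2.1
  -- a property that holds near a hit holds at its continuation
  have hprop : ∀ e f, ∀ h ∈ Hits (C.ang f) (θ e), ∀ P : ℝ → Prop, (∀ᶠ t in 𝓝 h, P t) →
      ∀ᶠ τ in 𝓝 (0 : ℝ), P (g e f h τ) := by
    intro e f h hh P hP
    obtain ⟨h0, hc, -⟩ := hg e f h hh
    rw [← h0] at hP
    exact hc.eventually hP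
  have hre : ∀ e f, ∀ h ∈ Hits (C.ang f) (θ e), ∀ᶠ τ in 𝓝 (0 : ℝ),
      ((C.L f (g e f h τ)).re < (C.L e (foot e τ)).re ↔ (C.L f h).re < (C.L e (t₀ e)).re) := by
    intro e f h hh
    by_cases heq : (C.L f h).re = (C.L e (t₀ e)).re
    · have hexp : exp (C.L f h) = exp (C.L e (t₀ e)) :=
        C.exp_L_eq_iff.2 ⟨heq, hh.2⟩
      by_cases hfe : f = e
      · subst hfe
        have : h = t₀ f := C.injOn f hh.1 (ht₀ f).1 hexp
        subst this
        exact Eventually.of_forall fun τ => by simp [foot]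
      · exact absurd hexp ((hgen e).crossing f h hh e (Ne.symm hfe) _ (hbase e).1)
    · have hc1 : ContinuousAt (fun τ => (C.L f (g e f h τ)).re) 0 :=
        (Complex.continuous_re.comp (C.cont f)).continuousAt.comp (hg e f h hh).2.1
      have hc2 : ContinuousAt (fun τ => (C.L e (foot e τ)).re) 0 :=
        (Complex.continuous_re.comp (C.cont e)).continuousAt.comp (hfootc e)
      have e1 : (C.L f (g e f h 0)).re = (C.L f h).re := by rw [(hg e f h hh).1]
      have e2 : (C.L e (foot e 0)).re = (C.L e (t₀ e)).re := by rw [hfoot0]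
      rcases lt_or_gt_of_ne heq with hlt | hlt
      · filter_upwards [hc1.eventually_lt hc2 (by rwa [e1, e2])] with τ hτ
        exact iff_of_true hτ hlt
      · filter_upwards [hc2.eventually_lt hc1 (by rwa [e1, e2])] with τ hτ
        exact iff_of_false (not_lt.2 hτ.le) (not_lt.2 hlt.le)
  -- the conditions at a single meridian
  let Q : ℝ → Prop := fun τ => ∀ e,
      (foot e τ ∈ Ioo (0 : ℝ) 1 ∧ C.ang e (foot e τ) = θ e + τ ∧
        ∀ v, exp ((C.P v).im * I) ≠ exp ((θ e + τ : ℝ) * I)) ∧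
      ∀ f, BijOn (fun h => g e f h τ) (Hits (C.ang f) (θ e)) (Hits (C.ang f) (θ e + τ)) ∧
        ∀ h ∈ Hits (C.ang f) (θ e), (g e f h τ ∈ Ioo (0 : ℝ) 1 ∧ ContDiffAt ℝ 1 (C.L f) (g e f h τ) ∧
          (deriv (C.L f) (g e f h τ)).im ≠ 0) ∧
          ((C.L f (g e f h τ)).re < (C.L e (foot e τ)).re ↔ (C.L f h).re < (C.L e (t₀ e)).re)
  have hev : ∀ᶠ τ in 𝓝 (0 : ℝ), Q τ := by
    rw [eventually_all]
    intro e
    refine Eventually.and ?_ ?_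
    · refine Eventually.and ?_ (Eventually.and (hg e e _ (ht₀ e)).2.2 ?_)
      · exact hprop e e _ (ht₀ e) _ (Ioo_mem_nhds (hbase e).1.1 (hbase e).1.2)
      · rw [eventually_all]
        intro v
        have hc : ContinuousAt (fun τ : ℝ => exp ((θ e + τ : ℝ) * I)) 0 := by fun_prop
        exact continuousAt_const.ne_iff_eventually_ne hc |>.1 (by
          rw [add_zero]; exact (hgen e).vertex v)
    · rw [eventually_all]
      intro f
      refine (hbij e f).and ?_
      rw [eventually_all_finite (hfin e f)]
      intro h hh
      refine Eventually.and ?_ (hre e f h hh)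
      obtain ⟨h1, h2, h3⟩ := (hgen e).regular f h hh
      refine hprop e f h hh (fun t => t ∈ Ioo (0 : ℝ) 1 ∧ ContDiffAt ℝ 1 (C.L f) t ∧
        (deriv (C.L f) t).im ≠ 0) ?_
      have h4 : ContinuousAt (fun t => (deriv (C.L f) t).im) h :=
        Complex.continuous_im.continuousAt.comp
          (ContDiffAt.continuousAt
            ((h2.fderiv_right (m := 0) (by simp)).clm_apply (contDiffAt_const (c := (1 : ℝ)))))
      filter_upwards [Ioo_mem_nhds h1.1 h1.2, h2.eventually (by simp), h4.eventually_ne h3] with t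
        a1 a2 a3 using ⟨a1, a2, a3⟩
  have hneg : Tendsto (fun δ : ℝ => -δ) (𝓝 0) (𝓝 0) := by
    have := (continuous_neg (G := ℝ)).tendsto 0
    rwa [neg_zero] at this
  -- the conditions on the removed part of an edge
  have hmid : ∀ᶠ δ in 𝓝 (0 : ℝ), ∀ e f, f ≠ e → ∀ s ∈ uIcc (foot e (-δ)) (foot e δ),
      (∀ t ∈ Icc (0 : ℝ) 1, exp (C.L e s) ≠ exp (C.L f t)) ∧
      (exp (C.ang e s * I) ≠ exp ((θ f + δ : ℝ) * I) ∧
        exp (C.ang e s * I) ≠ exp ((θ f + -δ : ℝ) * I)) := by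
    rw [eventually_all]; intro e
    rw [eventually_all]; intro f
    by_cases hfe : f = e
    · exact Eventually.of_forall fun δ h => absurd hfe h
    have h1 : ∀ᶠ s in 𝓝 (t₀ e), ∀ t ∈ Icc (0 : ℝ) 1, exp (C.L e s) ≠ exp (C.L f t) := by
      refine (isCompact_Icc (a := (0 : ℝ)) (b := 1)).eventually_forall_of_forall_eventually ?_
      intro t ht
      have hc1 : ContinuousAt (fun z : ℝ × ℝ => exp (C.L e z.1)) (t₀ e, t) :=
        ((Complex.continuous_exp.comp (C.cont e)).comp continuous_fst).continuousAt
      have hc2 : ContinuousAt (fun z : ℝ × ℝ => exp (C.L f z.2)) (t₀ e, t) :=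
        ((Complex.continuous_exp.comp (C.cont f)).comp continuous_snd).continuousAt
      refine hc1.ne_iff_eventually_ne hc2 |>.1 fun heq => ?_
      rcases eq_endpoints_or_mem_Ioo_of_mem_Icc ht with rfl | rfl | h
      · obtain ⟨u, v, -, h0, -⟩ := C.ends f
        exact C.ne_vertex e _ (hbase e).1 u (heq.trans h0)
      · obtain ⟨u, v, -, -, h0⟩ := C.ends f
        exact C.ne_vertex e _ (hbase e).1 v (heq.trans h0)
      · exact (hgen e).crossing e _ (ht₀ e) f hfe t h heq
    have h2 : ∀ᶠ z : ℝ × ℝ in 𝓝 (foot e 0, 0),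
        (∀ t ∈ Icc (0 : ℝ) 1, exp (C.L e z.1) ≠ exp (C.L f t)) ∧
        exp (C.ang e z.1 * I) ≠ exp ((θ f + z.2 : ℝ) * I) := by
      refine Eventually.and ?_ ?_
      · rw [hfoot0]
        exact (continuousAt_fst (p := (t₀ e, (0 : ℝ)))).eventually h1
      · have hc1 : ContinuousAt (fun z : ℝ × ℝ => exp (C.ang e z.1 * I)) (foot e 0, 0) := by
          have := (C.continuous_ang e)
          fun_prop
        have hc2 : ContinuousAt (fun z : ℝ × ℝ => exp ((θ f + z.2 : ℝ) * I)) (foot e 0, 0) := by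
          fun_prop
        refine hc1.ne_iff_eventually_ne hc2 |>.1 ?_
        simp only [add_zero, hfoot0]
        exact hne e f (Ne.symm hfe)
    filter_upwards [eventually_uIcc (hfootc e) (P := fun s δ =>
      (∀ t ∈ Icc (0 : ℝ) 1, exp (C.L e s) ≠ exp (C.L f t)) ∧
        exp (C.ang e s * I) ≠ exp ((θ f + δ : ℝ) * I)) h2] with δ hδ _ s hs
    exact ⟨(hδ s hs).1.1, (hδ s hs).1.2, (hδ s hs).2.2⟩
  have hapart : ∀ᶠ δ in 𝓝 (0 : ℝ), ∀ e f, e ≠ f → ∃ α, 2 * δ < α ∧ α < 2 * Real.pi - 2 * δ ∧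
      ∃ k : ℤ, θ f - θ e = α + k * (2 * Real.pi) := by
    rw [eventually_all]; intro e
    rw [eventually_all]; intro f
    by_cases hef : e = f
    · exact Eventually.of_forall fun δ h => absurd hef h
    set α := toIcoMod Real.two_pi_pos 0 (θ f - θ e) with hα
    have hmem := toIcoMod_mem_Ico Real.two_pi_pos 0 (θ f - θ e)
    rw [zero_add] at hmem
    have hk : θ f - θ e = α + toIcoDiv Real.two_pi_pos 0 (θ f - θ e) * (2 * Real.pi) := by
      rw [hα, toIcoMod]
      simp
    have hα0 : 0 < α := by
      refine lt_of_le_of_ne hmem.1 fun h0 => hne e f hef ?_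
      refine ((exp_mul_I_eq_iff (a := θ f) (b := θ e)).2
        ⟨toIcoDiv Real.two_pi_pos 0 (θ f - θ e), ?_⟩).symm
      rw [← h0, zero_add] at hk
      linarith
    have hc1 : ContinuousAt (fun δ : ℝ => 2 * δ) 0 := by fun_prop
    have hc2 : ContinuousAt (fun δ : ℝ => 2 * Real.pi - 2 * δ) 0 := by fun_prop
    filter_upwards [hc1.eventually_lt (continuousAt_const (y := α)) (by simpa using hα0),
      (continuousAt_const (y := α)).eventually_lt hc2 (by simpa using hmem.2)] with δ h1 h2 _
    exact ⟨α, h1, h2, _, hk⟩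
  obtain ⟨ε, hε, hεL, hεP⟩ : ∃ ε : ℝ, 0 < ε ∧ (∀ f, ∀ t ∈ Icc (0 : ℝ) 1, ε < (C.L f t).re) ∧
      ∀ v, ε < (C.P v).re := by
    have h1 : ∀ f, ∀ᶠ ε in 𝓝[>] (0 : ℝ), ∀ t ∈ Icc (0 : ℝ) 1, ε < (C.L f t).re := by
      intro f
      refine nhdsWithin_le_nhds ?_
      refine (isCompact_Icc (a := (0 : ℝ)) (b := 1)).eventually_forall_of_forall_eventually ?_
      intro t _
      have hc : ContinuousAt (fun z : ℝ × ℝ => (C.L f z.2).re) (0, t) :=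
        ((Complex.continuous_re.comp (C.cont f)).comp continuous_snd).continuousAt
      exact continuousAt_fst.eventually_lt hc (C.L_pos f t)
    have h2 : ∀ v, ∀ᶠ ε in 𝓝[>] (0 : ℝ), ε < (C.P v).re := fun v =>
      nhdsWithin_le_nhds (eventually_lt_nhds (C.P_pos v))
    obtain ⟨ε, h3, h4, h5⟩ := ((eventually_all.2 h1).and
      ((eventually_all.2 h2).and eventually_mem_nhdsWithin)).exists
    exact ⟨ε, h5, h3, h4⟩
  have hpi : (0 : ℝ) < Real.pi / 2 := by have := Real.pi_pos; positivity
  obtain ⟨δ, hδ0, hδpi, hpos, hneg', hmidδ, hapartδ⟩ :=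
    ((eventually_mem_nhdsWithin (a := (0 : ℝ)) (s := Ioi 0)).and (nhdsWithin_le_nhds
      ((eventually_lt_nhds hpi).and (hev.and ((hneg.eventually hev).and (hmid.and hapart)))))).exists
  have hboth : ∀ τ, τ = δ ∨ τ = -δ → Q τ := by
    rintro τ (rfl | rfl)
    · exact hpos
    · exact hneg'
  have hlow : ∀ e f τ, τ = δ ∨ τ = -δ →
      {t ∈ Hits (C.ang f) (θ e + τ) | (C.L f t).re < (C.L e (foot e τ)).re} =
        (fun h => g e f h τ) '' {h ∈ Hits (C.ang f) (θ e) | (C.L f h).re < (C.L e (t₀ e)).re} ∧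
      InjOn (fun h => g e f h τ) {h ∈ Hits (C.ang f) (θ e) | (C.L f h).re < (C.L e (t₀ e)).re} := by
    intro e f τ hτ
    obtain ⟨hb, hh⟩ := (hboth τ hτ e).2 f
    refine ⟨?_, hb.injOn.mono fun h hh => hh.1⟩
    ext t
    constructor
    · rintro ⟨ht, hlt⟩
      obtain ⟨h, hh', rfl⟩ := hb.surjOn ht
      exact ⟨h, ⟨hh', (hh h hh').2.1 hlt⟩, rfl⟩
    · rintro ⟨h, ⟨hh', hlt⟩, rfl⟩
      exact ⟨hb.mapsTo hh', (hh h hh').2.2 hlt⟩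
  refine ⟨{ θ := θ, δ := δ, ε := ε, foot := foot
            δ_pos := hδ0, δ_lt := hδpi, ε_pos := hε, lt_L := hεL, lt_P := hεP
            foot_mem := fun e τ hτ => (hboth τ hτ e).1.1
            ang_foot := fun e τ hτ => (hboth τ hτ e).1.2.1
            regular := ?_
            not_mem := ?_
            low_finite := ?_
            low_ncard := ?_
            low_self := ?_
            no_cross := fun e f hfe s hs => (hmidδ e f hfe s hs).1
            apart := hapartδ
            vertex := fun e τ hτ => (hboth τ hτ e).1.2.2 }⟩
  · intro e f τ hτ t ht
    obtain ⟨hb, hh⟩ := (hboth τ hτ e).2 f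
    obtain ⟨h, hh', rfl⟩ := hb.surjOn ht
    exact (hh h hh').1
  · intro e f τ hτ hfe t ht hmem
    have := (hmidδ f e (Ne.symm hfe) t hmem).2
    rcases hτ with rfl | rfl
    · exact this.1 ht.2
    · exact this.2 ht.2
  · intro e f τ hτ
    rw [(hlow e f τ hτ).1]
    exact ((hfin e f).subset fun h hh => hh.1).image _
  · intro e f
    rw [(hlow e f δ (Or.inl rfl)).1, (hlow e f (-δ) (Or.inr rfl)).1,
      (hlow e f δ (Or.inl rfl)).2.ncard_image, (hlow e f (-δ) (Or.inr rfl)).2.ncard_image]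
  · intro e τ hτ t ht
    by_contra hlt
    have hmem : t ∈ {t ∈ Hits (C.ang e) (θ e + τ) | (C.L e t).re < (C.L e (foot e τ)).re} :=
      ⟨ht, not_le.1 hlt⟩
    rw [(hlow e e τ hτ).1] at hmem
    obtain ⟨h, ⟨hh, hlt'⟩, -⟩ := hmem
    by_cases heq : h = t₀ e
    · rw [heq] at hlt'
      exact lt_irrefl _ hlt'
    · exact absurd ((hbase e).2.2 h hh heq) (not_lt.2 hlt'.le)

/-! ### Points and curves near the crosscap -/

lemma toRP2_pt_eq_iff' {L M : ℂ} : toRP2 (pt L) = toRP2 (pt M) ↔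
    (L.re = M.re ∧ exp (L.im * I) = exp (M.im * I)) ∨
      (L.re = -M.re ∧ exp (L.im * I) = exp ((M.im + Real.pi : ℝ) * I)) := by
  rw [toRP2_pt_eq_iff, exp_eq_exp_iff, exp_eq_exp_iff, exp_mul_I_eq_iff, exp_mul_I_eq_iff]
  simp [deck]

lemma toRP2_pt_eq_iff_of_pos {L M : ℂ} (hL : 0 < L.re) (hM : 0 < M.re) :
    toRP2 (pt L) = toRP2 (pt M) ↔ exp L = exp M := by
  rw [toRP2_pt_eq_iff]
  refine or_iff_left fun h => ?_
  have := (exp_eq_exp_iff.1 h).1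
  simp [deck] at this
  linarith

lemma contDiffAt_deck {L : ℝ → ℂ} {t : ℝ} (h : ContDiffAt ℝ 1 L t) :
    ContDiffAt ℝ 1 (fun r => deck (L r)) t ∧
      deriv (fun r => deck (L r)) t = -(starRingEnd ℂ) (deriv L t) := by
  refine ⟨((Complex.conjCLE.contDiff.contDiffAt.comp t h).neg).add contDiffAt_const, ?_⟩
  have h1 := (Complex.conjCLE.toContinuousLinearMap.hasFDerivAt.comp_hasDerivAt t
    (h.differentiableAt one_ne_zero).hasDerivAt).neg.add_const (Real.pi * I)
  exact h1.deriv

lemma CrossTransversally.symm {S : Type} {π : S2 → S} {c d : ℝ → S} {s t : ℝ}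
    (h : CrossTransversally π c s d t) : CrossTransversally π d t c s := by
  obtain ⟨x, y, hx, hy, hxy, hl⟩ := h
  exact ⟨y, x, hy, hx, hxy.symm, LinearIndependent.pair_symm_iff.1 hl⟩

lemma crossTransversally_toRP2 {c d : ℝ → RP2} {s t : ℝ} {L M : ℝ → ℂ}
    (hc : ∀ᶠ r in 𝓝 s, c r = toRP2 (pt (L r))) (hd : ∀ᶠ r in 𝓝 t, d r = toRP2 (pt (M r)))
    (hL : ContDiffAt ℝ 1 L s) (hM : ContDiffAt ℝ 1 M t)
    (heq : toRP2 (pt (L s)) = toRP2 (pt (M t)))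
    (h1 : exp (L s) = exp (M t) → det2 (deriv L s) (deriv M t) ≠ 0)
    (h2 : exp (L s) = exp (deck (M t)) →
      det2 (deriv L s) (-(starRingEnd ℂ) (deriv M t)) ≠ 0) :
    CrossTransversally toRP2 c s d t := by
  rcases toRP2_pt_eq_iff.1 heq with h | h
  · exact crossTransversally_pt hc hd hL hM h (h1 h)
  · obtain ⟨h3, h4⟩ := contDiffAt_deck hM
    refine crossTransversally_pt hc (M := fun r => deck (M r)) ?_ hL h3 h ?_
    · filter_upwards [hd] with r hr
      rw [hr, toRP2_deck]
    · rw [h4]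
      exact h2 h

lemma crosscap_eq (φ : ℝ) : crosscap φ = toRP2 (pt ⟨0, φ⟩) := by
  unfold crosscap
  congr 1
  apply Subtype.ext
  have h : ‖cyl ⟨0, φ⟩‖ = 1 := by
    have := norm_cyl_sq ⟨0, φ⟩
    simp only [ne_eq, OfNat.ofNat_ne_zero, not_false_eq_true, zero_pow, add_zero] at this
    nlinarith [norm_nonneg (cyl ⟨0, φ⟩)]
  simp only [equator, pt, ptE, h]
  simp [cyl]

lemma re_eq_zero_of_mem_crosscap {L : ℂ} (h : toRP2 (pt L) ∈ range crosscap) : L.re = 0 := by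
  obtain ⟨φ, hφ⟩ := h
  rw [crosscap_eq] at hφ
  rcases toRP2_pt_eq_iff'.1 hφ with h | h
  · exact h.1.symm
  · have := h.1
    simp at this
    linarith

/-- Truncation of a real number to `[-1, 1]`. -/
noncomputable def clamp (x : ℝ) : ℝ := max (-1) (min 1 x)

lemma clamp_of_le {x : ℝ} (h : 1 ≤ x) : clamp x = 1 := by
  rw [clamp, min_eq_left h, max_eq_right (by norm_num)]

lemma clamp_of_ge {x : ℝ} (h : x ≤ -1) : clamp x = -1 := by
  rw [clamp, min_eq_right (by linarith), max_eq_left h]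

lemma clamp_of_abs {x : ℝ} (h : |x| ≤ 1) : clamp x = x := by
  have := abs_le.1 h
  rw [clamp, min_eq_right this.2, max_eq_right this.1]

lemma abs_clamp_le (x : ℝ) : |clamp x| ≤ 1 := by
  rw [abs_le, clamp]
  exact ⟨le_max_left _ _, max_le (by norm_num) (min_le_left _ _)⟩

lemma clamp_neg (x : ℝ) : clamp (-x) = -clamp x := by
  rcases le_total x (-1) with h | h
  · rw [clamp_of_ge h, clamp_of_le (by linarith)]; norm_num
  rcases le_total 1 x with h' | h'
  · rw [clamp_of_le h', clamp_of_ge (by linarith)]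
  · rw [clamp_of_abs (abs_le.2 ⟨h, h'⟩), clamp_of_abs (abs_le.2 ⟨by linarith, by linarith⟩)]

lemma clamp_eq_iff {x c : ℝ} (hc : |c| < 1) : clamp x = c ↔ x = c := by
  have hc' := abs_lt.1 hc
  constructor
  · intro h
    rcases le_total x (-1) with h1 | h1
    · rw [clamp_of_ge h1] at h; linarith
    rcases le_total 1 x with h2 | h2
    · rw [clamp_of_le h2] at h; linarith
    rwa [clamp_of_abs (abs_le.2 ⟨h1, h2⟩)] at h
  · rintro rfl
    exact clamp_of_abs hc.le

lemma continuous_clamp : Continuous clamp := by unfold clamp; fun_prop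

namespace Fingers

variable {V : Type*} {G : SimpleGraph V} {C : CylDrawing G} (F : Fingers C)

/-- The parameter where the finger of an edge starts. -/
def tm (e : G.edgeSet) : ℝ := F.foot e (-F.δ)

/-- The parameter where the finger of an edge ends. -/
def tp (e : G.edgeSet) : ℝ := F.foot e F.δ

/-- The angle covered by half of a passage through the crosscap. -/
noncomputable def κ : ℝ := Real.pi / 2 - F.δ

lemma κ_pos : 0 < F.κ := sub_pos.2 F.δ_lt

lemma tm_mem (e : G.edgeSet) : F.tm e ∈ Ioo (0 : ℝ) 1 := F.foot_mem e _ (Or.inr rfl)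

lemma tp_mem (e : G.edgeSet) : F.tp e ∈ Ioo (0 : ℝ) 1 := F.foot_mem e _ (Or.inl rfl)

lemma ang_tm (e : G.edgeSet) : C.ang e (F.tm e) = F.θ e + -F.δ := F.ang_foot e _ (Or.inr rfl)

lemma ang_tp (e : G.edgeSet) : C.ang e (F.tp e) = F.θ e + F.δ := F.ang_foot e _ (Or.inl rfl)

lemma tm_ne_tp (e : G.edgeSet) : F.tm e ≠ F.tp e := by
  intro h
  have h1 := F.ang_tm e
  rw [h, F.ang_tp e] at h1
  have := F.δ_pos
  linarith

lemma sub_ne_zero' (e : G.edgeSet) : F.tp e - F.tm e ≠ 0 := sub_ne_zero.2 (F.tm_ne_tp e).symm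

/-- The height of the foot at which a finger starts. -/
noncomputable def hm (e : G.edgeSet) : ℝ := (C.L e (F.tm e)).re

/-- The height of the foot at which a finger ends. -/
noncomputable def hp (e : G.edgeSet) : ℝ := (C.L e (F.tp e)).re

lemma lt_hm (e : G.edgeSet) : F.ε < F.hm e := F.lt_L e _ (Ioo_subset_Icc_self (F.tm_mem e))

lemma lt_hp (e : G.edgeSet) : F.ε < F.hp e := F.lt_L e _ (Ioo_subset_Icc_self (F.tp_mem e))

/-- The speed at which the height decreases along a finger. -/
noncomputable def speed (e : G.edgeSet) : ℝ := -(F.hp e + F.hm e) / (F.tp e - F.tm e)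

lemma speed_ne_zero (e : G.edgeSet) : F.speed e ≠ 0 := by
  have h1 := F.lt_hm e
  have h2 := F.lt_hp e
  have h3 := F.ε_pos
  exact div_ne_zero (by linarith) (F.sub_ne_zero' e)

/-- The height along a finger, which becomes negative after the passage through the crosscap. -/
noncomputable def z (e : G.edgeSet) (t : ℝ) : ℝ := F.hm e + (t - F.tm e) * F.speed e

/-- The angle along a finger, as a function of the height. -/
noncomputable def U (e : G.edgeSet) (x : ℝ) : ℝ := F.θ e - Real.pi / 2 + clamp (x / F.ε) * F.κ

/-- The finger of an edge.  It passes through the crosscap between the heights `ε` and `-ε`, while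
the angle decreases by almost `π`; then it returns at negative heights, which is the same as positive
heights at an angle increased by `π`. -/
noncomputable def mid (e : G.edgeSet) (t : ℝ) : ℂ := ⟨F.z e t, F.U e (F.z e t)⟩

lemma z_tm (e : G.edgeSet) : F.z e (F.tm e) = F.hm e := by simp [z]

lemma z_tp (e : G.edgeSet) : F.z e (F.tp e) = -F.hp e := by
  rw [z, speed, mul_div_cancel₀ _ (F.sub_ne_zero' e)]
  ring

lemma z_injective (e : G.edgeSet) : Function.Injective (F.z e) := by
  intro s t h
  have := mul_right_cancel₀ (F.speed_ne_zero e) (add_left_cancel h)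
  linarith

lemma exists_z_eq (e : G.edgeSet) (x : ℝ) : ∃ t, F.z e t = x := by
  refine ⟨F.tm e + (x - F.hm e) / F.speed e, ?_⟩
  have := F.speed_ne_zero e
  unfold z
  field_simp
  ring

lemma continuous_z (e : G.edgeSet) : Continuous (F.z e) := by unfold z; fun_prop

/-- The interior of the parameter interval that is replaced by the finger. -/
def gap (e : G.edgeSet) : Set ℝ := Ioo (min (F.tm e) (F.tp e)) (max (F.tm e) (F.tp e))

lemma gap_subset_uIcc (e : G.edgeSet) : F.gap e ⊆ uIcc (F.tm e) (F.tp e) := Ioo_subset_Icc_self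

lemma uIcc_subset (e : G.edgeSet) : uIcc (F.tm e) (F.tp e) ⊆ Ioo 0 1 :=
  ordConnected_Ioo.uIcc_subset (F.tm_mem e) (F.tp_mem e)

lemma isOpen_gap (e : G.edgeSet) : IsOpen (F.gap e) := isOpen_Ioo

lemma mem_uIcc_iff (e : G.edgeSet) (t : ℝ) :
    t ∈ uIcc (F.tm e) (F.tp e) ↔ t ∈ F.gap e ∨ t = F.tm e ∨ t = F.tp e := by
  unfold gap uIcc
  rcases le_total (F.tm e) (F.tp e) with h | h
  · rw [inf_eq_left.2 h, sup_eq_right.2 h]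
    constructor
    · intro ht
      rcases eq_endpoints_or_mem_Ioo_of_mem_Icc ht with h | h | h
      exacts [Or.inr (Or.inl h), Or.inr (Or.inr h), Or.inl h]
    · rintro (h' | rfl | rfl)
      exacts [Ioo_subset_Icc_self h', left_mem_Icc.2 h, right_mem_Icc.2 h]
  · rw [inf_eq_right.2 h, sup_eq_left.2 h]
    constructor
    · intro ht
      rcases eq_endpoints_or_mem_Ioo_of_mem_Icc ht with h | h | h
      exacts [Or.inr (Or.inr h), Or.inr (Or.inl h), Or.inl h]
    · rintro (h' | rfl | rfl)
      exacts [Ioo_subset_Icc_self h', right_mem_Icc.2 h, left_mem_Icc.2 h]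

lemma mem_gap_iff (e : G.edgeSet) (t : ℝ) :
    t ∈ F.gap e ↔ -F.hp e < F.z e t ∧ F.z e t < F.hm e := by
  have h1 := F.lt_hm e
  have h2 := F.lt_hp e
  have h3 := F.ε_pos
  have hz : F.z e t = F.hm e + (t - F.tm e) * F.speed e := rfl
  have hz' : F.z e t = -F.hp e + (t - F.tp e) * F.speed e := by
    rw [← F.z_tp e, z, z]; ring
  unfold gap
  rcases lt_or_gt_of_ne (F.tm_ne_tp e) with h | h
  · have hs : F.speed e < 0 := div_neg_of_neg_of_pos (by linarith) (sub_pos.2 h)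
    rw [min_eq_left h.le, max_eq_right h.le, mem_Ioo]
    constructor
    · rintro ⟨a, b⟩
      exact ⟨by rw [hz']; nlinarith, by rw [hz]; nlinarith⟩
    · rintro ⟨a, b⟩
      rw [hz'] at a
      rw [hz] at b
      exact ⟨by nlinarith, by nlinarith⟩
  · have hs : 0 < F.speed e := div_pos_of_neg_of_neg (by linarith) (sub_neg.2 h)
    rw [min_eq_right h.le, max_eq_left h.le, mem_Ioo]
    constructor
    · rintro ⟨a, b⟩
      exact ⟨by rw [hz']; nlinarith, by rw [hz]; nlinarith⟩
    · rintro ⟨a, b⟩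
      rw [hz'] at a
      rw [hz] at b
      exact ⟨by nlinarith, by nlinarith⟩

lemma U_of_le (e : G.edgeSet) {x : ℝ} (h : F.ε ≤ x) : F.U e x = F.θ e + -F.δ := by
  rw [U, clamp_of_le ((one_le_div F.ε_pos).2 h), κ]
  ring

lemma U_of_ge (e : G.edgeSet) {x : ℝ} (h : x ≤ -F.ε) : F.U e x + Real.pi = F.θ e + F.δ := by
  rw [U, clamp_of_ge (by rw [div_le_iff₀ F.ε_pos]; linarith), κ]
  ring

lemma exp_add_pi_congr {a b : ℝ} :
    exp (a * I) = exp ((b + Real.pi : ℝ) * I) ↔ exp (b * I) = exp ((a + Real.pi : ℝ) * I) := by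
  rw [exp_mul_I_eq_iff, exp_mul_I_eq_iff]
  constructor
  · rintro ⟨k, rfl⟩
    exact ⟨-k - 1, by push_cast; ring⟩
  · rintro ⟨k, rfl⟩
    exact ⟨-k - 1, by push_cast; ring⟩

/-- Where a finger meets points above the height `ε`: on its first side at positive, and on its
second side at negative heights. -/
lemma mid_eq_iff (e : G.edgeSet) (s : ℝ) {M : ℂ} (hM : F.ε < M.re) :
    toRP2 (pt (F.mid e s)) = toRP2 (pt M) ↔
      (F.z e s = M.re ∧ exp (M.im * I) = exp ((F.θ e + -F.δ : ℝ) * I)) ∨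
      (F.z e s = -M.re ∧ exp (M.im * I) = exp ((F.θ e + F.δ : ℝ) * I)) := by
  rw [toRP2_pt_eq_iff']
  simp only [mid]
  refine or_congr (and_congr_right fun h => ?_) (and_congr_right fun h => ?_)
  · rw [F.U_of_le e (by linarith), eq_comm]
  · rw [exp_add_pi_congr, F.U_of_ge e (by linarith)]

lemma mid_eq_mid_iff (e f : G.edgeSet) (s t : ℝ) :
    toRP2 (pt (F.mid e s)) = toRP2 (pt (F.mid f t)) ↔
      (F.z e s = F.z f t ∧ exp (F.θ e * I) = exp (F.θ f * I)) ∨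
      (F.z e s = -F.z f t ∧ ∃ k : ℤ, 2 * (clamp (F.z e s / F.ε) * F.κ) =
        F.θ f - F.θ e + Real.pi + k * (2 * Real.pi)) := by
  rw [toRP2_pt_eq_iff']
  simp only [mid]
  refine or_congr (and_congr_right fun h => ?_) (and_congr_right fun h => ?_)
  · rw [h, exp_mul_I_eq_iff, exp_mul_I_eq_iff]
    refine exists_congr fun k => ?_
    unfold U
    constructor <;> intro h' <;> linarith
  · have h' : F.z f t = -F.z e s := by linarith
    rw [exp_mul_I_eq_iff, h']
    refine exists_congr fun k => ?_
    unfold U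
    rw [neg_div, clamp_neg]
    constructor <;> intro h' <;> linarith

lemma abs_clamp_κ (x : ℝ) : |2 * (clamp x * F.κ)| ≤ Real.pi - 2 * F.δ := by
  have h1 := abs_clamp_le x
  have h2 := F.κ_pos
  rw [abs_mul, abs_mul, abs_of_pos h2, abs_two]
  have h3 : |clamp x| * F.κ ≤ 1 * F.κ := mul_le_mul_of_nonneg_right h1 h2.le
  have : F.κ = Real.pi / 2 - F.δ := rfl
  linarith

/-- A finger does not meet itself. -/
lemma mid_injective (e : G.edgeSet) {s t : ℝ}
    (h : toRP2 (pt (F.mid e s)) = toRP2 (pt (F.mid e t))) : s = t := by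
  rcases (F.mid_eq_mid_iff e e s t).1 h with ⟨h1, -⟩ | ⟨-, k, hk⟩
  · exact F.z_injective e h1
  · exfalso
    have h1 := abs_le.1 (F.abs_clamp_κ (F.z e s / F.ε))
    rw [hk] at h1
    have hδ := F.δ_pos
    have hpi := Real.pi_pos
    rcases le_or_gt 0 k with h0 | h0
    · have : (0 : ℝ) ≤ k := by exact_mod_cast h0
      nlinarith [h1.2]
    · have : (k : ℝ) ≤ -1 := by exact_mod_cast (by omega : k ≤ -1)
      nlinarith [h1.1]

/-- Two fingers meet exactly once, in the passage through the crosscap. -/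
lemma exists_mid_eq_mid_iff {e f : G.edgeSet} (hef : e ≠ f) : ∃ c : ℝ, |c| < 1 ∧ ∀ s t,
    toRP2 (pt (F.mid e s)) = toRP2 (pt (F.mid f t)) ↔ F.z e s = F.ε * c ∧ F.z f t = -(F.ε * c) := by
  obtain ⟨α, h1, h2, k₀, hk₀⟩ := F.apart e f hef
  have hδ := F.δ_pos
  have hpi := Real.pi_pos
  have hκ := F.κ_pos
  have hε := F.ε_pos
  have hκ' : F.κ = Real.pi / 2 - F.δ := rfl
  have hc : |(α - Real.pi) / (2 * F.κ)| < 1 := by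
    rw [abs_div, abs_of_pos (by linarith : 0 < 2 * F.κ), div_lt_one (by linarith), abs_lt]
    constructor <;> linarith
  refine ⟨(α - Real.pi) / (2 * F.κ), hc, fun s t => ?_⟩
  rw [F.mid_eq_mid_iff]
  have hcl : ∀ x, F.z e s = x →
      ((∃ k : ℤ, 2 * (clamp (F.z e s / F.ε) * F.κ) = F.θ f - F.θ e + Real.pi + k * (2 * Real.pi)) ↔
        F.z e s = F.ε * ((α - Real.pi) / (2 * F.κ))) := by
    intro x _
    have e1 : F.z e s = F.ε * ((α - Real.pi) / (2 * F.κ)) ↔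
        F.z e s / F.ε = (α - Real.pi) / (2 * F.κ) := by
      rw [div_eq_iff hε.ne', mul_comm]
    rw [e1, ← clamp_eq_iff hc]
    rw [eq_div_iff (by linarith : 2 * F.κ ≠ 0)]
    constructor
    · rintro ⟨k, hk⟩
      rw [hk₀] at hk
      have h3 := abs_le.1 (F.abs_clamp_κ (F.z e s / F.ε))
      have hk1 : k + k₀ = -1 := by
        have h4 : 2 * (clamp (F.z e s / F.ε) * F.κ) = α + Real.pi + ((k + k₀ : ℤ) : ℝ) * (2 * Real.pi) := by
          push_cast; linarith
        rw [h4] at h3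
        by_contra hne
        rcases lt_or_gt_of_ne hne with h5 | h5
        · have : ((k + k₀ : ℤ) : ℝ) ≤ -2 := by exact_mod_cast (by omega : k + k₀ ≤ -2)
          nlinarith [h3.1]
        · have : (0 : ℝ) ≤ ((k + k₀ : ℤ) : ℝ) := by exact_mod_cast (by omega : 0 ≤ k + k₀)
          nlinarith [h3.2]
      have hk2 : (k : ℝ) = -1 - k₀ := by
        have : ((k + k₀ : ℤ) : ℝ) = -1 := by rw [hk1]; norm_num
        push_cast at this
        linarith
      rw [hk2] at hk
      linarith
    · intro h
      refine ⟨-1 - k₀, ?_⟩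
      rw [hk₀]
      push_cast
      linarith
  constructor
  · rintro (⟨-, h⟩ | ⟨h, h'⟩)
    · exfalso
      obtain ⟨k, hk⟩ := exp_mul_I_eq_iff.1 h
      have h3 : α = ((-k - k₀ : ℤ) : ℝ) * (2 * Real.pi) := by push_cast; linarith
      rcases le_or_gt (-k - k₀) 0 with h4 | h4
      · have : ((-k - k₀ : ℤ) : ℝ) ≤ 0 := by exact_mod_cast h4
        nlinarith
      · have : (1 : ℝ) ≤ ((-k - k₀ : ℤ) : ℝ) := by exact_mod_cast (by omega : 1 ≤ -k - k₀)
        nlinarith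
    · have := (hcl _ rfl).1 h'
      exact ⟨this, by linarith⟩
  · rintro ⟨h, h'⟩
    exact Or.inr ⟨by linarith, (hcl _ rfl).2 h⟩

/-- A finger is a straight line in cylindrical coordinates, except at the heights `±ε`. -/
lemma mid_affine (e : G.edgeSet) {s : ℝ} (hs : |F.z e s| ≠ F.ε) :
    ContDiffAt ℝ 1 (F.mid e) s ∧ deriv (F.mid e) s =
      ⟨F.speed e, if |F.z e s| < F.ε then F.speed e / F.ε * F.κ else 0⟩ := by
  have hε := F.ε_pos
  have hz : ∀ r, F.z e r = F.hm e - F.tm e * F.speed e + r * F.speed e := fun r => by unfold z; ring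
  rcases lt_or_gt_of_ne hs with h | h
  · rw [if_pos h]
    apply Spiral.contDiffAt_of_affine (a := ⟨F.hm e - F.tm e * F.speed e, F.θ e - Real.pi / 2 +
      (F.hm e - F.tm e * F.speed e) / F.ε * F.κ⟩)
    filter_upwards [(F.continuous_z e).abs.continuousAt.eventually_lt continuousAt_const h] with r hr
    have hcl : clamp (F.z e r / F.ε) = F.z e r / F.ε := by
      apply clamp_of_abs
      rw [abs_div, abs_of_pos hε, div_le_one hε]
      exact hr.le
    apply Complex.ext
    · simp [mid, hz r]
    · simp only [mid, U, hcl]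
      simp [hz r]
      ring
  · rw [if_neg (not_lt.2 h.le)]
    rcases lt_abs.1 h with h | h
    · apply Spiral.contDiffAt_of_affine (a := ⟨F.hm e - F.tm e * F.speed e, F.θ e + -F.δ⟩)
      filter_upwards [continuousAt_const.eventually_lt (F.continuous_z e).continuousAt h] with r hr
      apply Complex.ext
      · simp [mid, hz r]
      · simp only [mid, F.U_of_le e hr.le]
        simp
    · apply Spiral.contDiffAt_of_affine
        (a := ⟨F.hm e - F.tm e * F.speed e, F.θ e + F.δ - Real.pi⟩)
      filter_upwards [continuousAt_const.eventually_lt (F.continuous_z e).neg.continuousAt h]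
        with r hr
      have hr' : F.ε < -F.z e r := hr
      apply Complex.ext
      · simp [mid, hz r]
      · have := F.U_of_ge e (x := F.z e r) (by linarith)
        simp only [mid]
        simp
        linarith

lemma continuous_mid (e : G.edgeSet) : Continuous (F.mid e) := by
  have h1 := F.continuous_z e
  have h2 : Continuous fun t => F.U e (F.z e t) := by
    unfold U
    have := continuous_clamp
    fun_prop
  have : F.mid e = fun t => (F.z e t : ℂ) + (F.U e (F.z e t) : ℂ) * I := by
    funext t
    apply Complex.ext <;> simp [mid]
  rw [this]
  fun_prop

lemma mid_tm (e : G.edgeSet) : F.mid e (F.tm e) = C.L e (F.tm e) := by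
  apply Complex.ext
  · exact F.z_tm e
  · simp only [mid, z_tm, F.U_of_le e (F.lt_hm e).le]
    exact (F.ang_tm e).symm

lemma deck_mid_tp (e : G.edgeSet) : deck (F.mid e (F.tp e)) = C.L e (F.tp e) := by
  apply Complex.ext
  · simp [deck, mid, z_tp, hp]
  · have h1 := F.U_of_ge e (x := F.z e (F.tp e)) (by rw [F.z_tp e]; linarith [F.lt_hp e])
    have h2 : C.ang e (F.tp e) = _ := F.ang_tp e
    simp only [deck, mid]
    simp
    rw [h1, ← h2]
    rfl

end Fingers

/-! ### Leading edges through the crosscap -/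

namespace Fingers

variable {V : Type*} {G : SimpleGraph V} {C : CylDrawing G} (F : Fingers C) (l : G.edgeSet → ZMod 2)

open Classical in
/-- The lift of the new curve: edges with `l e = 1` are led through the crosscap by a finger. -/
noncomputable def path (e : G.edgeSet) (t : ℝ) : ℂ :=
  if l e = 1 ∧ t ∈ F.gap e then F.mid e t else C.L e t

/-- The curves of the new drawing. -/
noncomputable def arc (e : G.edgeSet) (t : ℝ) : RP2 := toRP2 (pt (F.path l e t))

variable {F l}

lemma arc_of_mem {e : G.edgeSet} {t : ℝ} (h : l e = 1 ∧ t ∈ F.gap e) :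
    F.arc l e t = toRP2 (pt (F.mid e t)) := by rw [arc, path, if_pos h]

lemma arc_of_not_mem {e : G.edgeSet} {t : ℝ} (h : ¬ (l e = 1 ∧ t ∈ F.gap e)) :
    F.arc l e t = toRP2 (pt (C.L e t)) := by rw [arc, path, if_neg h]

lemma eventually_arc_of_mem {e : G.edgeSet} {t : ℝ} (h : l e = 1 ∧ t ∈ F.gap e) :
    ∀ᶠ r in 𝓝 t, F.arc l e r = toRP2 (pt (F.mid e r)) := by
  filter_upwards [(F.isOpen_gap e).mem_nhds h.2] with r hr
  exact arc_of_mem ⟨h.1, hr⟩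

lemma eventually_arc_of_not_mem {e : G.edgeSet} {t : ℝ}
    (h : ¬ (l e = 1 ∧ t ∈ uIcc (F.tm e) (F.tp e))) :
    ∀ᶠ r in 𝓝 t, F.arc l e r = toRP2 (pt (C.L e r)) := by
  by_cases hl : l e = 1
  · have ht : t ∈ (uIcc (F.tm e) (F.tp e))ᶜ := fun h' => h ⟨hl, h'⟩
    filter_upwards [(isCompact_uIcc.isClosed.isOpen_compl).mem_nhds ht] with r hr
    exact arc_of_not_mem fun h' => hr (F.gap_subset_uIcc e h'.2)
  · exact Eventually.of_forall fun r => arc_of_not_mem fun h' => hl h'.1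

lemma continuous_arc (e : G.edgeSet) : Continuous (F.arc l e) := by
  have hout : Continuous fun t => toRP2 (pt (C.L e t)) :=
    continuous_toRP2.comp (continuous_pt.comp (C.cont e))
  have hin : Continuous fun t => toRP2 (pt (F.mid e t)) :=
    continuous_toRP2.comp (continuous_pt.comp (F.continuous_mid e))
  by_cases hl : l e = 1
  · have h1 : ContinuousOn (F.arc l e) (uIcc (F.tm e) (F.tp e)) := by
      refine hin.continuousOn.congr fun t ht => ?_
      rcases (F.mem_uIcc_iff e t).1 ht with h | rfl | rfl
      · exact arc_of_mem ⟨hl, h⟩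
      · refine (arc_of_not_mem ?_).trans (congrArg (fun L => toRP2 (pt L)) (F.mid_tm e).symm)
        rintro ⟨-, h⟩
        have := ((F.mem_gap_iff e _).1 h).2
        rw [z_tm] at this
        exact lt_irrefl _ this
      · have h3 : toRP2 (pt (C.L e (F.tp e))) = toRP2 (pt (F.mid e (F.tp e))) := by
          rw [← deck_mid_tp, toRP2_deck]
        refine (arc_of_not_mem ?_).trans h3
        rintro ⟨-, h⟩
        have := ((F.mem_gap_iff e _).1 h).1
        rw [z_tp] at this
        exact lt_irrefl _ this
    have h2 : ContinuousOn (F.arc l e) (F.gap e)ᶜ :=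
      hout.continuousOn.congr fun t ht => arc_of_not_mem fun h => ht h.2
    have h3 := h1.union_of_isClosed h2 isCompact_uIcc.isClosed (F.isOpen_gap e).isClosed_compl
    have h4 : uIcc (F.tm e) (F.tp e) ∪ (F.gap e)ᶜ = univ := by
      rw [eq_univ_iff_forall]
      intro t
      by_cases h : t ∈ F.gap e
      · exact Or.inl (F.gap_subset_uIcc e h)
      · exact Or.inr h
    rw [h4] at h3
    exact continuousOn_univ.1 h3
  · have : F.arc l e = fun t => toRP2 (pt (C.L e t)) := by
      funext t
      exact arc_of_not_mem fun h => hl h.1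
    rw [this]
    exact hout

lemma L_eq_iff {e f : G.edgeSet} {s t : ℝ} :
    toRP2 (pt (C.L e s)) = toRP2 (pt (C.L f t)) ↔ exp (C.L e s) = exp (C.L f t) :=
  toRP2_pt_eq_iff_of_pos (C.L_pos e s) (C.L_pos f t)

lemma z_lt_of_mem {e : G.edgeSet} {t : ℝ} (h : t ∈ F.gap e) : F.z e t < F.hm e ∧ -F.hp e < F.z e t :=
  ((F.mem_gap_iff e t).1 h).symm

lemma injOn_arc (e : G.edgeSet) : InjOn (F.arc l e) (Icc 0 1) := by
  -- a finger does not meet the rest of its edge, as this is higher on both meridians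
  have hmix : ∀ s ∈ F.gap e, ∀ t ∈ Icc (0 : ℝ) 1,
      toRP2 (pt (F.mid e s)) ≠ toRP2 (pt (C.L e t)) := by
    intro s hs t ht h
    obtain ⟨h1, h2⟩ := z_lt_of_mem hs
    rcases (F.mid_eq_iff e s (F.lt_L e t ht)).1 h with ⟨h3, h4⟩ | ⟨h3, h4⟩
    · have := F.low_self e (-F.δ) (Or.inr rfl) t ⟨ht, h4⟩
      rw [← h3] at this
      exact absurd h1 (not_lt.2 this)
    · have : F.hp e ≤ _ := F.low_self e F.δ (Or.inl rfl) t ⟨ht, h4⟩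
      linarith
  intro s hs t ht h
  by_cases h1 : l e = 1 ∧ s ∈ F.gap e <;> by_cases h2 : l e = 1 ∧ t ∈ F.gap e
  · rw [arc_of_mem h1, arc_of_mem h2] at h
    exact F.mid_injective e h
  · rw [arc_of_mem h1, arc_of_not_mem h2] at h
    exact absurd h (hmix s h1.2 t ht)
  · rw [arc_of_not_mem h1, arc_of_mem h2] at h
    exact absurd h.symm (hmix t h2.2 s hs)
  · rw [arc_of_not_mem h1, arc_of_not_mem h2, L_eq_iff] at h
    exact C.injOn e hs ht h

/-! ### Crossings of the new drawing -/

/-- The crossings of the finger of the edge `e` with the old part of the edge `f`. -/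
def sideCrossings (F : Fingers C) (l : G.edgeSet → ZMod 2) (e f : G.edgeSet) : Set (ℝ × ℝ) :=
  {p ∈ crossPairs (F.arc l e) (F.arc l f) |
    (l e = 1 ∧ p.1 ∈ F.gap e) ∧ ¬ (l f = 1 ∧ p.2 ∈ F.gap f)}

lemma mem_Ioo_of_gap {e : G.edgeSet} {t : ℝ} (h : t ∈ F.gap e) : t ∈ Ioo (0 : ℝ) 1 :=
  F.uIcc_subset e (F.gap_subset_uIcc e h)

/-- Both sides of a finger are crossed equally often. -/
lemma card_sideCrossings {e f : G.edgeSet} (hfe : f ≠ e) :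
    (sideCrossings F l e f).Finite ∧ ((sideCrossings F l e f).ncard : ZMod 2) = 0 := by
  by_cases hl : l e = 1
  swap
  · have : sideCrossings F l e f = ∅ := by
      ext p
      simp only [sideCrossings, mem_ofPred_eq, mem_empty_iff_false, iff_false]
      rintro ⟨-, ⟨h, -⟩, -⟩
      exact hl h
    rw [this]
    simp
  set A : Set (ℝ × ℝ) := {p ∈ sideCrossings F l e f | 0 < F.z e p.1} with hA
  set B : Set (ℝ × ℝ) := {p ∈ sideCrossings F l e f | F.z e p.1 < 0} with hB
  have hmem : ∀ p ∈ sideCrossings F l e f, p.1 ∈ F.gap e ∧ p.2 ∈ Icc (0 : ℝ) 1 ∧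
      ((F.z e p.1 = (C.L f p.2).re ∧ p.2 ∈ Hits (C.ang f) (F.θ e + -F.δ)) ∨
        (F.z e p.1 = -(C.L f p.2).re ∧ p.2 ∈ Hits (C.ang f) (F.θ e + F.δ))) := by
    rintro ⟨s, t⟩ ⟨⟨hs, ht, h⟩, h1, h2⟩
    simp only at hs ht h h1 h2
    have ht' := Ioo_subset_Icc_self ht
    rw [arc_of_mem h1, arc_of_not_mem h2] at h
    refine ⟨h1.2, ht', ?_⟩
    rcases (F.mid_eq_iff e s (F.lt_L f t ht')).1 h with h | h
    · exact Or.inl ⟨h.1, ht', h.2⟩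
    · exact Or.inr ⟨h.1, ht', h.2⟩
  have hback : ∀ s ∈ F.gap e, ∀ t τ, τ = F.δ ∨ τ = -F.δ → t ∈ Hits (C.ang f) (F.θ e + τ) →
      toRP2 (pt (F.mid e s)) = toRP2 (pt (C.L f t)) → (s, t) ∈ sideCrossings F l e f := by
    intro s hs t τ hτ ht h
    have h1 := (F.regular e f τ hτ t ht).1
    have h2 : ¬ (l f = 1 ∧ t ∈ F.gap f) := fun h' =>
      F.not_mem e f τ hτ hfe t ht (F.gap_subset_uIcc f h'.2)
    exact ⟨⟨mem_Ioo_of_gap hs, h1, by rw [arc_of_mem ⟨hl, hs⟩, arc_of_not_mem h2, h]⟩, ⟨hl, hs⟩, h2⟩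
  have hbijA : BijOn Prod.snd A
      {t ∈ Hits (C.ang f) (F.θ e + -F.δ) | (C.L f t).re < (C.L e (F.foot e (-F.δ))).re} := by
    refine ⟨?_, ?_, ?_⟩
    · rintro ⟨s, t⟩ ⟨hp, hz⟩
      obtain ⟨h1, h2, ⟨h3, h4⟩ | ⟨h3, h4⟩⟩ := hmem _ hp
      · refine ⟨h4, ?_⟩
        rw [← h3]
        exact (z_lt_of_mem h1).1
      · simp only at hz h3
        linarith [C.L_pos f t]
    · rintro ⟨s, t⟩ ⟨hp, hz⟩ ⟨s', t'⟩ ⟨hp', hz'⟩ htt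
      simp only at htt
      subst htt
      obtain ⟨h1, h2, ⟨h3, h4⟩ | ⟨h3, h4⟩⟩ := hmem _ hp
      · obtain ⟨h1', h2', ⟨h3', h4'⟩ | ⟨h3', h4'⟩⟩ := hmem _ hp'
        · exact Prod.ext (F.z_injective e (h3.trans h3'.symm)) rfl
        · simp only at hz' h3'
          linarith [C.L_pos f t]
      · simp only at hz h3
        linarith [C.L_pos f t]
    · rintro t ⟨ht, hlt⟩
      obtain ⟨s, hs⟩ := F.exists_z_eq e (C.L f t).re
      have hpos := C.L_pos f t
      have hgap : s ∈ F.gap e := (F.mem_gap_iff e s).2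
        ⟨by rw [hs]; linarith [F.lt_hp e, F.ε_pos], by rw [hs]; exact hlt⟩
      refine ⟨(s, t), ⟨hback s hgap t _ (Or.inr rfl) ht ?_, by simp only [hs]; exact hpos⟩, rfl⟩
      exact (F.mid_eq_iff e s (F.lt_L f t ht.1)).2 (Or.inl ⟨hs, ht.2⟩)
  have hbijB : BijOn Prod.snd B
      {t ∈ Hits (C.ang f) (F.θ e + F.δ) | (C.L f t).re < (C.L e (F.foot e F.δ)).re} := by
    refine ⟨?_, ?_, ?_⟩
    · rintro ⟨s, t⟩ ⟨hp, hz⟩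
      obtain ⟨h1, h2, ⟨h3, h4⟩ | ⟨h3, h4⟩⟩ := hmem _ hp
      · simp only at hz h3
        linarith [C.L_pos f t]
      · refine ⟨h4, ?_⟩
        have h5 := (z_lt_of_mem h1).2
        simp only at h3 h5 ⊢
        have h6 : F.hp e = (C.L e (F.foot e F.δ)).re := rfl
        linarith
    · rintro ⟨s, t⟩ ⟨hp, hz⟩ ⟨s', t'⟩ ⟨hp', hz'⟩ htt
      simp only at htt
      subst htt
      obtain ⟨h1, h2, ⟨h3, h4⟩ | ⟨h3, h4⟩⟩ := hmem _ hp
      · simp only at hz h3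
        linarith [C.L_pos f t]
      · obtain ⟨h1', h2', ⟨h3', h4'⟩ | ⟨h3', h4'⟩⟩ := hmem _ hp'
        · simp only at hz' h3'
          linarith [C.L_pos f t]
        · exact Prod.ext (F.z_injective e (h3.trans h3'.symm)) rfl
    · rintro t ⟨ht, hlt⟩
      obtain ⟨s, hs⟩ := F.exists_z_eq e (-(C.L f t).re)
      have hpos := C.L_pos f t
      have h6 : F.hp e = (C.L e (F.foot e F.δ)).re := rfl
      have hgap : s ∈ F.gap e := (F.mem_gap_iff e s).2
        ⟨by rw [hs]; linarith, by rw [hs]; linarith [F.lt_hm e, F.ε_pos]⟩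
      refine ⟨(s, t), ⟨hback s hgap t _ (Or.inl rfl) ht ?_, by simp only [hs]; linarith⟩, rfl⟩
      exact (F.mid_eq_iff e s (F.lt_L f t ht.1)).2 (Or.inr ⟨hs, ht.2⟩)
  have hAfin : A.Finite := Finite.of_finite_image (by
    rw [hbijA.image_eq]; exact F.low_finite e f _ (Or.inr rfl)) hbijA.injOn
  have hBfin : B.Finite := Finite.of_finite_image (by
    rw [hbijB.image_eq]; exact F.low_finite e f _ (Or.inl rfl)) hbijB.injOn
  have hAB : sideCrossings F l e f = A ∪ B := by
    ext p
    constructor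
    · intro hp
      have hne : F.z e p.1 ≠ 0 := by
        have := C.L_pos f p.2
        obtain ⟨-, -, ⟨h, -⟩ | ⟨h, -⟩⟩ := hmem p hp <;> rw [h] <;> linarith
      rcases lt_or_gt_of_ne hne with h | h
      · exact Or.inr ⟨hp, h⟩
      · exact Or.inl ⟨hp, h⟩
    · rintro (h | h) <;> exact h.1
  have hdisj : Disjoint A B := by
    rw [Set.disjoint_left]
    rintro p ⟨-, h1⟩ ⟨-, h2⟩
    exact lt_asymm h1 h2
  rw [hAB]
  refine ⟨hAfin.union hBfin, ?_⟩
  rw [ncard_union_eq hdisj hAfin hBfin, ← hbijA.injOn.ncard_image, ← hbijB.injOn.ncard_image,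
    hbijA.image_eq, hbijB.image_eq, F.low_ncard, Nat.cast_add, CharTwo.add_self_eq_zero]

/-- The old parts of two edges cross as before: no crossing lies on a removed part. -/
lemma oldCrossings_eq {e f : G.edgeSet} (hef : e ≠ f) :
    {p ∈ crossPairs (F.arc l e) (F.arc l f) |
      ¬ (l e = 1 ∧ p.1 ∈ F.gap e) ∧ ¬ (l f = 1 ∧ p.2 ∈ F.gap f)} =
    crossPairs (fun t => exp (C.L e t)) fun t => exp (C.L f t) := by
  ext ⟨s, t⟩
  constructor
  · rintro ⟨⟨hs, ht, h⟩, h1, h2⟩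
    simp only at hs ht h h1 h2
    rw [arc_of_not_mem h1, arc_of_not_mem h2, L_eq_iff] at h
    exact ⟨hs, ht, h⟩
  · rintro ⟨hs, ht, h⟩
    simp only at hs ht h
    have h1 : ¬ (l e = 1 ∧ s ∈ F.gap e) := fun h' => F.no_cross e f hef.symm s
      (F.gap_subset_uIcc e h'.2) t (Ioo_subset_Icc_self ht) h
    have h2 : ¬ (l f = 1 ∧ t ∈ F.gap f) := fun h' => F.no_cross f e hef t
      (F.gap_subset_uIcc f h'.2) s (Ioo_subset_Icc_self hs) h.symm
    exact ⟨⟨hs, ht, by rw [arc_of_not_mem h1, arc_of_not_mem h2, L_eq_iff]; exact h⟩, h1, h2⟩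

/-- Two fingers cross exactly once. -/
lemma card_fingerCrossings {e f : G.edgeSet} (hef : e ≠ f) :
    {p ∈ crossPairs (F.arc l e) (F.arc l f) |
      (l e = 1 ∧ p.1 ∈ F.gap e) ∧ (l f = 1 ∧ p.2 ∈ F.gap f)}.Finite ∧
    (({p ∈ crossPairs (F.arc l e) (F.arc l f) |
      (l e = 1 ∧ p.1 ∈ F.gap e) ∧ (l f = 1 ∧ p.2 ∈ F.gap f)}.ncard : ℕ) : ZMod 2) = l e * l f := by
  by_cases hl : l e = 1 ∧ l f = 1
  · obtain ⟨hl1, hl2⟩ := hl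
    obtain ⟨c, hc, hiff⟩ := F.exists_mid_eq_mid_iff hef
    obtain ⟨s, hs⟩ := F.exists_z_eq e (F.ε * c)
    obtain ⟨t, ht⟩ := F.exists_z_eq f (-(F.ε * c))
    have hε := F.ε_pos
    have hc' := abs_lt.1 hc
    have hsg : s ∈ F.gap e := (F.mem_gap_iff e s).2
      ⟨by rw [hs]; nlinarith [F.lt_hp e], by rw [hs]; nlinarith [F.lt_hm e]⟩
    have htg : t ∈ F.gap f := (F.mem_gap_iff f t).2
      ⟨by rw [ht]; nlinarith [F.lt_hp f], by rw [ht]; nlinarith [F.lt_hm f]⟩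
    have : {p ∈ crossPairs (F.arc l e) (F.arc l f) |
        (l e = 1 ∧ p.1 ∈ F.gap e) ∧ (l f = 1 ∧ p.2 ∈ F.gap f)} = {(s, t)} := by
      ext ⟨s', t'⟩
      simp only [mem_singleton_iff]
      constructor
      · rintro ⟨⟨-, -, h⟩, h1, h2⟩
        simp only at h h1 h2
        rw [arc_of_mem h1, arc_of_mem h2, hiff] at h
        rw [F.z_injective e (h.1.trans hs.symm), F.z_injective f (h.2.trans ht.symm)]
      · intro h
        rw [Prod.mk.injEq] at h
        obtain ⟨rfl, rfl⟩ := h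
        refine ⟨⟨mem_Ioo_of_gap hsg, mem_Ioo_of_gap htg, ?_⟩, ⟨hl1, hsg⟩, hl2, htg⟩
        rw [arc_of_mem ⟨hl1, hsg⟩, arc_of_mem ⟨hl2, htg⟩, hiff]
        exact ⟨hs, ht⟩
    rw [this, hl1, hl2]
    simp
  · have : {p ∈ crossPairs (F.arc l e) (F.arc l f) |
        (l e = 1 ∧ p.1 ∈ F.gap e) ∧ (l f = 1 ∧ p.2 ∈ F.gap f)} = ∅ := by
      ext p
      simp only [mem_ofPred_eq, mem_empty_iff_false, iff_false]
      rintro ⟨-, h1, h2⟩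
      exact hl ⟨h1.1, h2.1⟩
    rw [this]
    refine ⟨finite_empty, ?_⟩
    have key : ∀ a b : ZMod 2, ¬ (a = 1 ∧ b = 1) → 0 = a * b := by decide
    simpa using key _ _ hl

/-- Leading edges through the crosscap adds one crossing, modulo 2, for each pair of such edges. -/
theorem card_crossPairs {e f : G.edgeSet} (hef : e ≠ f) :
    (crossPairs (F.arc l e) (F.arc l f)).Finite ∧
    ((crossPairs (F.arc l e) (F.arc l f)).ncard : ZMod 2) =
      (crossPairs (fun t => exp (C.L e t)) fun t => exp (C.L f t)).ncard + l e * l f := by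
  set W := crossPairs (F.arc l e) (F.arc l f) with hW
  set W₁ := {p ∈ W | ¬ (l e = 1 ∧ p.1 ∈ F.gap e) ∧ ¬ (l f = 1 ∧ p.2 ∈ F.gap f)} with hW₁
  set W₂ := sideCrossings F l e f with hW₂
  set W₃ := Prod.swap '' sideCrossings F l f e with hW₃
  set W₄ := {p ∈ W | (l e = 1 ∧ p.1 ∈ F.gap e) ∧ (l f = 1 ∧ p.2 ∈ F.gap f)} with hW₄
  have hW₃' : W₃ = {p ∈ W | ¬ (l e = 1 ∧ p.1 ∈ F.gap e) ∧ (l f = 1 ∧ p.2 ∈ F.gap f)} := by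
    ext ⟨s, t⟩
    constructor
    · rintro ⟨⟨t', s'⟩, ⟨⟨ht, hs, h⟩, h1, h2⟩, heq⟩
      simp only [Prod.swap_prod_mk, Prod.mk.injEq] at heq
      obtain ⟨rfl, rfl⟩ := heq
      exact ⟨⟨hs, ht, h.symm⟩, h2, h1⟩
    · rintro ⟨⟨hs, ht, h⟩, h1, h2⟩
      exact ⟨(t, s), ⟨⟨ht, hs, h.symm⟩, h2, h1⟩, rfl⟩
  have hunion : W = W₁ ∪ W₂ ∪ (W₃ ∪ W₄) := by
    rw [hW₃']
    ext p
    simp only [mem_union, hW₁, hW₂, hW₄, sideCrossings, mem_ofPred_eq]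
    tauto
  have hfin₁ : W₁.Finite := by rw [hW₁, oldCrossings_eq hef]; exact C.finite e f hef
  obtain ⟨hfin₂, hc₂⟩ := card_sideCrossings (F := F) (l := l) hef.symm
  obtain ⟨hfin₃, hc₃⟩ := card_sideCrossings (F := F) (l := l) hef
  obtain ⟨hfin₄, hc₄⟩ := card_fingerCrossings (F := F) (l := l) hef
  have hfin₃' : W₃.Finite := hfin₃.image _
  have hd₁ : Disjoint W₁ W₂ := by
    rw [Set.disjoint_left]
    rintro p ⟨-, h1, -⟩ ⟨-, h2, -⟩
    exact h1 h2
  have hd₂ : Disjoint W₃ W₄ := by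
    rw [hW₃', Set.disjoint_left]
    rintro p ⟨-, h1, -⟩ ⟨-, h2, -⟩
    exact h1 h2
  have hd₃ : Disjoint (W₁ ∪ W₂) (W₃ ∪ W₄) := by
    rw [hW₃', Set.disjoint_left]
    rintro p (⟨-, -, h1⟩ | ⟨-, -, h1⟩) (⟨-, -, h2⟩ | ⟨-, -, h2⟩) <;> exact h1 h2
  rw [hunion]
  refine ⟨(hfin₁.union hfin₂).union (hfin₃'.union hfin₄), ?_⟩
  rw [ncard_union_eq hd₃ (hfin₁.union hfin₂) (hfin₃'.union hfin₄), ncard_union_eq hd₁ hfin₁ hfin₂,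
    ncard_union_eq hd₂ hfin₃' hfin₄, hW₃, ncard_image_of_injective _ Prod.swap_injective]
  push_cast
  rw [hc₂, hc₃, hc₄, hW₁, oldCrossings_eq hef]
  ring

lemma crossTransversally_side {e f : G.edgeSet} (hfe : f ≠ e) {s t : ℝ} (ht : t ∈ Icc (0 : ℝ) 1)
    (h1 : l e = 1 ∧ s ∈ F.gap e) (h2 : ¬ (l f = 1 ∧ t ∈ F.gap f))
    (h : F.arc l e s = F.arc l f t) :
    CrossTransversally toRP2 (F.arc l e) s (F.arc l f) t := by
  have h' := h
  rw [arc_of_mem h1, arc_of_not_mem h2] at h'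
  have hlt := F.lt_L f t ht
  have hε := F.ε_pos
  obtain ⟨τ, hτ, hhit, habs⟩ : ∃ τ, (τ = F.δ ∨ τ = -F.δ) ∧ t ∈ Hits (C.ang f) (F.θ e + τ) ∧
      F.ε < |F.z e s| := by
    rcases (F.mid_eq_iff e s hlt).1 h' with ⟨h3, h4⟩ | ⟨h3, h4⟩
    · exact ⟨_, Or.inr rfl, ⟨ht, h4⟩, by rw [h3, abs_of_pos (hε.trans hlt)]; exact hlt⟩
    · exact ⟨_, Or.inl rfl, ⟨ht, h4⟩, by rw [h3, abs_neg, abs_of_pos (hε.trans hlt)]; exact hlt⟩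
  obtain ⟨-, h5, h6⟩ := F.regular e f τ hτ t hhit
  have h7 := F.not_mem e f τ hτ hfe t hhit
  obtain ⟨h8, h9⟩ := F.mid_affine e habs.ne'
  rw [if_neg (not_lt.2 habs.le)] at h9
  have h10 := F.speed_ne_zero e
  refine crossTransversally_toRP2 (eventually_arc_of_mem h1)
    (eventually_arc_of_not_mem fun h => h7 h.2) h8 h5 h' ?_ ?_
  · intro _
    rw [h9]
    simpa [det2] using ⟨h10, h6⟩
  · intro _
    rw [h9]
    simpa [det2] using ⟨h10, h6⟩

lemma crossTransversally_arc {e f : G.edgeSet} (hef : e ≠ f) {s t : ℝ} (hs : s ∈ Ioo (0 : ℝ) 1)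
    (ht : t ∈ Ioo (0 : ℝ) 1) (h : F.arc l e s = F.arc l f t) :
    CrossTransversally toRP2 (F.arc l e) s (F.arc l f) t := by
  by_cases h1 : l e = 1 ∧ s ∈ F.gap e <;> by_cases h2 : l f = 1 ∧ t ∈ F.gap f
  · have h' := h
    rw [arc_of_mem h1, arc_of_mem h2] at h'
    obtain ⟨c, hc, hiff⟩ := F.exists_mid_eq_mid_iff hef
    obtain ⟨h3, h4⟩ := (hiff s t).1 h'
    have hε := F.ε_pos
    have hκ := F.κ_pos
    have e1 : |F.z e s| < F.ε := by
      rw [h3, abs_mul, abs_of_pos hε]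
      nlinarith
    have e2 : |F.z f t| < F.ε := by
      rw [h4, abs_neg, abs_mul, abs_of_pos hε]
      nlinarith
    obtain ⟨c1, d1⟩ := F.mid_affine e e1.ne
    obtain ⟨c2, d2⟩ := F.mid_affine f e2.ne
    rw [if_pos e1] at d1
    rw [if_pos e2] at d2
    have n1 := F.speed_ne_zero e
    have n2 := F.speed_ne_zero f
    refine crossTransversally_toRP2 (eventually_arc_of_mem h1) (eventually_arc_of_mem h2) c1 c2 h'
      ?_ ?_
    · -- The angles of two fingers at the same height are different.
      intro hexp
      exfalso
      obtain ⟨hre, k, hk⟩ := exp_eq_exp_iff.1 hexp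
      simp only [mid, U] at hre hk
      rw [hre] at hk
      obtain ⟨α, a1, a2, k₀, hk₀⟩ := F.apart e f hef
      have hδ := F.δ_pos
      have hpi := Real.pi_pos
      have h3 : α = ((-k - k₀ : ℤ) : ℝ) * (2 * Real.pi) := by push_cast; linarith
      rcases le_or_gt (-k - k₀) 0 with h4 | h4
      · have : ((-k - k₀ : ℤ) : ℝ) ≤ 0 := by exact_mod_cast h4
        nlinarith
      · have : (1 : ℝ) ≤ ((-k - k₀ : ℤ) : ℝ) := by exact_mod_cast (by omega : 1 ≤ -k - k₀)
        nlinarith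
    · intro _
      rw [d1, d2, det2]
      have : F.speed e * (F.speed f / F.ε * F.κ) - F.speed e / F.ε * F.κ * -F.speed f ≠ 0 := by
        have e3 : F.speed e * (F.speed f / F.ε * F.κ) - F.speed e / F.ε * F.κ * -F.speed f =
          2 * F.speed e * F.speed f * F.κ / F.ε := by ring
        rw [e3]
        positivity
      simpa using this
  · exact crossTransversally_side hef.symm (Ioo_subset_Icc_self ht) h1 h2 h
  · exact (crossTransversally_side hef (Ioo_subset_Icc_self hs) h2 h1 h.symm).symm
  · have h' := h
    rw [arc_of_not_mem h1, arc_of_not_mem h2, L_eq_iff] at h'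
    obtain ⟨c1, c2, hd⟩ := C.transversal e f hef s hs t ht h'
    refine crossTransversally_toRP2 (eventually_arc_of_not_mem fun h3 => ?_)
      (eventually_arc_of_not_mem fun h3 => ?_) c1 c2 (L_eq_iff.2 h') (fun _ => hd) fun h3 => ?_
    · exact F.no_cross e f hef.symm s h3.2 t (Ioo_subset_Icc_self ht) h'
    · exact F.no_cross f e hef t h3.2 s (Ioo_subset_Icc_self hs) h'.symm
    · exfalso
      have := (exp_eq_exp_iff.1 h3).1
      simp [deck] at this
      linarith [C.L_pos e s, C.L_pos f t]

lemma regularAt_arc {e : G.edgeSet} {t : ℝ} (hreg : ContDiffAt ℝ 1 (C.L e) t ∧ deriv (C.L e) t ≠ 0)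
    (h1 : t ≠ F.tm e) (h2 : t ≠ F.tp e) (h3 : F.z e t ≠ F.ε) (h4 : F.z e t ≠ -F.ε) :
    RegularAt toRP2 (F.arc l e) t := by
  by_cases h : l e = 1 ∧ t ∈ F.gap e
  · obtain ⟨c, d⟩ := F.mid_affine e (s := t) (by
      intro habs
      rcases abs_eq F.ε_pos.le |>.1 habs with h' | h'
      exacts [h3 h', h4 h'])
    refine regularAt_pt (eventually_arc_of_mem h) c ?_
    rw [d]
    intro h0
    exact F.speed_ne_zero e (congrArg Complex.re h0)
  · refine regularAt_pt (eventually_arc_of_not_mem fun h' => ?_) hreg.1 hreg.2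
    rcases (F.mem_uIcc_iff e t).1 h'.2 with h5 | h5 | h5
    exacts [h ⟨h'.1, h5⟩, h1 h5, h2 h5]

lemma arc_zero (e : G.edgeSet) : F.arc l e 0 = toRP2 (pt (C.L e 0)) :=
  arc_of_not_mem fun h => lt_irrefl _ (mem_Ioo_of_gap h.2).1

lemma arc_one (e : G.edgeSet) : F.arc l e 1 = toRP2 (pt (C.L e 1)) :=
  arc_of_not_mem fun h => lt_irrefl _ (mem_Ioo_of_gap h.2).2

/-- The drawing on the projective plane in which the edges `e` with `l e = 1` are led through the
crosscap. -/
noncomputable def drawing (F : Fingers C) (l : G.edgeSet → ZMod 2) : RP2Drawing G where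
  vertex v := toRP2 (pt (C.P v))
  vertex_injective u v h := C.P_inj u v ((toRP2_pt_eq_iff_of_pos (C.P_pos u) (C.P_pos v)).1 h)
  curve := F.arc l
  curve_continuousOn e := (continuous_arc e).continuousOn
  curve_injOn := injOn_arc
  curve_ends e := by
    obtain ⟨u, v, h, h0, h1⟩ := C.ends e
    refine ⟨u, v, h, ?_, ?_⟩
    · rw [arc_zero, toRP2_pt_eq_iff_of_pos (C.L_pos e 0) (C.P_pos u), h0]
    · rw [arc_one, toRP2_pt_eq_iff_of_pos (C.L_pos e 1) (C.P_pos v), h1]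
  curve_ne_vertex e t ht w h := by
    by_cases h1 : l e = 1 ∧ t ∈ F.gap e
    · rw [arc_of_mem h1] at h
      rcases (F.mid_eq_iff e t (F.lt_P w)).1 h with ⟨-, h⟩ | ⟨-, h⟩
      · exact F.vertex e _ (Or.inr rfl) w h
      · exact F.vertex e _ (Or.inl rfl) w h
    · rw [arc_of_not_mem h1, toRP2_pt_eq_iff_of_pos (C.L_pos e t) (C.P_pos w)] at h
      exact C.ne_vertex e t ht w h
  curve_regular e := by
    have hfin : ({F.tm e, F.tp e} ∪ F.z e ⁻¹' {F.ε, -F.ε}).Finite :=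
      (toFinite _).union ((toFinite _).preimage (F.z_injective e).injOn)
    refine ((C.regular e).union hfin).subset ?_
    rintro t ⟨ht, hn⟩
    by_contra hnot
    have hreg : ContDiffAt ℝ 1 (C.L e) t ∧ deriv (C.L e) t ≠ 0 := by
      by_contra hc
      exact hnot (Or.inl ⟨ht, hc⟩)
    simp only [mem_union, mem_insert_iff, mem_singleton_iff, mem_preimage, not_or] at hnot
    obtain ⟨-, ⟨h2, h3⟩, h4, h5⟩ := hnot
    exact hn (regularAt_arc hreg h2 h3 h4 h5)
  crossings_finite e f hef := by
    rw [← (bijOn_crossPairs (injOn_arc e) (injOn_arc f)).image_eq]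
    exact (card_crossPairs hef).1.image _
  crossings_transversal e f hef s hs t ht h := crossTransversally_arc hef hs ht h

lemma passesOnce_drawing {e : G.edgeSet} (hl : l e = 1) : PassesOnce (F.drawing l) e := by
  obtain ⟨t, ht⟩ := F.exists_z_eq e 0
  have hε := F.ε_pos
  have hgap : t ∈ F.gap e := (F.mem_gap_iff e t).2
    ⟨by rw [ht]; linarith [F.lt_hp e], by rw [ht]; linarith [F.lt_hm e]⟩
  have habs : |F.z e t| < F.ε := by rw [ht, abs_zero]; exact hε
  obtain ⟨c, d⟩ := F.mid_affine e habs.ne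
  refine ⟨t, mem_Ioo_of_gap hgap, ⟨F.U e 0, ?_⟩, ?_⟩
  · have hline : (fun φ : ℝ => (⟨0, φ⟩ : ℂ)) =ᶠ[𝓝 (F.U e 0)] fun φ : ℝ => 0 + (φ : ℂ) * I :=
      Eventually.of_forall fun φ => by apply Complex.ext <;> simp
    obtain ⟨c', d'⟩ := Spiral.contDiffAt_of_affine hline
    refine crossTransversally_pt (eventually_arc_of_mem ⟨hl, hgap⟩)
      (Eventually.of_forall crosscap_eq) c c' ?_ ?_
    · congr 1
      simp only [mid, ht]
    · rw [d, d', det2]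
      simpa using F.speed_ne_zero e
  · intro r hr hmem
    have hmem' : F.arc l e r ∈ range crosscap := hmem
    by_cases h : l e = 1 ∧ r ∈ F.gap e
    · rw [arc_of_mem h] at hmem'
      have : F.z e r = 0 := re_eq_zero_of_mem_crosscap hmem'
      exact F.z_injective e (this.trans ht.symm)
    · rw [arc_of_not_mem h] at hmem'
      exact absurd (re_eq_zero_of_mem_crosscap hmem') (C.L_pos e r).ne'

end Fingers

/-- Edges of a drawing on the sphere can be led through a crosscap as prescribed. -/
theorem exists_crosscap_drawing {V : Type*} [Finite V] {G : SimpleGraph V} (D : SphereDrawing G)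
    (l : G.edgeSet → ZMod 2) : ∃ D' : RP2Drawing G,
      (∀ e f : G.edgeSet, e ≠ f → D'.cr e f = D.cr e f + l e * l f) ∧
      (∀ e f : G.edgeSet, l e = 0 → l f = 0 → ∀ s ∈ Icc (0 : ℝ) 1, ∀ t ∈ Icc (0 : ℝ) 1,
        D'.curve e s = D'.curve f t → D.curve e s = D.curve f t) ∧
      (∀ v : V, D'.vertex v ∉ range crosscap) ∧
      (∀ e : G.edgeSet, l e = 0 → Disjoint (D'.arc e) (range crosscap)) ∧
      (∀ e : G.edgeSet, l e = 1 → PassesOnce D' e) := by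
  obtain ⟨C, hC⟩ := exists_cylDrawing D
  obtain ⟨F⟩ := exists_fingers C
  have hzero : ∀ e t, l e = 0 → F.arc l e t = toRP2 (pt (C.L e t)) := fun e t he =>
    Fingers.arc_of_not_mem fun h => zero_ne_one (he.symm.trans h.1)
  refine ⟨F.drawing l, fun e f hef => ?_, fun e f he hf s hs t ht h => ?_, fun v hv => ?_,
    fun e he => ?_, fun e he => Fingers.passesOnce_drawing he⟩
  · rw [Drawing.cr_eq_ncard, Drawing.cr_eq_ncard]
    have h1 : crossPairs (D.curve e) (D.curve f) =
        crossPairs (fun t => exp (C.L e t)) fun t => exp (C.L f t) := by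
      ext ⟨s, t⟩
      exact and_congr_right fun hs => and_congr_right fun ht =>
        hC e f s (Ioo_subset_Icc_self hs) t (Ioo_subset_Icc_self ht)
    rw [h1]
    exact (Fingers.card_crossPairs hef).2
  · have h' : F.arc l e s = F.arc l f t := h
    rw [hzero e s he, hzero f t hf, Fingers.L_eq_iff] at h'
    exact (hC e f s hs t ht).2 h'
  · exact (C.P_pos v).ne' (re_eq_zero_of_mem_crosscap hv)
  · rw [Set.disjoint_left]
    rintro _ ⟨t, ht, rfl⟩ hmem
    have hmem' : F.arc l e t ∈ range crosscap := hmem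
    rw [hzero e t he] at hmem'
    exact (C.L_pos e t).ne' (re_eq_zero_of_mem_crosscap hmem')

end ProjHT

theorem mainTheorem7 {V : Type*} [Finite V] (G : SimpleGraph V) :
    ((∃ (D : ProjHT.SphereDrawing G) (l : G.edgeSet → ZMod 2), ProjHT.IsProjectiveHT D l) ↔
      ∃ D : ProjHT.RP2Drawing G, ProjHT.IsHT D) ∧
    (∀ (D : ProjHT.SphereDrawing G) (l : G.edgeSet → ZMod 2), ProjHT.IsProjectiveHT D l →
      ∃ D' : ProjHT.RP2Drawing G, ProjHT.IsHT D' ∧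
        (∀ e f : G.edgeSet, e ≠ f → D'.cr e f = D.cr e f + l e * l f) ∧
        (∀ e f : G.edgeSet, l e = 0 → l f = 0 →
          (Disjoint (D.arc e) (D.arc f) → Disjoint (D'.arc e) (D'.arc f)) ∧
          (Disjoint (D.openArc e) (D.openArc f) → Disjoint (D'.openArc e) (D'.openArc f))) ∧
        (∀ v : V, D'.vertex v ∉ Set.range ProjHT.crosscap) ∧
        (∀ e : G.edgeSet, l e = 0 → Disjoint (D'.arc e) (Set.range ProjHT.crosscap)) ∧
        (∀ e : G.edgeSet, l e = 1 → ProjHT.PassesOnce D' e)) := by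
  refine ⟨⟨?_, ?_⟩, fun D l hD => ?_⟩
  · rintro ⟨D, l, hD⟩
    obtain ⟨D', h1, -⟩ := ProjHT.exists_crosscap_drawing D l
    exact ⟨D', fun e f hef => by rw [h1 e f hef.ne, hD e f hef, CharTwo.add_self_eq_zero]⟩
  · rintro ⟨D, hD⟩
    exact ProjHT.exists_isProjectiveHT D hD
  · obtain ⟨D', h1, h2, h3, h4, h5⟩ := ProjHT.exists_crosscap_drawing D l
    refine ⟨D', fun e f hef => ?_, h1, fun e f he hf => ⟨fun hd => ?_, fun hd => ?_⟩, h3, h4, h5⟩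
    · rw [h1 e f hef.ne, hD e f hef, CharTwo.add_self_eq_zero]
    · rw [Set.disjoint_left] at hd ⊢
      rintro _ ⟨s, hs, rfl⟩ ⟨t, ht, h⟩
      exact hd ⟨s, hs, rfl⟩ ⟨t, ht, (h2 e f he hf s hs t ht h.symm).symm⟩
    · rw [Set.disjoint_left] at hd ⊢
      rintro _ ⟨s, hs, rfl⟩ ⟨t, ht, h⟩
      exact hd ⟨s, hs, rfl⟩ ⟨t, ht, (h2 e f he hf s (Set.Ioo_subset_Icc_self hs) t
        (Set.Ioo_subset_Icc_self ht) h.symm).symm⟩
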